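/- Let $k$ be a commutative ring. For finite sets of signed points $Y_0,Y_1$ let $\mathbf{Cob}_2(Y_0,Y_1)$ be the category whose objects are compact oriented 1-dimensional cobordisms $W:Y_0\to Y_1$ and whose morphisms are the diffeomorphism classes, relative to the boundary, of compact oriented 2-bordisms with corners. Let $\mathcal C(Y_0,Y_1)$ be the additive closure (formal direct sums and matrices) of its $k$-linearization modulo Bar-Natan's relations: $S\amalg S^2=0$, $S\amalg T^2=2S$, and $4Tu$: for four disjoint discs $1,2,3,4$ in a 2-bordism, if $C_{ij}$ denotes the result of joining the discs $i,j$ by a tube, then $C_{12}+C_{34}=C_{13}+C_{24}$. For a complex $W$ put $W[n]^i=W^{i-n}$ with differential $(-1)^nd$. **Brackets.** Let $D$ be an oriented singular tangle diagram in $\mathbb R\times[0,1]$ (finitely many ordinary crossings and double points, forming together a finite set $V$), with a checkerboard coloring $\chi$ of its complement and a total order on $V$; for $A\subset V$ and $a\in V$ let $\mu_a(A)=\#\{a'\in A: a'<a\}$. Draw each crossing with both strands running upwards. A negative crossing has the horizontal smoothing as 0-smoothing and the vertical smoothing $)($ as 1-smoothing; a positive crossing has the vertical smoothing as 0-smoothing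 and the horizontal one as 1-smoothing. For a set $r$ of double points and a set $s\subset V$, resolve the double points in $r$ into positive and the other ones into negative crossings, and let $D_{r,s}^\chi$ be the result of 1-smoothing the crossings in $s$ and 0-smoothing the others, oriented as the boundary of the black region. The bracket $[\![D^\chi]\!]$ is the complex $$[\![D^\chi]\!]^i=\bigoplus_{|s|+2|r|=i}D_{r,s}^\chi$$ whose differential has the components $(-1)^{\mu_v(s)}\cdot\text{(saddle at }v)$ from $(r,s)$ to $(r,s\cup\{v\})$ for $v\notin s$, and $(-1)^{\mu_b(s)}\Phi_b$ from $(r,s)$ to $(r\cup\{b\},s\setminus\{b\})$ for double points $b\notin r$ with $b\in s$. Here $\Phi_b$, at the vertical smoothing $)($ of $b$, is the identity 2-bordism with a tube joining the sheets over the left and the right strand, minus the identity 2-bordism with a handle attached to the sheet over the left strand. **Genus-one morphism.** If $D^{(-)}$ and $D^{(+)}$ differ only in that a crossing $c$ is negative in $D^{(-)}$ and positive in $D^{(+)}$ (with the same order of the crossings), then $\widehat\Phi:[\![D^{(-),\chi}]\!]\to[\![D^{(+),\chi}]\!][1]$ has the components $(-1)^{\mu_c(s)}\Phi_c$ from $(r,s)$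 to $(r,s\setminus\{c\})$ for $c\in s$, and all others are $0$. **Theorem.** Let $D$ be a singular tangle diagram with a chosen edge, and let $D^{(-)}$, $D^{(+)}$ be obtained from $D$ by inserting into this edge a kink with a negative, respectively positive, crossing $c$: if the edge is drawn upwards along its orientation, the strand enters $c$ from the lower left, leaves it to the upper right, turns around on the right-hand side, enters $c$ again from the lower right and leaves it to the upper left. Let $\chi$ be any checkerboard coloring of the complement of $D$; it induces colorings for $D^{(\pm)}$. Take any total order of the crossings of $D^{(\pm)}$, and the induced order for $D$. The vertical smoothing of $c$ turns $D^{(\pm)}$ into $D$ together with a small circle. Let - $\bar R_1^-:[\![D^\chi]\!]\to[\![D^{(-),\chi}]\!][-1]$ have the components, from $(r,s)$ to $(r,s\cup\{c\})$, given by $(-1)^{\mu_c(s)}$ times the disjoint union of the identity and a disc bounded by the small circle; - $\bar R_1^+:[\![D^\chi]\!]\to[\![D^{(+),\chi}]\!]$ have the components, from $(r,s)$ to $(r,s)$, given by the disjoint union of the identity and a one-holed torus bounded by the small circle, minus the saddle that splits the small circle off from the strand at the chosen edge; all other components being $0$. Then $[\![D^\chi]\!]$, $[\![D^{(-),\chi}]\!]$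 and $[\![D^{(+),\chi}]\!]$ are complexes in $\mathcal C(\partial^-D^\chi,\partial^+D^\chi)$, the maps $\bar R_1^-$, $\bar R_1^+$ and $\widehat\Phi:[\![D^{(-),\chi}]\!][-1]\to[\![D^{(+),\chi}]\!]$ are chain maps, and the triangle commutes strictly: $$\widehat\Phi\circ\bar R_1^-=\bar R_1^+ .$$ -/

import Mathlib

noncomputable section

namespace TangleCob

/-! ## Cobordisms between oriented 0-manifolds -/

/-- A cobordism `Y₀ → Y₁` between oriented 0-manifolds (finite sets with signs `ε₀`, `ε₁`, where
`true` is the sign `+`): a compact oriented 1-manifold `W` with `∂W = Ȳ₀ ⊔ Y₁`, cut into finitely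
many oriented segments.  `Dart` is the set of ends of the segments, `edge` exchanges the two ends of
a segment, and `join` exchanges two ends that are glued; `join` fixes exactly the boundary points,
which are numbered by `bd`.  `out d` says that the orientation of the segment points away from its
end `d`; glued ends are one incoming and one outgoing.  A boundary point has sign `+` for the
boundary orientation when the orientation of `W` points towards it, and `Ȳ₀` is `Y₀` with the
signs reversed. -/
structure OneCob {Y₀ Y₁ : Type} (ε₀ : Y₀ → Bool) (ε₁ : Y₁ → Bool) where
  Dart : Type
  finite_dart : Finite Dart
  edge : Dart → Dart
  join : Dart → Dart
  bd : Y₀ ⊕ Y₁ → Dart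
  out : Dart → Bool
  edge_edge : ∀ d, edge (edge d) = d
  join_join : ∀ d, join (join d) = d
  bd_injective : Function.Injective bd
  join_eq_self : ∀ d, join d = d ↔ d ∈ Set.range bd
  out_edge : ∀ d, out (edge d) = !out d
  out_join : ∀ d, join d ≠ d → out (join d) = !out d
  out_bd₀ : ∀ y, out (bd (Sum.inl y)) = ε₀ y
  out_bd₁ : ∀ y, out (bd (Sum.inr y)) = !ε₁ y

section Surfaces

variable {Y₀ Y₁ : Type} {ε₀ : Y₀ → Bool} {ε₁ : Y₁ → Bool}

/-- The number of arcs (components with boundary) of `W` lying over `p`, for a map `f` that is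
constant on the components of `W`: every arc has exactly one end at which it starts.  This is also
the Euler characteristic of the part of `W` over `p`. -/
def OneCob.arcs (W : OneCob ε₀ ε₁) {P : Type} (f : W.Dart → P) (p : P) : ℤ :=
  (Nat.card {y : Y₀ ⊕ Y₁ // W.out (W.bd y) = true ∧ f (W.bd y) = p} : ℤ)

/-- The topological type of a 2-bordism `S : W → X` with corners, relative to its boundary
`W̄ ∪ (Ȳ₀ ⊔ Y₁) × [0,1] ∪ X`: its finite set of components (closed components are allowed), the
component in which each piece of `W` and of `X` lies, and the Euler characteristic of each
component.  Which such data come from surfaces is the predicate `IsSurface` below; by the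
classification of compact oriented surfaces, two 2-bordisms `W → X` are diffeomorphic
relative to the structure maps if and only if their types are isomorphic. -/
structure Bordism (W X : OneCob ε₀ ε₁) where
  Comp : Type
  finite_comp : Finite Comp
  src : W.Dart → Comp
  tgt : X.Dart → Comp
  src_edge : ∀ d, src (W.edge d) = src d
  src_join : ∀ d, src (W.join d) = src d
  tgt_edge : ∀ d, tgt (X.edge d) = tgt d
  tgt_join : ∀ d, tgt (X.join d) = tgt d
  src_bd : ∀ y, src (W.bd y) = tgt (X.bd y)
  euler : Comp → ℤ

/-- Isomorphism of types: a bijection of components that respects everything. -/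
def Bordism.Iso {W X : OneCob ε₀ ε₁} (S T : Bordism W X) : Prop :=
  ∃ φ : S.Comp ≃ T.Comp, (∀ d, φ (S.src d) = T.src d) ∧ (∀ d, φ (S.tgt d) = T.tgt d) ∧
    ∀ p, T.euler (φ p) = S.euler p

/-- The closed 1-manifold `W̄ ∪ (Ȳ₀ ⊔ Y₁) × [0,1] ∪ X` as a graph on the ends of segments. -/
inductive BdryStep (W X : OneCob ε₀ ε₁) : W.Dart ⊕ X.Dart → W.Dart ⊕ X.Dart → Prop
  | src_edge (d : W.Dart) : BdryStep W X (Sum.inl d) (Sum.inl (W.edge d))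
  | src_join (d : W.Dart) : BdryStep W X (Sum.inl d) (Sum.inl (W.join d))
  | tgt_edge (d : X.Dart) : BdryStep W X (Sum.inr d) (Sum.inr (X.edge d))
  | tgt_join (d : X.Dart) : BdryStep W X (Sum.inr d) (Sum.inr (X.join d))
  | side (y : Y₀ ⊕ Y₁) : BdryStep W X (Sum.inl (W.bd y)) (Sum.inr (X.bd y))

/-- The number of boundary circles of the component `p`. -/
def Bordism.circles {W X : OneCob ε₀ ε₁} (S : Bordism W X) (p : S.Comp) : ℕ :=
  Nat.card {c : Quot (BdryStep W X) // ∃ a, Quot.mk _ a = c ∧ Sum.elim S.src S.tgt a = p}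

/-- The type is that of a compact oriented surface: a component of genus `g` with `b` boundary
circles has Euler characteristic `2 - 2 g - b`. -/
def Bordism.IsSurface {W X : OneCob ε₀ ε₁} (S : Bordism W X) : Prop :=
  ∀ p, ∃ g : ℕ, S.euler p = 2 - 2 * (g : ℤ) - (S.circles p : ℤ)

/-- Two components become equal when `S : W → X` and `T : X → Z` are glued along `X`. -/
def glueStep {W X Z : OneCob ε₀ ε₁} (S : Bordism W X) (T : Bordism X Z) :
    S.Comp ⊕ T.Comp → S.Comp ⊕ T.Comp → Prop :=
  fun a b => ∃ d : X.Dart, a = Sum.inl (S.tgt d) ∧ b = Sum.inr (T.src d)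

/-- The composition: `S : W → X` and `T : X → Z` are glued along `X`.  Euler characteristics add
up, minus the Euler characteristic of the part of `X` along which one glues. -/
def Bordism.comp {W X Z : OneCob ε₀ ε₁} (S : Bordism W X) (T : Bordism X Z) : Bordism W Z where
  Comp := Quot (glueStep S T)
  finite_comp := by
    have := S.finite_comp
    have := T.finite_comp
    infer_instance
  src d := Quot.mk _ (Sum.inl (S.src d))
  tgt d := Quot.mk _ (Sum.inr (T.tgt d))
  src_edge d := by rw [S.src_edge]
  src_join d := by rw [S.src_join]
  tgt_edge d := by rw [T.tgt_edge]
  tgt_join d := by rw [T.tgt_join]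
  src_bd y := by
    rw [S.src_bd, ← T.src_bd]
    exact Quot.sound ⟨_, rfl, rfl⟩
  euler q :=
    (∑ᶠ p : {p : S.Comp // Quot.mk (glueStep S T) (Sum.inl p) = q}, S.euler p) +
    (∑ᶠ p : {p : T.Comp // Quot.mk (glueStep S T) (Sum.inr p) = q}, T.euler p) -
    X.arcs (fun d => Quot.mk (glueStep S T) (Sum.inl (S.tgt d))) q

open Classical in
/-- Remove a disc from each of the components `p` and `q` (two disjoint discs if `p = q`) and join
the two resulting circles by a tube.  For `p = q` this adds a handle to `p`. -/
def Bordism.addTube {W X : OneCob ε₀ ε₁} (S : Bordism W X) (p q : S.Comp) : Bordism W X where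
  Comp := Quot (fun a b : S.Comp => a = p ∧ b = q)
  finite_comp := by
    have := S.finite_comp
    infer_instance
  src d := Quot.mk _ (S.src d)
  tgt d := Quot.mk _ (S.tgt d)
  src_edge d := by rw [S.src_edge]
  src_join d := by rw [S.src_join]
  tgt_edge d := by rw [S.tgt_edge]
  tgt_join d := by rw [S.tgt_join]
  src_bd y := by rw [S.src_bd]
  euler c :=
    (∑ᶠ a : {a : S.Comp // Quot.mk (fun a b : S.Comp => a = p ∧ b = q) a = c}, S.euler a) -
    (if c = Quot.mk _ p then 2 else 0)

/-- The disjoint union with a closed connected surface of Euler characteristic `e`. -/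
def Bordism.addClosed {W X : OneCob ε₀ ε₁} (S : Bordism W X) (e : ℤ) : Bordism W X where
  Comp := Option S.Comp
  finite_comp := by
    have := S.finite_comp
    infer_instance
  src d := some (S.src d)
  tgt d := some (S.tgt d)
  src_edge d := by rw [S.src_edge]
  src_join d := by rw [S.src_join]
  tgt_edge d := by rw [S.tgt_edge]
  tgt_join d := by rw [S.tgt_join]
  src_bd y := by rw [S.src_bd]
  euler p := p.elim e S.euler

variable (k : Type*) [CommRing k]

/-- Formal `k`-linear combinations of 2-bordisms `W → X`. -/
abbrev Chain (W X : OneCob ε₀ ε₁) := Bordism W X →₀ k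

/-- A 2-bordism as a formal combination. -/
def Chain.of {W X : OneCob ε₀ ε₁} (S : Bordism W X) : Chain k W X := Finsupp.single S 1

/-- The bilinear extension of the composition. -/
def Chain.comp {W X Z : OneCob ε₀ ε₁} (f : Chain k W X) (g : Chain k X Z) : Chain k W Z :=
  f.sum fun S a => g.sum fun T b => Finsupp.single (S.comp T) (a * b)

/-- The relations between formal combinations of 2-bordisms: diffeomorphic surfaces are equal, and
the local relations `S` (sphere), `T` (torus) and `4Tu` (four tubes) for all surfaces. -/
inductive Relator (W X : OneCob ε₀ ε₁) : Chain k W X → Prop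
  | iso (S T : Bordism W X) (h : S.Iso T) : Relator W X (Chain.of k S - Chain.of k T)
  | sphere (S : Bordism W X) (h : S.IsSurface) : Relator W X (Chain.of k (S.addClosed 2))
  | torus (S : Bordism W X) (h : S.IsSurface) :
      Relator W X (Chain.of k (S.addClosed 0) - (2 : k) • Chain.of k S)
  | fourTu (S : Bordism W X) (h : S.IsSurface) (p₁ p₂ p₃ p₄ : S.Comp) :
      Relator W X (Chain.of k (S.addTube p₁ p₂) + Chain.of k (S.addTube p₃ p₄) -
        Chain.of k (S.addTube p₁ p₃) - Chain.of k (S.addTube p₂ p₄))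

/-- The submodule spanned by the relations.  The morphisms `W → X` in the quotient category
`k Cob₂ / L` are the combinations of surfaces modulo this submodule.  (Apart from isomorphism, only
surfaces are related, so a combination of surfaces is zero modulo this submodule exactly if it is
zero in `k Cob₂ / L`.) -/
def relations (W X : OneCob ε₀ ε₁) : Submodule k (Chain k W X) :=
  Submodule.span k {f | Relator k W X f}

/-- Equality of morphisms of the quotient category. -/
def Chain.Eqv {W X : OneCob ε₀ ε₁} (f g : Chain k W X) : Prop := f - g ∈ relations k W X

/-- A bounded graded object `i ↦ ⨁_{deg a = i} obj a` of the additive closure `Mat (k Cob₂ / L)`,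
with a matrix `d` of representatives of morphisms from the object to itself. -/
structure GradedCx (ε₀ : Y₀ → Bool) (ε₁ : Y₁ → Bool) where
  Index : Type
  finite_index : Finite Index
  deg : Index → ℤ
  obj : Index → OneCob ε₀ ε₁
  d : ∀ a b, Chain k (obj a) (obj b)

namespace GradedCx

variable {k}

/-- Matrices of (representatives of) morphisms. -/
abbrev Mat (A B : GradedCx k ε₀ ε₁) := ∀ a b, Chain k (A.obj a) (B.obj b)

/-- The matrix product `A → B → C`. -/
def Mat.comp {A B C : GradedCx k ε₀ ε₁} (f : Mat A B) (g : Mat B C) : Mat A C :=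
  fun a c => ∑ᶠ b : B.Index, Chain.comp k (f a b) (g b c)

/-- Equality of matrices of morphisms of `k Cob₂ / L`. -/
def Mat.Eqv {A B : GradedCx k ε₀ ε₁} (f g : Mat A B) : Prop :=
  ∀ a b, Chain.Eqv k (f a b) (g a b)

/-- `d` has degree `1` and `d ∘ d = 0`. -/
def IsComplex (A : GradedCx k ε₀ ε₁) : Prop :=
  (∀ a b, A.d a b ≠ 0 → A.deg b = A.deg a + 1) ∧
    Mat.Eqv (A := A) (B := A) (Mat.comp (A := A) (B := A) (C := A) A.d A.d) (fun _ _ => 0)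

/-- `f` has degree `0` and commutes with the differentials. -/
def IsChainMap {A B : GradedCx k ε₀ ε₁} (f : Mat A B) : Prop :=
  (∀ a b, f a b ≠ 0 → B.deg b = A.deg a) ∧
    Mat.Eqv (Mat.comp (A := A) (B := A) (C := B) A.d f) (Mat.comp (A := A) (B := B) (C := B) f B.d)

/-- The shift `A[n]` with `A[n]^i = A^(i-n)` and differential `(-1)^n d`. -/
def shift (A : GradedCx k ε₀ ε₁) (n : ℤ) : GradedCx k ε₀ ε₁ where
  Index := A.Index
  finite_index := A.finite_index
  deg a := A.deg a + n
  obj := A.obj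
  d a b := ((n.negOnePow : ℤˣ) : ℤ) • A.d a b

end GradedCx

end Surfaces

/-! ## Singular tangle diagrams -/

/-- The ends of the edges of a tangle diagram in the strip `ℝ × [0,1]` with set of crossings `V`
(ordinary or singular), set `J` of marked points (bivalent vertices, so that closed curves without
crossings can be described), `m` endpoints on `ℝ × {0}` and `n` endpoints on `ℝ × {1}`, both
numbered from left to right.  Every crossing is turned so that both strands run upwards; its ends
`0, 1, 2, 3` are then the south-west, south-east, north-east and north-west ones. At a marked
point, `mark j false` is the incoming and `mark j true` the outgoing end. -/
inductive Dart (V J : Type) (m n : ℕ) : Type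
  | cross (v : V) (i : Fin 4)
  | mark (j : J) (b : Bool)
  | bot (i : Fin m)
  | top (i : Fin n)

variable {V J : Type} {m n : ℕ}

/-- There are finitely many ends. -/
theorem Dart.finite [Finite V] [Finite J] : Finite (Dart V J m n) := by
  refine Finite.of_injective
    (fun d : Dart V J m n => match d with
      | .cross v i => (Sum.inl (Sum.inl (v, i)) : ((V × Fin 4) ⊕ (J × Bool)) ⊕ (Fin m ⊕ Fin n))
      | .mark j b => Sum.inl (Sum.inr (j, b))
      | .bot i => Sum.inr (Sum.inl i)
      | .top i => Sum.inr (Sum.inr i)) ?_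
  intro a b h
  cases a <;> cases b <;> simp_all

/-- The next end in clockwise order around the same vertex.  The complement of the strip is
collapsed to one further vertex of the 2-sphere; around it, the endpoints follow each other clockwise
as they do counterclockwise along the boundary of the strip. -/
def Dart.cw : Dart V J m n → Dart V J m n
  | .cross v i => .cross v (i + 3)
  | .mark j b => .mark j (!b)
  | .bot i =>
      if h : i.val + 1 < m then .bot ⟨i.val + 1, h⟩
      else if h' : 0 < n then .top ⟨n - 1, by omega⟩
      else .bot ⟨0, by omega⟩
  | .top i =>
      if h : 0 < i.val then .top ⟨i.val - 1, by omega⟩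
      else if h' : 0 < m then .bot ⟨0, h'⟩
      else .top ⟨n - 1, by omega⟩

/-- The ordinary crossings (negative, positive) and double points. -/
inductive Kind : Type
  | neg
  | pos
  | sing

/-- The edges of an oriented singular tangle diagram, with no crossing information.  `edge`
exchanges the two ends of an edge.  `tail d` says that the edge at `d` is oriented away from `d`
by the orientation of the tangle. -/
structure Shadow (V J : Type) (m n : ℕ) where
  edge : Dart V J m n → Dart V J m n
  tail : Dart V J m n → Bool
  edge_edge : ∀ d, edge (edge d) = d
  tail_edge : ∀ d, tail (edge d) = !tail d
  tail_cross : ∀ v i, tail (.cross v i) = decide (2 ≤ i.val)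
  tail_mark : ∀ j b, tail (.mark j b) = b

/-- An oriented singular tangle diagram as a combinatorial map (planarity is a separate predicate):
the ends of edges, their cyclic order around the vertices, and the kinds of the crossings. -/
structure Diagram (V J : Type) (m n : ℕ) extends Shadow V J m n where
  kind : V → Kind

/-- Planarity: the combinatorial map formed by the diagram and the exterior of the strip has Euler
characteristic `#vertices - #edges + #faces = 2 #components`. -/
def Shadow.IsPlanar (Γ : Shadow V J m n) : Prop :=
  Nat.card (Quot fun a b : Dart V J m n => b = a.cw) +
      Nat.card (Quot fun a b : Dart V J m n => b = (Γ.edge a).cw) =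
    Nat.card (Quot fun a b : Dart V J m n => b = Γ.edge a) +
      2 * Nat.card (Quot fun a b : Dart V J m n => b = a.cw ∨ b = Γ.edge a)

/-- A checkerboard coloring.  `black d` says that the region on the left of the edge at `d`, seen
along the edge from its end `d`, is black.  The region on the left of `d` is also the one on the left
of `(edge d).cw`, and it is separated by the edge from the region on the left of `d.cw`. -/
structure Shadow.Coloring (Γ : Shadow V J m n) where
  black : Dart V J m n → Bool
  black_region : ∀ d, black (Γ.edge d).cw = black d
  black_cw : ∀ d : Dart V J m n, black d.cw = !black d

/-- The two sides of an edge have different colors. -/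
theorem Shadow.Coloring.black_edge {Γ : Shadow V J m n} (χ : Γ.Coloring) (d : Dart V J m n) :
    χ.black (Γ.edge d) = !χ.black d := by
  have h := χ.black_region d
  rw [χ.black_cw] at h
  rw [← h, Bool.not_not]

/-- The signs of the points of `∂⁻D`: with the boundary orientation of the black part. -/
def Shadow.Coloring.sign₀ {Γ : Shadow V J m n} (χ : Γ.Coloring) : Fin m → Bool :=
  fun i => χ.black (.bot i)

/-- The signs of the points of `∂⁺D`. -/
def Shadow.Coloring.sign₁ {Γ : Shadow V J m n} (χ : Γ.Coloring) : Fin n → Bool :=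
  fun i => !χ.black (.top i)

/-- How a smoothing connects the ends at the vertices: at a crossing with `σ v = true` it is the
vertical smoothing `)(`, compatible with the orientations of the strands, and otherwise the
horizontal one. -/
def smoothJoin (σ : V → Bool) : Dart V J m n → Dart V J m n
  | .cross v i => .cross v (if σ v then ![3, 2, 1, 0] i else ![1, 0, 3, 2] i)
  | .mark j b => .mark j (!b)
  | .bot i => .bot i
  | .top i => .top i

/-- The smoothing of a diagram, with the boundary orientation of the black part. -/
def Shadow.smooth [Finite V] [Finite J] (Γ : Shadow V J m n) (χ : Γ.Coloring) (σ : V → Bool) :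
    OneCob χ.sign₀ χ.sign₁ where
  Dart := Dart V J m n
  finite_dart := Dart.finite
  edge := Γ.edge
  join := smoothJoin σ
  bd := Sum.elim .bot .top
  out := χ.black
  edge_edge := Γ.edge_edge
  join_join d := by
    rcases d with ⟨v, i⟩ | ⟨j, b⟩ | i | i
    · by_cases h : σ v <;> fin_cases i <;> simp [smoothJoin, h]
    all_goals simp [smoothJoin]
  bd_injective := by
    rintro (a | a) (b | b) h <;> simp_all
  join_eq_self d := by
    rcases d with ⟨v, i⟩ | ⟨j, b⟩ | i | i
    · by_cases h : σ v <;> fin_cases i <;> simp [smoothJoin, h]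
    all_goals simp [smoothJoin]
  out_edge := χ.black_edge
  out_join d hd := by
    rcases d with ⟨v, i⟩ | ⟨j, b⟩ | i | i
    · have h0 := χ.black_cw (.cross v 0)
      have h1 := χ.black_cw (.cross v 1)
      have h2 := χ.black_cw (.cross v 2)
      have h3 := χ.black_cw (.cross v 3)
      simp only [Dart.cw, Fin.isValue, Fin.reduceAdd] at h0 h1 h2 h3
      by_cases h : σ v <;> fin_cases i <;> simp_all [smoothJoin]
    · exact χ.black_cw (.mark j b)
    all_goals simp [smoothJoin] at hd
  out_bd₀ _ := rfl
  out_bd₁ y := (Bool.not_not _).symm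

/-! ## Elementary 2-bordisms between smoothings -/

/-- Two ends lie in one component of the union of the smoothings `σ` and `τ`. -/
inductive Shadow.TraceStep (Γ : Shadow V J m n) (σ τ : V → Bool) :
    Dart V J m n → Dart V J m n → Prop
  | edge (d) : TraceStep Γ σ τ d (Γ.edge d)
  | src (d) : TraceStep Γ σ τ d (smoothJoin σ d)
  | tgt (d) : TraceStep Γ σ τ d (smoothJoin τ d)

section Elementary

variable [Finite V] [Finite J]

/-- For `σ = τ` and `w = 0` this is the identity 2-bordism `D_σ × [0,1]`.  If `σ` and `τ` differ at
some crossings, the segments of the diagram run through as `segment × [0,1]`; the Euler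
characteristic of each component is that of `D_σ × [0,1]` corrected by the weight `w`. -/
def Shadow.trace (Γ : Shadow V J m n) (χ : Γ.Coloring) (σ τ : V → Bool)
    (w : Quot (Γ.TraceStep σ τ) → ℤ) : Bordism (Γ.smooth χ σ) (Γ.smooth χ τ) where
  Comp := Quot (Γ.TraceStep σ τ)
  finite_comp := by
    have : Finite (Dart V J m n) := Dart.finite
    infer_instance
  src d := Quot.mk _ d
  tgt d := Quot.mk _ d
  src_edge d := (Quot.sound (.edge d)).symm
  src_join d := (Quot.sound (.src d)).symm
  tgt_edge d := (Quot.sound (.edge d)).symm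
  tgt_join d := (Quot.sound (.tgt d)).symm
  src_bd _ := rfl
  euler p := (Γ.smooth χ σ).arcs (fun d => Quot.mk (Γ.TraceStep σ τ) d) p + w p

/-- The identity (if `σ = τ`). -/
def Shadow.cylinder (Γ : Shadow V J m n) (χ : Γ.Coloring) (σ τ : V → Bool) :
    Bordism (Γ.smooth χ σ) (Γ.smooth χ τ) :=
  Γ.trace χ σ τ fun _ => 0

open Classical in
/-- The saddle at the crossing `v` (if `σ` and `τ` differ exactly at `v`): the identity with one
1-handle attached, which reconnects the two strands at `v`. -/
def Shadow.saddle (Γ : Shadow V J m n) (χ : Γ.Coloring) (σ τ : V → Bool) (v : V) :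
    Bordism (Γ.smooth χ σ) (Γ.smooth χ τ) :=
  Γ.trace χ σ τ fun p => if p = Quot.mk _ (.cross v 0) then -1 else 0

/-- The two terms of `Φ` at a vertically smoothed crossing `v` (if `σ = τ`).  The first: the
identity with a tube that joins the sheets over the left strand (through the end `0`) and over the
right strand (through the end `1`) at `v`. -/
def Shadow.phiFst (Γ : Shadow V J m n) (χ : Γ.Coloring) (σ τ : V → Bool) (v : V) :
    Bordism (Γ.smooth χ σ) (Γ.smooth χ τ) :=
  (Γ.cylinder χ σ τ).addTube (Quot.mk _ (.cross v 0)) (Quot.mk _ (.cross v 1))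

/-- The second: the identity with a handle on the sheet over the left strand. -/
def Shadow.phiSnd (Γ : Shadow V J m n) (χ : Γ.Coloring) (σ τ : V → Bool) (v : V) :
    Bordism (Γ.smooth χ σ) (Γ.smooth χ τ) :=
  (Γ.cylinder χ σ τ).addTube (Quot.mk _ (.cross v 0)) (Quot.mk _ (.cross v 0))

end Elementary

/-! ## The universal bracket complex -/

/-- The sign `(-1)^μ`, where `μ` is the number of elements of `A` that come before `a` in the total
order of the crossings given by their numbers `ν`. -/
def muSign (ν : V ↪ ℕ) (A : Finset V) (a : V) : ℤ :=
  (-1) ^ (A.filter fun b => ν b < ν a).card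

/-- The direct summands of the bracket: a resolution scheme `r` (the set of double points that are
resolved into positive crossings, the others being resolved into negative ones) and a state `s` on
the resolved diagram. -/
structure Diagram.State (D : Diagram V J m n) where
  r : Finset V
  s : Finset V
  sing_of_mem : ∀ v ∈ r, D.kind v = Kind.sing

/-- There are finitely many states. -/
theorem Diagram.State.finite [Finite V] (D : Diagram V J m n) : Finite D.State := by
  have := Fintype.ofFinite V
  refine Finite.of_injective (fun x : D.State => (x.r, x.s)) ?_
  rintro ⟨r, s, h⟩ ⟨r', s', h'⟩ e
  simp_all

open Classical in
/-- Which crossings are smoothed vertically.  A negative crossing has the horizontal 0-smoothing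
and the vertical 1-smoothing, a positive crossing the other way round. -/
def Diagram.State.vertical {D : Diagram V J m n} (x : D.State) (v : V) : Bool :=
  match D.kind v with
  | .neg => decide (v ∈ x.s)
  | .pos => decide (v ∉ x.s)
  | .sing => if v ∈ x.r then decide (v ∉ x.s) else decide (v ∈ x.s)

open Classical in
/-- The diagram with the crossing `c` replaced by one of another kind. -/
def Diagram.resolve (D : Diagram V J m n) (c : V) (t : Kind) : Diagram V J m n where
  toShadow := D.toShadow
  kind v := if v = c then t else D.kind v

/-- The smoothed diagram of a state. -/
def Diagram.smoothing [Finite V] [Finite J] (D : Diagram V J m n) (χ : D.Coloring) (x : D.State) :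
    OneCob χ.sign₀ χ.sign₁ :=
  D.toShadow.smooth χ x.vertical

section Bracket

variable [Fintype V] [DecidableEq V] [Finite J] (k : Type*) [CommRing k]

open Classical in
/-- The universal bracket complex of a singular tangle diagram.  The differential consists of the
signed saddles at the crossings of the resolved diagrams, and of the genus-one morphisms
`Φ` (the difference of `phiFst` and `phiSnd`, with the sign of the contraction by `b`) between
the two resolutions of the double points `b`.  The contraction signs make the genus-one morphisms at
different double points anticommute, so that no further sign is needed. -/
def Diagram.bracket (D : Diagram V J m n) (χ : D.Coloring) (ν : V ↪ ℕ) :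
    GradedCx k χ.sign₀ χ.sign₁ where
  Index := D.State
  finite_index := Diagram.State.finite D
  deg x := (x.s.card : ℤ) + 2 * (x.r.card : ℤ)
  obj := D.smoothing χ
  d x y :=
    (∑ v : V, if v ∉ x.s ∧ y.r = x.r ∧ y.s = insert v x.s then
        muSign ν x.s v • Chain.of k (D.saddle χ x.vertical y.vertical v) else 0) +
    (∑ b : V, if D.kind b = Kind.sing ∧ b ∉ x.r ∧ b ∈ x.s ∧ y.r = insert b x.r ∧
          y.s = x.s.erase b then
        muSign ν x.s b • (Chain.of k (D.phiFst χ x.vertical y.vertical b) -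
          Chain.of k (D.phiSnd χ x.vertical y.vertical b)) else 0)

open Classical in
/-- The genus-one morphism at `c`, from the bracket of the diagram with a negative crossing `c` to
that of the diagram with a positive crossing `c`: the contraction by `c` times `Φ`, and the identity
on the other double points and their resolutions. -/
def Diagram.genusOne (D : Diagram V J m n) (χ : D.Coloring) (ν : V ↪ ℕ) (c : V) :
    GradedCx.Mat (Diagram.bracket k (D.resolve c .neg) χ ν)
      (Diagram.bracket k (D.resolve c .pos) χ ν) :=
  fun (x : (D.resolve c .neg).State) (y : (D.resolve c .pos).State) =>
    if c ∈ x.s ∧ y.r = x.r ∧ y.s = x.s.erase c then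
      muSign ν x.s c • (Chain.of k (D.phiFst χ x.vertical y.vertical c) -
        Chain.of k (D.phiSnd χ x.vertical y.vertical c))
    else 0

end Bracket

/-! ## Reidemeister I kinks -/

/-- The ends of `D` as ends of the diagram with one more crossing `none`. -/
def Dart.old : Dart V J m n → Dart (Option V) J m n
  | .cross v i => .cross (some v) i
  | .mark j b => .mark j b
  | .bot i => .bot i
  | .top i => .top i

open Classical in
/-- The edges of the diagram with a kink in the edge at `e`. -/
def Shadow.kinkEdge (Γ : Shadow V J m n) (e : Dart V J m n) :
    Dart (Option V) J m n → Dart (Option V) J m n :=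
  let f : Dart V J m n → Dart (Option V) J m n := fun d =>
    if d = e then .cross none 0 else if d = Γ.edge e then .cross none 3 else (Γ.edge d).old
  fun d => match d with
  | .cross none i => ![e.old, .cross none 2, .cross none 1, (Γ.edge e).old] i
  | .cross (some v) i => f (.cross v i)
  | .mark j b => f (.mark j b)
  | .bot i => f (.bot i)
  | .top i => f (.top i)

/-- A function on the ends of `D` and on the four ends of the new crossing. -/
def Dart.extend (f : Dart V J m n → Bool) (g : Fin 4 → Bool) : Dart (Option V) J m n → Bool
  | .cross none i => g i
  | .cross (some v) i => f (.cross v i)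
  | .mark j b => f (.mark j b)
  | .bot i => f (.bot i)
  | .top i => f (.top i)

theorem Shadow.kinkEdge_old (Γ : Shadow V J m n) (e d : Dart V J m n) (h1 : d ≠ e)
    (h2 : d ≠ Γ.edge e) : Γ.kinkEdge e d.old = (Γ.edge d).old := by
  cases d <;> simp [Shadow.kinkEdge, Dart.old, h1, h2]

theorem Shadow.kinkEdge_old_self (Γ : Shadow V J m n) (e : Dart V J m n) :
    Γ.kinkEdge e e.old = .cross none 0 := by
  cases e <;> simp [Shadow.kinkEdge, Dart.old]

theorem Shadow.edge_ne (Γ : Shadow V J m n) (d : Dart V J m n) : Γ.edge d ≠ d := by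
  intro h
  have := Γ.tail_edge d
  rw [h] at this
  simp at this

theorem Shadow.kinkEdge_old_edge (Γ : Shadow V J m n) (e : Dart V J m n) :
    Γ.kinkEdge e (Γ.edge e).old = .cross none 3 := by
  have h := Γ.edge_ne e
  generalize hd : Γ.edge e = d at h
  cases d <;> simp [Shadow.kinkEdge, Dart.old, h, hd]

theorem Dart.cases_old (P : Dart (Option V) J m n → Prop) (hold : ∀ d : Dart V J m n, P d.old)
    (hnew : ∀ i, P (.cross none i)) : ∀ d, P d
  | .cross none i => hnew i
  | .cross (some v) i => hold (.cross v i)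
  | .mark j b => hold (.mark j b)
  | .bot i => hold (.bot i)
  | .top i => hold (.top i)

theorem Dart.extend_old (f : Dart V J m n → Bool) (g : Fin 4 → Bool) (d : Dart V J m n) :
    Dart.extend f g d.old = f d := by
  cases d <;> rfl

theorem Dart.cw_old (d : Dart V J m n) : d.old.cw = d.cw.old := by
  rcases d with ⟨v, i⟩ | ⟨j, b⟩ | i | i
  · rfl
  · rfl
  · simp only [Dart.old, Dart.cw]; split_ifs <;> rfl
  · simp only [Dart.old, Dart.cw]; split_ifs <;> rfl

/-- An alternating function stays alternating when a kink is inserted. -/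
theorem Shadow.extend_kinkEdge (Γ : Shadow V J m n) (e : Dart V J m n) (f : Dart V J m n → Bool)
    (g : Fin 4 → Bool) (hf : ∀ d, f (Γ.edge d) = !f d) (h0 : g 0 = !f e) (h3 : g 3 = f e)
    (h12 : g 2 = !g 1) (d : Dart (Option V) J m n) :
    Dart.extend f g (Γ.kinkEdge e d) = !Dart.extend f g d := by
  revert d
  apply Dart.cases_old
  · intro d
    by_cases h1 : d = e
    · subst h1
      rw [Γ.kinkEdge_old_self, Dart.extend_old]
      exact h0
    by_cases h2 : d = Γ.edge e
    · subst h2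
      rw [Γ.kinkEdge_old_edge, Dart.extend_old, hf, Bool.not_not]
      exact h3
    rw [Γ.kinkEdge_old e d h1 h2, Dart.extend_old, Dart.extend_old, hf]
  · intro i
    fin_cases i
    · change Dart.extend f g e.old = !g 0
      rw [Dart.extend_old, h0, Bool.not_not]
    · exact h12
    · change g 1 = !g 2
      rw [h12, Bool.not_not]
    · change Dart.extend f g (Γ.edge e).old = !g 3
      rw [Dart.extend_old, h3, hf]

theorem Shadow.kinkEdge_kinkEdge (Γ : Shadow V J m n) (e : Dart V J m n)
    (d : Dart (Option V) J m n) : Γ.kinkEdge e (Γ.kinkEdge e d) = d := by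
  revert d
  apply Dart.cases_old
  · intro d
    by_cases h1 : d = e
    · subst h1
      rw [Γ.kinkEdge_old_self]
      rfl
    by_cases h2 : d = Γ.edge e
    · subst h2
      rw [Γ.kinkEdge_old_edge]
      rfl
    have h3 : Γ.edge d ≠ e := fun h => h2 (by rw [← h, Γ.edge_edge])
    have h4 : Γ.edge d ≠ Γ.edge e := fun h => h1 (by rw [← Γ.edge_edge d, h, Γ.edge_edge])
    rw [Γ.kinkEdge_old e d h1 h2, Γ.kinkEdge_old e _ h3 h4, Γ.edge_edge]
  · intro i
    fin_cases i
    · exact Γ.kinkEdge_old_self e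
    · rfl
    · rfl
    · exact Γ.kinkEdge_old_edge e

/-- The diagram with a kink in the edge at `e`.  If the strand leaves the vertex of `e` along this
edge and the edge is drawn upwards, the strand enters the new crossing `none` from the south-west,
leaves it to the north-east, makes a loop on the right-hand side of the diagram, enters the crossing
again from the south-east and leaves it to the north-west. -/
def Shadow.kink (Γ : Shadow V J m n) (e : Dart V J m n) (he : Γ.tail e = true) :
    Shadow (Option V) J m n where
  edge := Γ.kinkEdge e
  tail := Dart.extend Γ.tail fun i => decide (2 ≤ i.val)
  edge_edge := Γ.kinkEdge_kinkEdge e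
  tail_edge := Γ.extend_kinkEdge e _ _ Γ.tail_edge (by simp [he]) (by simp [he]) (by simp)
  tail_cross v i := by
    cases v with
    | none => rfl
    | some v => exact Γ.tail_cross v i
  tail_mark := Γ.tail_mark

/-- The induced coloring: the colors of the old regions do not change. -/
def Shadow.Coloring.kink {Γ : Shadow V J m n} (χ : Γ.Coloring) (e : Dart V J m n)
    (he : Γ.tail e = true) : (Γ.kink e he).Coloring where
  black := Dart.extend χ.black ![!χ.black e, χ.black e, !χ.black e, χ.black e]
  black_region d := by
    have hcw : ∀ d : Dart (Option V) J m n,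
        Dart.extend χ.black ![!χ.black e, χ.black e, !χ.black e, χ.black e] d.cw =
          !Dart.extend χ.black ![!χ.black e, χ.black e, !χ.black e, χ.black e] d := by
      apply Dart.cases_old
      · intro d
        rw [Dart.cw_old, Dart.extend_old, Dart.extend_old, χ.black_cw]
      · intro i
        fin_cases i <;> simp [Dart.cw, Dart.extend]
    rw [hcw]
    have h := Γ.extend_kinkEdge e χ.black ![!χ.black e, χ.black e, !χ.black e, χ.black e]
      χ.black_edge rfl rfl rfl d
    change (!Dart.extend χ.black _ (Γ.kinkEdge e d)) = _
    rw [h, Bool.not_not]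
  black_cw := by
    apply Dart.cases_old
    · intro d
      rw [Dart.cw_old, Dart.extend_old, Dart.extend_old, χ.black_cw]
    · intro i
      fin_cases i <;> simp [Dart.cw, Dart.extend]

/-- The singular diagram with a kink whose crossing is a double point. -/
def Diagram.kink (D : Diagram V J m n) (e : Dart V J m n) (he : D.tail e = true) :
    Diagram (Option V) J m n where
  toShadow := D.toShadow.kink e he
  kind o := o.elim Kind.sing D.kind

/-- The diagram `D⁻` with a negative kink. -/
def Diagram.kinkNeg (D : Diagram V J m n) (e : Dart V J m n) (he : D.tail e = true) :
    Diagram (Option V) J m n := (D.kink e he).resolve none .neg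

/-- The diagram `D⁺` with a positive kink. -/
def Diagram.kinkPos (D : Diagram V J m n) (e : Dart V J m n) (he : D.tail e = true) :
    Diagram (Option V) J m n := (D.kink e he).resolve none .pos

/-- Two ends lie in one component of a 2-bordism from the smoothing `σ` of `D` to the smoothing `τ`
of the diagram with a kink, if the pieces of `D` run through.  (If `τ` agrees with `σ` on the old
crossings and smooths the kink vertically, the last two steps are consequences of the first two, and
the classes are the components of the target: those of the source, and the circle through the ends
`1` and `2` of the new crossing.) -/
inductive Shadow.KinkStep (Γ : Shadow V J m n) (e : Dart V J m n) (σ : V → Bool)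
    (τ : Option V → Bool) : Dart (Option V) J m n → Dart (Option V) J m n → Prop
  | tgt_edge (d) : KinkStep Γ e σ τ d (Γ.kinkEdge e d)
  | tgt_join (d) : KinkStep Γ e σ τ d (smoothJoin τ d)
  | src_edge (d : Dart V J m n) : KinkStep Γ e σ τ d.old (Γ.edge d).old
  | src_join (d : Dart V J m n) : KinkStep Γ e σ τ d.old (smoothJoin σ d).old

/-- The same with the sheet over the strand of the kink connected to the new circle. -/
def Shadow.SplitStep (Γ : Shadow V J m n) (e : Dart V J m n) (σ : V → Bool)
    (τ : Option V → Bool) (a b : Dart (Option V) J m n) : Prop :=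
  Γ.KinkStep e σ τ a b ∨ (a = .cross none 0 ∧ b = .cross none 1)

section Kinks

variable [Finite V] [Finite J]

open Classical in
/-- The 2-bordism `D_σ → D_σ ⊔ circle` onto the vertically smoothed kink that is the disjoint union
of the identity of `D_σ` and a connected surface of genus `g` bounded by the new circle. -/
def Shadow.newCircle (Γ : Shadow V J m n) (χ : Γ.Coloring) (e : Dart V J m n)
    (he : Γ.tail e = true) (g : ℕ) (σ : V → Bool) (τ : Option V → Bool) :
    Bordism (Γ.smooth χ σ) ((Γ.kink e he).smooth (χ.kink e he) τ) where
  Comp := Quot (Γ.KinkStep e σ τ)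
  finite_comp := by
    have : Finite (Dart (Option V) J m n) := Dart.finite
    infer_instance
  src d := Quot.mk _ d.old
  tgt d := Quot.mk _ d
  src_edge d := (Quot.sound (.src_edge d)).symm
  src_join d := (Quot.sound (.src_join d)).symm
  tgt_edge d := (Quot.sound (.tgt_edge d)).symm
  tgt_join d := (Quot.sound (.tgt_join d)).symm
  src_bd y := by cases y <;> rfl
  euler p := (Γ.smooth χ σ).arcs (fun d => Quot.mk (Γ.KinkStep e σ τ) d.old) p +
    (if p = Quot.mk _ (.cross none 1) then 1 - 2 * (g : ℤ) else 0)

open Classical in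
/-- The 2-bordism `D_σ → D_σ ⊔ circle` onto the vertically smoothed kink that is the identity of
`D_σ` with one 1-handle attached, which splits the new circle off from the strand of the kink. -/
def Shadow.split (Γ : Shadow V J m n) (χ : Γ.Coloring) (e : Dart V J m n)
    (he : Γ.tail e = true) (σ : V → Bool) (τ : Option V → Bool) :
    Bordism (Γ.smooth χ σ) ((Γ.kink e he).smooth (χ.kink e he) τ) where
  Comp := Quot (Γ.SplitStep e σ τ)
  finite_comp := by
    have : Finite (Dart (Option V) J m n) := Dart.finite
    infer_instance
  src d := Quot.mk _ d.old
  tgt d := Quot.mk _ d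
  src_edge d := (Quot.sound (show Γ.SplitStep e σ τ _ _ from Or.inl (.src_edge d))).symm
  src_join d := (Quot.sound (show Γ.SplitStep e σ τ _ _ from Or.inl (.src_join d))).symm
  tgt_edge d := (Quot.sound (show Γ.SplitStep e σ τ _ _ from Or.inl (.tgt_edge d))).symm
  tgt_join d := (Quot.sound (show Γ.SplitStep e σ τ _ _ from Or.inl (.tgt_join d))).symm
  src_bd y := by cases y <;> rfl
  euler p := (Γ.smooth χ σ).arcs (fun d => Quot.mk (Γ.SplitStep e σ τ) d.old) p +
    (if p = Quot.mk _ (.cross none 1) then -1 else 0)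

end Kinks

section ReidemeisterI

variable [Fintype V] [DecidableEq V] [Finite J] (k : Type*) [CommRing k]

/-- The brackets of `D`, `D⁻` and `D⁺`, with crossings ordered by `ν`, as complexes over one
category. -/
def Diagram.bracketNil (D : Diagram V J m n) (χ : D.Coloring) (ν : Option V ↪ ℕ) :
    GradedCx k χ.sign₀ χ.sign₁ :=
  D.bracket k χ (Function.Embedding.some.trans ν)

/-- The bracket of `D⁻`. -/
def Diagram.bracketNeg (D : Diagram V J m n) (χ : D.Coloring) (ν : Option V ↪ ℕ)
    (e : Dart V J m n) (he : D.tail e = true) : GradedCx k χ.sign₀ χ.sign₁ :=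
  (D.kinkNeg e he).bracket k (χ.kink e he) ν

/-- The bracket of `D⁺`. -/
def Diagram.bracketPos (D : Diagram V J m n) (χ : D.Coloring) (ν : Option V ↪ ℕ)
    (e : Dart V J m n) (he : D.tail e = true) : GradedCx k χ.sign₀ χ.sign₁ :=
  (D.kinkPos e he).bracket k (χ.kink e he) ν

/-- The genus-one morphism at the crossing of the kink. -/
def Diagram.kinkGenusOne (D : Diagram V J m n) (χ : D.Coloring) (ν : Option V ↪ ℕ)
    (e : Dart V J m n) (he : D.tail e = true) :
    GradedCx.Mat (D.bracketNeg k χ ν e he) (D.bracketPos k χ ν e he) :=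
  (D.kink e he).genusOne k (χ.kink e he) ν none

open Classical in
/-- The Reidemeister I morphism for the negative kink: the identity with a disc bounded by the new
circle, onto the states that contain the new crossing, with the sign `(-1)^μ` of the exterior
multiplication by the new crossing that is used in the differential. -/
def Diagram.reidNeg (D : Diagram V J m n) (χ : D.Coloring) (ν : Option V ↪ ℕ)
    (e : Dart V J m n) (he : D.tail e = true) :
    GradedCx.Mat (D.bracketNil k χ ν) (D.bracketNeg k χ ν e he) :=
  fun (x : D.State) (y : (D.kinkNeg e he).State) =>
    if y.r = x.r.map .some ∧ y.s = insert none (x.s.map .some) then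
      muSign ν (x.s.map .some) none •
        Chain.of k (D.newCircle χ e he 0 x.vertical y.vertical)
    else 0

open Classical in
/-- The Reidemeister I morphism for the positive kink: the identity with a one-holed torus bounded by
the new circle, minus the saddle that splits off the new circle, onto the states that do not contain
the new crossing. -/
def Diagram.reidPos (D : Diagram V J m n) (χ : D.Coloring) (ν : Option V ↪ ℕ)
    (e : Dart V J m n) (he : D.tail e = true) :
    GradedCx.Mat (D.bracketNil k χ ν) (D.bracketPos k χ ν e he) :=
  fun (x : D.State) (y : (D.kinkPos e he).State) =>
    if y.r = x.r.map .some ∧ y.s = x.s.map .some then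
      Chain.of k (D.newCircle χ e he 1 x.vertical y.vertical) -
        Chain.of k (D.split χ e he x.vertical y.vertical)
    else 0

end ReidemeisterI

end TangleCob

/-! The type of a 2-bordism is a partition into components with an Euler characteristic on each, so
questions about diffeomorphisms become algebra. Every bordism that occurs is described
(`Bordism.Presented`) by an equivalence relation on the ends of the target, a map from the ends of
the source, and an integral weight that corrects the Euler characteristic of a cylinder. Equal data
give isomorphic bordisms (`Bordism.Presented.iso`); gluing takes joins of relations and sums of
weights (`Bordism.Presented.comp`). Joins and sums are commutative, so bordisms attached at
different places commute.

The differential of a bracket is a sum over moves `t : V ⊕ V`, the saddles and the genus-one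
morphisms; each move adds its place to `s` or removes it. The signs of two such toggles anticommute
(`muSign_toggle_comm`) while the bordisms commute, so moves at different places cancel in pairs. Two
moves at the same place either cannot follow each other or are a saddle and a `Φ`. The saddle
connects the two sheets; then a tube between them is the same as a handle, and the two terms of `Φ`
cancel. The genus-one morphism at `c` behaves like one more toggle: it anticommutes with the
differentials, and the shift by `-1` turns this into commutation.

The vertical smoothing of the kink is the old diagram with a small circle, and bordisms onto it
commute with all moves of the old diagram. Only the saddle at the kink remains. The image of the
negative Reidemeister map lies where `c ∈ s`, so there is no such saddle. For the positive one the
saddle merges the circle with the strand, and both the torus and the splitting saddle become a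
handle on the strand, so their difference dies.

The triangle is neck cutting (`Shadow.newCircle_phi`). Let `p` be the sheet over the strand and `q`
the disc. The relation `4Tu` for two discs on `p` and two on `q` reads handle(p) + handle(q) = 2
tube(p,q), that is, tube(p,q) - handle(p) = handle(q) - tube(p,q). The left side is the disc
followed by `Φ`, the right side is the torus minus the splitting saddle. Since `4Tu` is imposed on
genuine surfaces only, an Euler characteristic count (`Shadow.newCircle_isSurface`) is needed.
Products are always formed on representatives, and only the result is passed to the quotient. -/

namespace TangleCob

/-! ## Presentations of 2-bordisms -/

section

/-- The equivalence relation generated by identifying two points. -/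
def pairSetoid {α : Type*} (a b : α) : Setoid α :=
  Relation.EqvGen.setoid fun x y => x = a ∧ y = b

theorem pairSetoid_le {α : Type*} {a b : α} {E : Setoid α} : pairSetoid a b ≤ E ↔ E a b := by
  constructor
  · intro h
    exact h (Relation.EqvGen.rel _ _ ⟨rfl, rfl⟩)
  · intro h
    exact Setoid.eqvGen_le (by rintro x y ⟨rfl, rfl⟩; exact h)

theorem setoid_map_le {α β : Type*} {E : Setoid α} {F : Setoid β} {f : α → β} :
    E.map f ≤ F ↔ ∀ a b, E a b → F (f a) (f b) := by
  constructor
  · intro h a b hab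
    exact h (Relation.EqvGen.rel _ _ ⟨a, b, hab, rfl, rfl⟩)
  · intro h
    exact Setoid.eqvGen_le (by rintro x y ⟨a, b, hab, rfl, rfl⟩; exact h a b hab)

theorem setoid_map_le_comap {α β : Type*} {E : Setoid α} {F : Setoid β} {f : α → β} :
    E.map f ≤ F ↔ E ≤ F.comap f := setoid_map_le

/-- `Setoid.map` is left adjoint to `Setoid.comap`, hence preserves joins. -/
theorem setoid_map_sup {α β : Type*} (E F : Setoid α) (f : α → β) :
    (E ⊔ F).map f = E.map f ⊔ F.map f := by
  apply eq_of_forall_ge_iff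
  intro c
  simp only [setoid_map_le_comap, sup_le_iff]

theorem setoid_map_id {α : Type*} (E : Setoid α) : E.map id = E := by
  apply eq_of_forall_ge_iff
  intro c
  simp only [setoid_map_le_comap, Setoid.comap_id]

theorem setoid_map_pair {α β : Type*} (a b : α) (f : α → β) :
    (pairSetoid a b).map f = pairSetoid (f a) (f b) := by
  apply eq_of_forall_ge_iff
  intro c
  simp only [setoid_map_le_comap, pairSetoid_le, Setoid.comap_rel]

theorem ker_quot_mk {α : Type*} (r : α → α → Prop) :
    Setoid.ker (Quot.mk r) = Relation.EqvGen.setoid r := by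
  ext a b
  exact ⟨fun h => Quot.eqvGen_exact h, fun h => Quot.eqvGen_sound h⟩

/-- Summing over the fibre of a map between finite types is the push-forward. -/
theorem finsum_fibre {A B : Type*} [Finite A] (h : A → B) (θ : A →₀ ℤ) (q : B) :
    ∑ᶠ p : {p : A // h p = q}, θ p = θ.mapDomain h q := by
  classical
  induction θ using Finsupp.induction_linear with
  | zero => simp
  | add f g hf hg =>
    rw [Finsupp.mapDomain_add, Finsupp.add_apply, ← hf, ← hg,
      ← finsum_add_distrib (Set.toFinite _) (Set.toFinite _)]
    rfl
  | single a z =>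
    rw [Finsupp.mapDomain_single, Finsupp.single_apply]
    split_ifs with haq
    · rw [finsum_eq_single _ ⟨a, haq⟩]
      · simp
      · rintro ⟨x, hx⟩ hne
        rw [Finsupp.single_apply, if_neg]
        rintro rfl
        exact hne rfl
    · apply finsum_eq_zero_of_forall_eq_zero
      rintro ⟨x, rfl⟩
      rw [Finsupp.single_apply, if_neg]
      rintro rfl
      exact haq rfl

variable {Y₀ Y₁ : Type} {ε₀ : Y₀ → Bool} {ε₁ : Y₁ → Bool}

theorem OneCob.finite_bdry (W : OneCob ε₀ ε₁) : Finite (Y₀ ⊕ Y₁) :=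
  have := W.finite_dart
  Finite.of_injective _ W.bd_injective

/-- The boundary points at which arcs start, as a weight on the ends of segments. -/
def OneCob.arcWeight (W : OneCob ε₀ ε₁) : W.Dart →₀ ℤ :=
  ∑ᶠ y : {y : Y₀ ⊕ Y₁ // W.out (W.bd y) = true}, Finsupp.single (W.bd y) 1

/-- Counting arcs is a push-forward, so the cylinder part of an Euler characteristic and its
corrections can be handled by the same linear calculus. -/
theorem OneCob.arcs_eq (W : OneCob ε₀ ε₁) {P : Type} (f : W.Dart → P) (p : P) :
    W.arcs f p = W.arcWeight.mapDomain f p := by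
  classical
  have := W.finite_bdry
  have := Fintype.ofFinite (Y₀ ⊕ Y₁)
  rw [OneCob.arcWeight, finsum_eq_sum_of_fintype, Finsupp.mapDomain_finsetSum]
  simp only [Finsupp.mapDomain_single, Finsupp.finsetSum_apply, Finsupp.single_apply]
  rw [Finset.sum_boole, OneCob.arcs, Nat.cast_inj, ← Fintype.card_subtype,
    ← Nat.card_eq_fintype_card]
  exact Nat.card_congr (Equiv.subtypeSubtypeEquivSubtypeInter
    (fun y => W.out (W.bd y) = true) (fun y => f (W.bd y) = p)).symm

/-- The bordism `S` has the components `X.Dart / E`, each piece `d` of the source lies in the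
component of `f d`, and the Euler characteristics are given by the push-forward of the weight `w`,
in addition to those of `W × [0,1]`. -/
structure Bordism.Presented {W X : OneCob ε₀ ε₁} (S : Bordism W X) (f : W.Dart → X.Dart)
    (E : Setoid X.Dart) (w : X.Dart →₀ ℤ) : Prop where
  src_eq : ∀ d, S.src d = S.tgt (f d)
  ker_tgt : Setoid.ker S.tgt = E
  surj : Function.Surjective S.tgt
  euler_eq : ∀ p, S.euler p = (W.arcWeight.mapDomain f + w).mapDomain S.tgt p

theorem OneCob.arcs_comp_add (W : OneCob ε₀ ε₁) {P Q : Type} (f : W.Dart → Q) (t : Q → P)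
    (u : Q →₀ ℤ) (p : P) :
    W.arcs (t ∘ f) p + u.mapDomain t p = (W.arcWeight.mapDomain f + u).mapDomain t p := by
  rw [OneCob.arcs_eq, Finsupp.mapDomain_add, Finsupp.mapDomain_comp, Finsupp.add_apply]

theorem single_mapDomain_ite {P Q : Type} [DecidableEq P] (t : Q → P) (a : Q) (z : ℤ) (p : P) :
    (if p = t a then z else 0) = (Finsupp.single a z).mapDomain t p := by
  rw [Finsupp.mapDomain_single, Finsupp.single_apply]
  simp only [eq_comm]

namespace Bordism.Presented

variable {W X Z : OneCob ε₀ ε₁} {S T : Bordism W X} {f : W.Dart → X.Dart} {E : Setoid X.Dart}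
  {w : X.Dart →₀ ℤ}

theorem tgt_eq (hS : S.Presented f E w) {a b : X.Dart} : S.tgt a = S.tgt b ↔ E a b := by
  rw [← hS.ker_tgt]; rfl

theorem congr (hS : S.Presented f E w) {f' : W.Dart → X.Dart} {E' : Setoid X.Dart}
    {w' : X.Dart →₀ ℤ} (hf : f = f') (hE : E = E') (hw : w = w') : S.Presented f' E' w' := by
  subst hf hE hw
  exact hS

/-- The universal property of the components: the map from the ends of the target is onto, with
kernel `E`. -/
theorem exists_factor (hS : S.Presented f E w) {B : Type*} (g : X.Dart → B)
    (hg : ∀ a b, E a b → g a = g b) : ∃ h : S.Comp → B, ∀ a, h (S.tgt a) = g a := by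
  refine ⟨fun p => g (Function.surjInv hS.surj p), fun a => hg _ _ ?_⟩
  exact hS.tgt_eq.1 (Function.surjInv_eq hS.surj _)

/-- Both sets of components are copies of the quotient of `X.Dart` by `E`, and the remaining data
are determined by `f` and `w`. All diffeomorphisms in the proof come from here. -/
theorem iso (hS : S.Presented f E w) (hT : T.Presented f E w) : S.Iso T := by
  obtain ⟨φ, hφ⟩ := hS.exists_factor T.tgt fun a b h => hT.tgt_eq.2 h
  have hb : Function.Bijective φ := by
    constructor
    · intro p q h
      obtain ⟨a, rfl⟩ := hS.surj p
      obtain ⟨b, rfl⟩ := hS.surj q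
      rw [hφ, hφ, hT.tgt_eq] at h
      exact hS.tgt_eq.2 h
    · intro q
      obtain ⟨a, rfl⟩ := hT.surj q
      exact ⟨_, hφ a⟩
  refine ⟨Equiv.ofBijective φ hb, fun d => ?_, hφ, fun p => ?_⟩
  · rw [Equiv.ofBijective_apply, hS.src_eq, hφ, hT.src_eq]
  · have : T.tgt = φ ∘ S.tgt := funext fun a => (hφ a).symm
    rw [Equiv.ofBijective_apply, hT.euler_eq, hS.euler_eq, this, Finsupp.mapDomain_comp,
      Finsupp.mapDomain_apply hb.1]

/-- Only the total weight of each component matters, so weights may be moved within a class of `E`.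
-/
theorem weight_congr (hS : S.Presented f E w) {w' : X.Dart →₀ ℤ}
    (h : ∀ {B : Type} (g : X.Dart → B), (∀ a b, E a b → g a = g b) →
      w.mapDomain g = w'.mapDomain g) : S.Presented f E w' where
  src_eq := hS.src_eq
  ker_tgt := hS.ker_tgt
  surj := hS.surj
  euler_eq p := by
    rw [hS.euler_eq, Finsupp.mapDomain_add, Finsupp.mapDomain_add,
      h S.tgt fun a b hab => hS.tgt_eq.2 hab]

/-- Gluing of presented bordisms. -/
theorem comp {S : Bordism W X} {T : Bordism X Z} {g : X.Dart → Z.Dart} {F : Setoid Z.Dart}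
    {u : Z.Dart →₀ ℤ} (hS : S.Presented f E w) (hT : T.Presented g F u) :
    (S.comp T).Presented (g ∘ f) (F ⊔ E.map g) (u + w.mapDomain g) := by
  -- Hence every component of the glued surface is visible from an end of `Z`.
  have glue : ∀ x, Quot.mk (glueStep S T) (Sum.inl (S.tgt x)) =
      Quot.mk (glueStep S T) (Sum.inr (T.tgt (g x))) := by
    intro x
    rw [← hT.src_eq]
    exact Quot.sound ⟨x, rfl, rfl⟩
  constructor
  · intro d
    change Quot.mk _ (Sum.inl (S.src d)) = Quot.mk _ (Sum.inr (T.tgt _))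
    rw [hS.src_eq, glue]
    rfl
  · apply le_antisymm
    -- The maps `φ` and `ψ` send the components of the two halves to classes of the join. They agree
    -- along `X`, so ends in one glued component are related by the join.
    · obtain ⟨φ, hφ⟩ := hS.exists_factor
        (fun x => (Quotient.mk (F ⊔ E.map g) (g x) : Quotient (F ⊔ E.map g)))
        fun a b h => Quotient.sound
          ((le_sup_right : E.map g ≤ F ⊔ E.map g) (setoid_map_le.1 le_rfl a b h))
      obtain ⟨ψ, hψ⟩ := hT.exists_factor
        (fun x => (Quotient.mk (F ⊔ E.map g) x : Quotient (F ⊔ E.map g)))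
        fun a b h => Quotient.sound ((le_sup_left : F ≤ F ⊔ E.map g) h)
      have hstep : ∀ a b, glueStep S T a b → Sum.elim φ ψ a = Sum.elim φ ψ b := by
        rintro _ _ ⟨d, rfl, rfl⟩
        simp only [Sum.elim_inl, Sum.elim_inr]
        rw [hφ, hT.src_eq, hψ]
      intro a b hab
      have h := congrArg (Quot.lift (Sum.elim φ ψ) hstep) hab
      change ψ (T.tgt a) = ψ (T.tgt b) at h
      rw [hψ, hψ] at h
      exact Quotient.exact h
    · refine sup_le ?_ (setoid_map_le.2 ?_)
      · intro a b h
        exact congrArg (fun p => Quot.mk (glueStep S T) (Sum.inr p)) (hT.tgt_eq.2 h)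
      · intro a b h
        change Quot.mk (glueStep S T) (Sum.inr (T.tgt (g a))) =
          Quot.mk (glueStep S T) (Sum.inr (T.tgt (g b)))
        rw [← glue, ← glue, hS.tgt_eq.2 h]
  · intro q
    induction q using Quot.ind with | _ p
    rcases p with p | p
    · obtain ⟨a, rfl⟩ := hS.surj p
      exact ⟨g a, (glue a).symm⟩
    · obtain ⟨a, rfl⟩ := hT.surj p
      exact ⟨a, rfl⟩
  · intro (q : Quot (glueStep S T))
    have := S.finite_comp
    have := T.finite_comp
    have e1 := finsum_fibre (fun p => Quot.mk (glueStep S T) (Sum.inl p))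
      ((W.arcWeight.mapDomain f + w).mapDomain S.tgt) q
    have e2 := finsum_fibre (fun p => Quot.mk (glueStep S T) (Sum.inr p))
      ((X.arcWeight.mapDomain g + u).mapDomain T.tgt) q
    simp only [← hS.euler_eq, ← hT.euler_eq] at e1 e2
    let t : Z.Dart → Quot (glueStep S T) := fun a => Quot.mk _ (Sum.inr (T.tgt a))
    change _ + _ - OneCob.arcs X _ q = Finsupp.mapDomain t _ q
    rw [e1, e2, OneCob.arcs_eq]
    have hfun : (fun x => Quot.mk (glueStep S T) (Sum.inl (S.tgt x))) = t ∘ g := funext glue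
    have h1 (θ : X.Dart →₀ ℤ) : (θ.mapDomain S.tgt).mapDomain
        (fun p => Quot.mk (glueStep S T) (Sum.inl p)) = (θ.mapDomain g).mapDomain t := by
      rw [← Finsupp.mapDomain_comp, ← Finsupp.mapDomain_comp, ← hfun]
      rfl
    have h2 (θ : Z.Dart →₀ ℤ) : (θ.mapDomain T.tgt).mapDomain
        (fun p => Quot.mk (glueStep S T) (Sum.inr p)) = θ.mapDomain t := by
      rw [← Finsupp.mapDomain_comp]
      rfl
    rw [h1, h2, hfun]
    -- The arcs of `X` enter once through the cylinder part of `T` and are subtracted once by the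
    -- gluing formula.
    simp only [Finsupp.mapDomain_add, Finsupp.add_apply, Finsupp.mapDomain_comp]
    ring

/-- Attaching a tube to a presented bordism. -/
theorem addTube (hS : S.Presented f E w) (a b : X.Dart) :
    (S.addTube (S.tgt a) (S.tgt b)).Presented f (E ⊔ pairSetoid a b)
      (w + Finsupp.single a (-2)) := by
  classical
  constructor
  · intro d
    exact congrArg (Quot.mk _) (hS.src_eq d)
  · apply le_antisymm
    · obtain ⟨φ, hφ⟩ := hS.exists_factor
        (fun x => (Quotient.mk (E ⊔ pairSetoid a b) x : Quotient (E ⊔ pairSetoid a b)))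
        fun a b h => Quotient.sound ((le_sup_left : E ≤ _) h)
      have hstep : ∀ p q, (p = S.tgt a ∧ q = S.tgt b) → φ p = φ q := by
        rintro _ _ ⟨rfl, rfl⟩
        rw [hφ, hφ]
        exact Quotient.sound ((le_sup_right : pairSetoid a b ≤ _) (pairSetoid_le.1 le_rfl))
      intro x y hxy
      have h := congrArg (Quot.lift φ hstep) hxy
      change φ (S.tgt x) = φ (S.tgt y) at h
      rw [hφ, hφ] at h
      exact Quotient.exact h
    · refine sup_le ?_ (pairSetoid_le.2 ?_)
      · intro x y h
        exact congrArg (Quot.mk _) (hS.tgt_eq.2 h)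
      · exact Quot.sound ⟨rfl, rfl⟩
  · intro q
    induction q using Quot.ind with | _ p
    obtain ⟨a, rfl⟩ := hS.surj p
    exact ⟨a, rfl⟩
  · intro q
    have := S.finite_comp
    have e1 := finsum_fibre (Quot.mk fun p q : S.Comp => p = S.tgt a ∧ q = S.tgt b)
      ((W.arcWeight.mapDomain f + w).mapDomain S.tgt) q
    simp only [← hS.euler_eq] at e1
    change _ - _ = _
    rw [e1, ← Finsupp.mapDomain_comp, ← add_assoc, Finsupp.mapDomain_add (v₂ := Finsupp.single _ _),
      Finsupp.mapDomain_single, Finsupp.add_apply, Finsupp.single_apply]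
    change _ - ite (q = (S.addTube (S.tgt a) (S.tgt b)).tgt a) _ _ = _ + ite _ _ _
    simp only [eq_comm (a := q)]
    split_ifs
    · rfl
    · rw [sub_zero, add_zero]; rfl

end Bordism.Presented

end

/-! ## Elementary bordisms between smoothings -/

section

variable {V J : Type} {m n : ℕ}

/-- The components of a smoothing. -/
def Shadow.conn (Γ : Shadow V J m n) (σ : V → Bool) : Setoid (Dart V J m n) :=
  Relation.EqvGen.setoid fun a b => b = Γ.edge a ∨ b = smoothJoin σ a

theorem Shadow.conn_le {Γ : Shadow V J m n} {σ : V → Bool} {E : Setoid (Dart V J m n)} :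
    Γ.conn σ ≤ E ↔ (∀ d, E d (Γ.edge d)) ∧ ∀ d, E d (smoothJoin σ d) := by
  constructor
  · intro h
    exact ⟨fun d => h (Relation.EqvGen.rel _ _ (Or.inl rfl)),
      fun d => h (Relation.EqvGen.rel _ _ (Or.inr rfl))⟩
  · intro h
    refine Setoid.eqvGen_le ?_
    rintro a b (rfl | rfl)
    exacts [h.1 a, h.2 a]

theorem Shadow.conn_edge (Γ : Shadow V J m n) (σ : V → Bool) (d : Dart V J m n) :
    Γ.conn σ d (Γ.edge d) := (Shadow.conn_le.1 le_rfl).1 d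

theorem Shadow.conn_join (Γ : Shadow V J m n) (σ : V → Bool) (d : Dart V J m n) :
    Γ.conn σ d (smoothJoin σ d) := (Shadow.conn_le.1 le_rfl).2 d

theorem Shadow.traceStep_setoid (Γ : Shadow V J m n) (σ τ : V → Bool) :
    Relation.EqvGen.setoid (Γ.TraceStep σ τ) = Γ.conn σ ⊔ Γ.conn τ := by
  apply le_antisymm
  · refine Setoid.eqvGen_le ?_
    rintro a b (d | d | d)
    · exact (le_sup_left : Γ.conn σ ≤ _) (Γ.conn_edge σ a)
    · exact (le_sup_left : Γ.conn σ ≤ _) (Γ.conn_join σ a)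
    · exact (le_sup_right : Γ.conn τ ≤ Γ.conn σ ⊔ _) (Γ.conn_join τ a)
  · refine sup_le (Shadow.conn_le.2 ⟨?_, ?_⟩) (Shadow.conn_le.2 ⟨?_, ?_⟩) <;>
    intro d <;> apply Relation.EqvGen.rel
    exacts [.edge d, .src d, .edge d, .tgt d]

theorem smoothJoin_congr {σ τ : V → Bool} {v : V} (h : σ v = τ v) (i : Fin 4) :
    smoothJoin σ (.cross v i : Dart V J m n) = smoothJoin τ (.cross v i) := by
  simp [smoothJoin, h]

/-- If `ρ` agrees at each crossing with `σ` or `τ`, its components are connected in the union. -/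
theorem Shadow.conn_le_sup (Γ : Shadow V J m n) {σ ρ τ : V → Bool}
    (h : ∀ v, ρ v = σ v ∨ ρ v = τ v) : Γ.conn ρ ≤ Γ.conn σ ⊔ Γ.conn τ := by
  refine Shadow.conn_le.2 ⟨fun d => (le_sup_left : Γ.conn σ ≤ _) (Γ.conn_edge σ d), fun d => ?_⟩
  rcases d with ⟨v, i⟩ | ⟨j, b⟩ | i | i
  · rcases h v with h | h
    · rw [smoothJoin_congr h]
      exact (le_sup_left : Γ.conn σ ≤ _) (Γ.conn_join σ _)
    · rw [smoothJoin_congr h]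
      exact (le_sup_right : Γ.conn τ ≤ Γ.conn σ ⊔ _) (Γ.conn_join τ _)
  all_goals exact (le_sup_left : Γ.conn σ ≤ _) (Γ.conn_join σ _)

/-- A horizontal smoothing connects the ends `0` and `1`. -/
theorem Shadow.pair_le_conn (Γ : Shadow V J m n) {σ : V → Bool} {v : V} (h : σ v = false) :
    pairSetoid (.cross v 0) (.cross v 1) ≤ Γ.conn σ := by
  refine pairSetoid_le.2 ?_
  have := Γ.conn_join σ (.cross v 0)
  simpa [smoothJoin, h] using this

/-- One of the two smoothings is horizontal at `v`. This expresses that a saddle connects the two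
sheets. -/
theorem Shadow.pair_le_conn_sup (Γ : Shadow V J m n) {σ τ : V → Bool} {v : V} (h : σ v ≠ τ v) :
    pairSetoid (.cross v 0) (.cross v 1) ≤ Γ.conn σ ⊔ Γ.conn τ := by
  cases hσ : σ v with
  | false => exact (Γ.pair_le_conn hσ).trans le_sup_left
  | true => exact (Γ.pair_le_conn (by cases hτ : τ v <;> simp_all)).trans le_sup_right

section Elementary

variable [Finite V] [Finite J] {Γ : Shadow V J m n} {χ : Γ.Coloring}

/-- A 2-bordism between smoothings of one diagram through which the segments run, with additional
connections `X` between the components. -/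
def Shadow.IsElem {σ τ : V → Bool} (S : Bordism (Γ.smooth χ σ) (Γ.smooth χ τ))
    (X : Setoid (Dart V J m n)) (w : Dart V J m n →₀ ℤ) : Prop :=
  S.Presented (id : Dart V J m n → Dart V J m n) (Γ.conn σ ⊔ Γ.conn τ ⊔ X) w

theorem Shadow.isElem_trace (σ τ : V → Bool) (w : Quot (Γ.TraceStep σ τ) → ℤ)
    (u : Dart V J m n →₀ ℤ) (h : ∀ p, w p = u.mapDomain (Quot.mk _) p) :
    Γ.IsElem (Γ.trace χ σ τ w) ⊥ u where
  src_eq _ := rfl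
  ker_tgt := (ker_quot_mk _).trans ((Γ.traceStep_setoid σ τ).trans (sup_bot_eq _).symm)
  surj := Quot.mk_surjective
  euler_eq p := (congrArg (OneCob.arcs _ _ p + ·) (h p)).trans
    ((Γ.smooth χ σ).arcs_comp_add (id : Dart V J m n → Dart V J m n) (Quot.mk _) u p)

theorem Shadow.isElem_saddle (σ τ : V → Bool) (v : V) :
    Γ.IsElem (Γ.saddle χ σ τ v) ⊥ (Finsupp.single (.cross v 0) (-1)) := by
  classical
  refine Shadow.isElem_trace _ _ _ _ fun p => ?_
  exact single_mapDomain_ite (Quot.mk (Γ.TraceStep σ τ)) (.cross v 0) (-1) p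

theorem Shadow.isElem_cylinder (σ τ : V → Bool) : Γ.IsElem (Γ.cylinder χ σ τ) ⊥ 0 :=
  Shadow.isElem_trace _ _ _ _ fun p => by simp

theorem Shadow.isElem_phiFst (σ τ : V → Bool) (v : V) :
    Γ.IsElem (Γ.phiFst χ σ τ v) (pairSetoid (.cross v 0) (.cross v 1))
      (Finsupp.single (.cross v 0) (-2)) := by
  have h := (Shadow.isElem_cylinder (χ := χ) σ τ).addTube (.cross v 0) (.cross v 1)
  exact h.congr rfl (congrArg (· ⊔ _) (sup_bot_eq _)) (zero_add _)

theorem Shadow.isElem_phiSnd (σ τ : V → Bool) (v : V) :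
    Γ.IsElem (Γ.phiSnd χ σ τ v) (pairSetoid (.cross v 0) (.cross v 0))
      (Finsupp.single (.cross v 0) (-2)) := by
  have h := (Shadow.isElem_cylinder (χ := χ) σ τ).addTube (.cross v 0) (.cross v 0)
  exact h.congr rfl (congrArg (· ⊔ _) (sup_bot_eq _)) (zero_add _)

theorem pairSetoid_self {α : Type*} (a : α) : pairSetoid a a = ⊥ :=
  le_bot_iff.1 (pairSetoid_le.2 rfl)

/-- By `h` the intermediate smoothing makes no connection that the outer two do not make, so `ρ`
disappears from the presentation. What is left is symmetric in the two factors. -/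
theorem Shadow.IsElem.comp {σ ρ τ : V → Bool} {S : Bordism (Γ.smooth χ σ) (Γ.smooth χ ρ)}
    {T : Bordism (Γ.smooth χ ρ) (Γ.smooth χ τ)} {X Y : Setoid (Dart V J m n)}
    {w u : Dart V J m n →₀ ℤ} (hS : Γ.IsElem S X w) (hT : Γ.IsElem T Y u)
    (h : ∀ v, ρ v = σ v ∨ ρ v = τ v) : Γ.IsElem (S.comp T) (X ⊔ Y) (w + u) := by
  have hc := Bordism.Presented.comp hS hT
  have h1 : Γ.conn ρ ⊔ Γ.conn τ ⊔ Y ⊔ Setoid.map (Γ.conn σ ⊔ Γ.conn ρ ⊔ X) id =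
      Γ.conn σ ⊔ Γ.conn τ ⊔ (X ⊔ Y) := by
    rw [setoid_map_id]
    have := Γ.conn_le_sup h
    apply le_antisymm
    · have h2 : Γ.conn ρ ≤ Γ.conn σ ⊔ Γ.conn τ ⊔ (X ⊔ Y) := this.trans le_sup_left
      simp only [sup_le_iff, h2, true_and, and_true]
      refine ⟨⟨?_, ?_⟩, ?_, ?_⟩
      · exact le_sup_right.trans le_sup_left
      · exact le_sup_right.trans le_sup_right
      · exact le_sup_left.trans le_sup_left
      · exact le_sup_left.trans le_sup_right
    · simp only [sup_le_iff]
      refine ⟨⟨?_, ?_⟩, ?_, ?_⟩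
      · exact le_sup_left.trans (le_sup_left.trans le_sup_right)
      · exact le_sup_right.trans (le_sup_left.trans le_sup_left)
      · exact le_sup_right.trans le_sup_right
      · exact le_sup_right.trans le_sup_left
  have h2 : u + Finsupp.mapDomain id w = w + u := by
    rw [Finsupp.mapDomain_id, add_comm]
  exact hc.congr rfl h1 h2

/-- Two elementary bordisms in different places commute. -/
theorem Shadow.IsElem.comm {σ ρ ρ' τ : V → Bool}
    {S : Bordism (Γ.smooth χ σ) (Γ.smooth χ ρ)} {T : Bordism (Γ.smooth χ ρ) (Γ.smooth χ τ)}
    {T' : Bordism (Γ.smooth χ σ) (Γ.smooth χ ρ')} {S' : Bordism (Γ.smooth χ ρ') (Γ.smooth χ τ)}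
    {X Y : Setoid (Dart V J m n)} {w u : Dart V J m n →₀ ℤ}
    (hS : Γ.IsElem S X w) (hT : Γ.IsElem T Y u) (hT' : Γ.IsElem T' Y u) (hS' : Γ.IsElem S' X w)
    (h : ∀ v, ρ v = σ v ∨ ρ v = τ v) (h' : ∀ v, ρ' v = σ v ∨ ρ' v = τ v) :
    (S.comp T).Iso (T'.comp S') := by
  have h1 := hS.comp hT h
  have h2 := hT'.comp hS' h'
  rw [sup_comm, add_comm] at h2
  exact h1.iso h2

/-- Connections that are there already can be omitted. -/
theorem Shadow.IsElem.absorb {σ τ : V → Bool} {S : Bordism (Γ.smooth χ σ) (Γ.smooth χ τ)}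
    {X : Setoid (Dart V J m n)} {w : Dart V J m n →₀ ℤ} (hS : Γ.IsElem S X w)
    (h : X ≤ Γ.conn σ ⊔ Γ.conn τ) : Γ.IsElem S ⊥ w := by
  exact Bordism.Presented.congr hS rfl ((sup_eq_left.2 h).trans (sup_bot_eq _).symm) rfl

/-- After a saddle, a tube between the two sheets is a handle. -/
theorem Shadow.saddle_phi_iso {σ ρ τ : V → Bool} {v : V} (hv : σ v ≠ τ v)
    (h : ∀ v, ρ v = σ v ∨ ρ v = τ v) :
    ((Γ.saddle χ σ ρ v).comp (Γ.phiFst χ ρ τ v)).Iso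
      ((Γ.saddle χ σ ρ v).comp (Γ.phiSnd χ ρ τ v)) := by
  have h1 := (Shadow.isElem_saddle (χ := χ) σ ρ v).comp (Shadow.isElem_phiFst ρ τ v) h
  have h2 := (Shadow.isElem_saddle (χ := χ) σ ρ v).comp (Shadow.isElem_phiSnd ρ τ v) h
  rw [bot_sup_eq] at h1
  rw [bot_sup_eq, pairSetoid_self] at h2
  -- Tube and handle have the same weight `-2`; they differ only in the connection of the ends `0`
  -- and `1`, which the saddle makes anyway.
  exact (h1.absorb (Γ.pair_le_conn_sup hv)).iso h2

/-- The mirror image: the saddle that follows joins the two sheets. -/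
theorem Shadow.phi_saddle_iso {σ ρ τ : V → Bool} {v : V} (hv : σ v ≠ τ v)
    (h : ∀ v, ρ v = σ v ∨ ρ v = τ v) :
    ((Γ.phiFst χ σ ρ v).comp (Γ.saddle χ ρ τ v)).Iso
      ((Γ.phiSnd χ σ ρ v).comp (Γ.saddle χ ρ τ v)) := by
  have h1 := (Shadow.isElem_phiFst (χ := χ) σ ρ v).comp (Shadow.isElem_saddle ρ τ v) h
  have h2 := (Shadow.isElem_phiSnd (χ := χ) σ ρ v).comp (Shadow.isElem_saddle ρ τ v) h
  rw [sup_bot_eq] at h1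
  rw [sup_bot_eq, pairSetoid_self] at h2
  exact (h1.absorb (Γ.pair_le_conn_sup hv)).iso h2

end Elementary

/-! ## Bordisms onto the kink -/

/-- `τ` is the state of the diagram with a kink that extends `σ` by the vertical smoothing. -/
def KinkState (σ : V → Bool) (τ : Option V → Bool) : Prop :=
  (∀ v, τ (some v) = σ v) ∧ τ none = true

theorem smoothJoin_old {σ : V → Bool} {τ : Option V → Bool} (h : ∀ v, τ (some v) = σ v)
    (d : Dart V J m n) : smoothJoin τ d.old = (smoothJoin σ d).old := by
  cases d <;> simp [smoothJoin, Dart.old, h]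

/-- Inserting the kink cuts the edge at `e`, but the vertical smoothing connects the two halves
again through the ends `0` and `3` of the new crossing. -/
theorem Shadow.map_conn_le (Γ : Shadow V J m n) (e : Dart V J m n) (he : Γ.tail e = true)
    {σ : V → Bool} {τ : Option V → Bool} (h : KinkState σ τ) :
    (Γ.conn σ).map Dart.old ≤ (Γ.kink e he).conn τ := by
  set E := (Γ.kink e he).conn τ with hE
  have hedge (d) : E d (Γ.kinkEdge e d) := (Γ.kink e he).conn_edge τ d
  have h03 : E (.cross none 0) (.cross none 3) := by
    have := (Γ.kink e he).conn_join τ (.cross none 0)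
    simpa [smoothJoin, h.2] using this
  have he' : E e.old (Γ.edge e).old := by
    have h1 := hedge e.old
    have h2 := hedge (Γ.edge e).old
    rw [Γ.kinkEdge_old_self] at h1
    rw [Γ.kinkEdge_old_edge] at h2
    exact E.trans' h1 (E.trans' h03 (E.symm' h2))
  rw [setoid_map_le_comap, Shadow.conn_le]
  simp only [Setoid.comap_rel]
  refine ⟨fun d => ?_, fun d => ?_⟩
  · by_cases h1 : d = e
    · subst h1
      exact he'
    by_cases h2 : d = Γ.edge e
    · subst h2
      rw [Γ.edge_edge]
      exact E.symm' he'
    rw [← Γ.kinkEdge_old e d h1 h2]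
    exact hedge _
  · rw [← smoothJoin_old h.1]
    exact (Γ.kink e he).conn_join τ _

theorem Shadow.kinkStep_setoid (Γ : Shadow V J m n) (e : Dart V J m n) (he : Γ.tail e = true)
    (σ : V → Bool) (τ : Option V → Bool) : Relation.EqvGen.setoid (Γ.KinkStep e σ τ) =
      (Γ.kink e he).conn τ ⊔ (Γ.conn σ).map Dart.old := by
  apply le_antisymm
  · refine Setoid.eqvGen_le ?_
    rintro a b (d | d | d | d)
    · exact (le_sup_left : (Γ.kink e he).conn τ ≤ _) ((Γ.kink e he).conn_edge τ a)
    · exact (le_sup_left : (Γ.kink e he).conn τ ≤ _) ((Γ.kink e he).conn_join τ a)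
    · exact (le_sup_right : (Γ.conn σ).map Dart.old ≤ (Γ.kink e he).conn τ ⊔ _)
        (setoid_map_le.1 le_rfl _ _ (Γ.conn_edge σ d))
    · exact (le_sup_right : (Γ.conn σ).map Dart.old ≤ (Γ.kink e he).conn τ ⊔ _)
        (setoid_map_le.1 le_rfl _ _ (Γ.conn_join σ d))
  · refine sup_le (Shadow.conn_le.2 ⟨?_, ?_⟩)
      (setoid_map_le_comap.2 (Shadow.conn_le.2 ⟨?_, ?_⟩)) <;>
    intro d <;> apply Relation.EqvGen.rel
    exacts [.tgt_edge d, .tgt_join d, .src_edge d, .src_join d]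

theorem Shadow.splitStep_setoid (Γ : Shadow V J m n) (e : Dart V J m n) (he : Γ.tail e = true)
    (σ : V → Bool) (τ : Option V → Bool) : Relation.EqvGen.setoid (Γ.SplitStep e σ τ) =
      (Γ.kink e he).conn τ ⊔ (Γ.conn σ).map Dart.old ⊔
        pairSetoid (.cross none 0) (.cross none 1) := by
  rw [← Γ.kinkStep_setoid e he]
  apply le_antisymm
  · refine Setoid.eqvGen_le ?_
    rintro a b (h | ⟨rfl, rfl⟩)
    · exact (le_sup_left : Relation.EqvGen.setoid (Γ.KinkStep e σ τ) ≤ _)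
        (Relation.EqvGen.rel _ _ h)
    · exact pairSetoid_le.1 le_sup_right
  · refine sup_le (Setoid.eqvGen_mono fun a b h => Or.inl h) (pairSetoid_le.2 ?_)
    exact Relation.EqvGen.rel _ _ (Or.inr ⟨rfl, rfl⟩)

/-- The components of a smoothing of the kink are those of the old diagram away from the kink. -/
theorem Shadow.kink_conn_le {Γ : Shadow V J m n} {e : Dart V J m n} {he : Γ.tail e = true}
    {σ : V → Bool} {τ τ' : Option V → Bool} (h : KinkState σ τ)
    (h' : τ' none = true) :
    (Γ.kink e he).conn τ ≤ (Γ.kink e he).conn τ' ⊔ (Γ.conn σ).map Dart.old := by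
  refine Shadow.conn_le.2 ⟨fun d => (le_sup_left : (Γ.kink e he).conn τ' ≤ _)
    ((Γ.kink e he).conn_edge τ' d), ?_⟩
  apply Dart.cases_old
  · intro d
    rw [smoothJoin_old h.1]
    exact (le_sup_right : (Γ.conn σ).map Dart.old ≤ (Γ.kink e he).conn τ' ⊔ _)
      (setoid_map_le.1 le_rfl _ _ (Γ.conn_join σ d))
  · intro i
    rw [smoothJoin_congr (h.2.trans h'.symm)]
    exact (le_sup_left : (Γ.kink e he).conn τ' ≤ _) ((Γ.kink e he).conn_join τ' _)

section KinkBordisms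

variable [Finite V] [Finite J] {Γ : Shadow V J m n} {χ : Γ.Coloring} {e : Dart V J m n}
  {he : Γ.tail e = true}

/-- A 2-bordism from a smoothing of the diagram to one of the diagram with a kink through which the
segments run, with additional connections `X` between the components. -/
def Shadow.IsKinkElem {σ : V → Bool} {τ : Option V → Bool}
    (S : Bordism (Γ.smooth χ σ) ((Γ.kink e he).smooth (χ.kink e he) τ))
    (X : Setoid (Dart (Option V) J m n)) (w : Dart (Option V) J m n →₀ ℤ) : Prop :=
  S.Presented (Dart.old : Dart V J m n → Dart (Option V) J m n)
    ((Γ.kink e he).conn τ ⊔ (Γ.conn σ).map Dart.old ⊔ X) w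

theorem Shadow.isKinkElem_newCircle (g : ℕ) (σ : V → Bool) (τ : Option V → Bool) :
    Γ.IsKinkElem (Γ.newCircle χ e he g σ τ) ⊥ (Finsupp.single (.cross none 1) (1 - 2 * (g : ℤ)))
    where
  src_eq _ := rfl
  ker_tgt := (ker_quot_mk _).trans ((Γ.kinkStep_setoid e he σ τ).trans (sup_bot_eq _).symm)
  surj := Quot.mk_surjective
  euler_eq p := by
    classical
    exact (congrArg (OneCob.arcs _ _ p + ·)
      (single_mapDomain_ite (Quot.mk (Γ.KinkStep e σ τ)) _ _ p)).trans
      ((Γ.smooth χ σ).arcs_comp_add (Dart.old : Dart V J m n → _) (Quot.mk _) _ p)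

theorem Shadow.isKinkElem_split (σ : V → Bool) (τ : Option V → Bool) :
    Γ.IsKinkElem (Γ.split χ e he σ τ) (pairSetoid (.cross none 0) (.cross none 1))
      (Finsupp.single (.cross none 1) (-1)) where
  src_eq _ := rfl
  ker_tgt := (ker_quot_mk _).trans (Γ.splitStep_setoid e he σ τ)
  surj := Quot.mk_surjective
  euler_eq p := by
    classical
    exact (congrArg (OneCob.arcs _ _ p + ·)
      (single_mapDomain_ite (Quot.mk (Γ.SplitStep e σ τ)) _ _ p)).trans
      ((Γ.smooth χ σ).arcs_comp_add (Dart.old : Dart V J m n → _) (Quot.mk _) _ p)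

theorem Shadow.IsKinkElem.absorb {σ : V → Bool} {τ : Option V → Bool}
    {S : Bordism (Γ.smooth χ σ) ((Γ.kink e he).smooth (χ.kink e he) τ)}
    {X Z : Setoid (Dart (Option V) J m n)} {w : Dart (Option V) J m n →₀ ℤ}
    (hS : Γ.IsKinkElem S (Z ⊔ X) w) (h : Z ≤ (Γ.kink e he).conn τ ⊔ (Γ.conn σ).map Dart.old) :
    Γ.IsKinkElem S X w := by
  exact Bordism.Presented.congr hS rfl
    ((sup_assoc _ _ _).symm.trans (congrArg (· ⊔ X) (sup_eq_left.2 h))) rfl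

/-- The connections of the intermediate smoothing are kept as an extra term. They are absorbed later
where that is possible; for the saddle at the kink they are left in place. -/
theorem Shadow.IsKinkElem.comp_elem {σ : V → Bool} {τ τ' : Option V → Bool}
    {S : Bordism (Γ.smooth χ σ) ((Γ.kink e he).smooth (χ.kink e he) τ)}
    {T : Bordism ((Γ.kink e he).smooth (χ.kink e he) τ) ((Γ.kink e he).smooth (χ.kink e he) τ')}
    {X Y : Setoid (Dart (Option V) J m n)} {w u : Dart (Option V) J m n →₀ ℤ}
    (hS : Γ.IsKinkElem S X w) (hT : (Γ.kink e he).IsElem T Y u) :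
    Γ.IsKinkElem (S.comp T) ((Γ.kink e he).conn τ ⊔ (X ⊔ Y)) (w + u) := by
  have hc := Bordism.Presented.comp hS hT
  have h1 : (Γ.kink e he).conn τ ⊔ (Γ.kink e he).conn τ' ⊔ Y ⊔ Setoid.map
      ((Γ.kink e he).conn τ ⊔ (Γ.conn σ).map Dart.old ⊔ X) id = (Γ.kink e he).conn τ' ⊔
        (Γ.conn σ).map Dart.old ⊔ ((Γ.kink e he).conn τ ⊔ (X ⊔ Y)) := by
    rw [setoid_map_id]
    apply eq_of_forall_ge_iff
    intro c
    simp only [sup_le_iff]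
    tauto
  have h2 : u + Finsupp.mapDomain id w = w + u := by
    rw [Finsupp.mapDomain_id, add_comm]
  exact hc.congr rfl h1 h2

theorem Shadow.IsElem.comp_kink {σ σ' : V → Bool} {τ' : Option V → Bool}
    {S : Bordism (Γ.smooth χ σ) (Γ.smooth χ σ')}
    {T : Bordism (Γ.smooth χ σ') ((Γ.kink e he).smooth (χ.kink e he) τ')}
    {X : Setoid (Dart V J m n)} {Y : Setoid (Dart (Option V) J m n)}
    {w : Dart V J m n →₀ ℤ} {u : Dart (Option V) J m n →₀ ℤ}
    (hS : Γ.IsElem S X w) (hT : Γ.IsKinkElem T Y u) :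
    Γ.IsKinkElem (S.comp T) ((Γ.conn σ').map Dart.old ⊔ (X.map Dart.old ⊔ Y))
      (w.mapDomain Dart.old + u) := by
  have hc := Bordism.Presented.comp hS hT
  have h1 : (Γ.kink e he).conn τ' ⊔ (Γ.conn σ').map Dart.old ⊔ Y ⊔ Setoid.map
      (Γ.conn σ ⊔ Γ.conn σ' ⊔ X) Dart.old = (Γ.kink e he).conn τ' ⊔
        (Γ.conn σ).map Dart.old ⊔ ((Γ.conn σ').map Dart.old ⊔ (X.map Dart.old ⊔ Y)) := by
    rw [setoid_map_sup, setoid_map_sup]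
    apply eq_of_forall_ge_iff
    intro c
    simp only [sup_le_iff]
    tauto
  exact hc.congr rfl h1 (add_comm _ _)

/-- Elementary bordisms of the old diagram commute with bordisms onto the kink. -/
theorem Shadow.IsElem.comm_kink {σ σ' : V → Bool} {τ τ' : Option V → Bool}
    {S : Bordism (Γ.smooth χ σ) (Γ.smooth χ σ')}
    {T : Bordism (Γ.smooth χ σ') ((Γ.kink e he).smooth (χ.kink e he) τ')}
    {T' : Bordism (Γ.smooth χ σ) ((Γ.kink e he).smooth (χ.kink e he) τ)}
    {S' : Bordism ((Γ.kink e he).smooth (χ.kink e he) τ) ((Γ.kink e he).smooth (χ.kink e he) τ')}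
    {X : Setoid (Dart V J m n)} {Y X' : Setoid (Dart (Option V) J m n)}
    {w : Dart V J m n →₀ ℤ} {u w' : Dart (Option V) J m n →₀ ℤ}
    (hS : Γ.IsElem S X w) (hT : Γ.IsKinkElem T Y u) (hT' : Γ.IsKinkElem T' Y u)
    (hS' : (Γ.kink e he).IsElem S' X' w') (hX : X.map Dart.old = X')
    (hw : w.mapDomain Dart.old = w') (h : KinkState σ τ) (h' : KinkState σ' τ') :
    (S.comp T).Iso (T'.comp S') := by
  subst hX hw
  have h1 := hS.comp_kink hT
  have h2 := hT'.comp_elem hS'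
  rw [add_comm u, sup_comm Y] at h2
  exact (h1.absorb ((Γ.map_conn_le e he h').trans le_sup_left)).iso
    (h2.absorb (Shadow.kink_conn_le h h'.2))

end KinkBordisms

end

/-! ## Surfaces and neck cutting -/

section

/-! ### Arcs and their starting points; a criterion for surfaces -/

section Arcs

variable {Y₀ Y₁ : Type} {ε₀ : Y₀ → Bool} {ε₁ : Y₁ → Bool}

/-- The components of a 1-dimensional cobordism. -/
def OneCob.conn (W : OneCob ε₀ ε₁) : Setoid W.Dart :=
  Relation.EqvGen.setoid fun a b => b = W.edge a ∨ b = W.join a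

theorem OneCob.conn_le {W : OneCob ε₀ ε₁} {E : Setoid W.Dart} :
    W.conn ≤ E ↔ (∀ d, E d (W.edge d)) ∧ ∀ d, E d (W.join d) := by
  constructor
  · intro h
    exact ⟨fun d => h (Relation.EqvGen.rel _ _ (Or.inl rfl)),
      fun d => h (Relation.EqvGen.rel _ _ (Or.inr rfl))⟩
  · intro h
    refine Setoid.eqvGen_le ?_
    rintro a b (rfl | rfl)
    exacts [h.1 a, h.2 a]

theorem OneCob.conn_edge (W : OneCob ε₀ ε₁) (d : W.Dart) : W.conn d (W.edge d) :=
  (OneCob.conn_le.1 le_rfl).1 d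

theorem OneCob.conn_join (W : OneCob ε₀ ε₁) (d : W.Dart) : W.conn d (W.join d) :=
  (OneCob.conn_le.1 le_rfl).2 d

theorem OneCob.join_bd (W : OneCob ε₀ ε₁) (y : Y₀ ⊕ Y₁) : W.join (W.bd y) = W.bd y :=
  (W.join_eq_self _).2 ⟨y, rfl⟩

/-- The ends that are met when one follows the orientation from the end `a`. -/
inductive OneCob.Flow (W : OneCob ε₀ ε₁) (a : W.Dart) : W.Dart → Prop
  | start : Flow W a a
  | edge (x) : Flow W a x → W.out x = true → Flow W a (W.edge x)
  | join (x) : Flow W a x → W.out x = false → W.join x ≠ x → Flow W a (W.join x)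

/-- `edge` and `join` are involutions that reverse `out` (`join` away from its fixed points), so the
last step of a path can be undone in only one way. -/
theorem OneCob.Flow.back {W : OneCob ε₀ ε₁} {a x : W.Dart} (ha : W.out a = true)
    (h : W.Flow a x) : (W.out x = true → x = a ∨ (W.join x ≠ x ∧ W.Flow a (W.join x))) ∧
      (W.out x = false → W.Flow a (W.edge x)) := by
  cases h with
  | start => simp [ha]
  | edge x hx ho =>
    rw [W.out_edge, ho, W.edge_edge]
    exact ⟨fun h => by simp at h, fun _ => hx⟩
  | join x hx ho hj =>
    rw [W.out_join x hj, ho, W.join_join]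
    exact ⟨fun _ => Or.inr ⟨hj.symm, hx⟩, fun h => by simp at h⟩

/-- The ends met from `a` are closed under both involutions: forwards by definition, backwards by
`OneCob.Flow.back`, and at `a` itself because `join` fixes it. So they fill the component. -/
theorem OneCob.flow_of_conn {W : OneCob ε₀ ε₁} {a x : W.Dart} (ha : W.out a = true)
    (hj : W.join a = a) (h : W.conn a x) : W.Flow a x := by
  have hedge (x) (hx : W.Flow a x) : W.Flow a (W.edge x) := by
    cases ho : W.out x with
    | true => exact .edge x hx ho
    | false => exact (hx.back ha).2 ho
  have hjoin (x) (hx : W.Flow a x) : W.Flow a (W.join x) := by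
    by_cases hxj : W.join x = x
    · rwa [hxj]
    cases ho : W.out x with
    | true =>
      rcases (hx.back ha).1 ho with rfl | h
      · rwa [hj]
      · exact h.2
    | false => exact .join x hx ho hxj
  -- A set closed under the involutions is a `Prop`-valued function constant on components.
  have hle : W.conn ≤ Setoid.ker (W.Flow a) := by
    refine OneCob.conn_le.2 ⟨fun d => propext ⟨hedge d, fun h => ?_⟩,
      fun d => propext ⟨hjoin d, fun h => ?_⟩⟩
    · simpa [W.edge_edge] using hedge _ h
    · simpa [W.join_join] using hjoin _ h
  have h1 : W.Flow a a = W.Flow a x := hle h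
  exact h1 ▸ .start

/-- Every component has at most one boundary point at which it starts. -/
theorem OneCob.start_unique (W : OneCob ε₀ ε₁) {y z : Y₀ ⊕ Y₁} (hy : W.out (W.bd y) = true)
    (hz : W.out (W.bd z) = true) (h : W.conn (W.bd y) (W.bd z)) : y = z := by
  rcases ((OneCob.flow_of_conn hy (W.join_bd y) h).back hy).1 hz with h | h
  · exact (W.bd_injective h).symm
  · exact absurd (W.join_bd z) h.1

/-- Every component with boundary has a boundary point at which it starts. -/
theorem OneCob.exists_start (W : OneCob ε₀ ε₁) (y : Y₀ ⊕ Y₁) :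
    ∃ z, W.out (W.bd z) = true ∧ W.conn (W.bd y) (W.bd z) := by
  by_contra! hno
  have hy : W.out (W.bd y) = false := by
    by_contra h
    exact hno y (by simpa using h) (W.conn.refl' _)
  have := W.finite_dart
  -- If no arc started in this component, following the orientation across a segment and a glued
  -- point would be an injective self-map of the finite set of its incoming ends, hence onto. But
  -- `W.bd y` has no predecessor, since `join` fixes it.
  let C := {x : W.Dart // W.conn (W.bd y) x ∧ W.out x = false}
  have hout (x : C) : W.out (W.edge x.1) = true := by rw [W.out_edge, x.2.2]; rfl
  have hmem (x : C) : W.conn (W.bd y) (W.edge x.1) :=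
    W.conn.trans' x.2.1 (W.conn_edge _)
  have hj (x : C) : W.join (W.edge x.1) ≠ W.edge x.1 := by
    intro h
    obtain ⟨z, hz⟩ := (W.join_eq_self _).1 h
    exact hno z (by rw [hz]; exact hout x) (by rw [hz]; exact hmem x)
  let φ : C → C := fun x => ⟨W.join (W.edge x.1), W.conn.trans' (hmem x) (W.conn_join _), by
    rw [W.out_join _ (hj x), hout x]; rfl⟩
  have hφ : Function.Injective φ := by
    intro a b h
    have h1 := congrArg (fun c : C => W.edge (W.join c.1)) h
    simp only [φ, W.join_join, W.edge_edge] at h1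
    exact Subtype.ext h1
  obtain ⟨x, hx⟩ := Finite.surjective_of_injective hφ ⟨W.bd y, W.conn.refl' _, hy⟩
  have h1 : W.edge x.1 = W.bd y := by
    rw [← W.join_join (W.edge x.1), show W.join (W.edge x.1) = W.bd y from congrArg Subtype.val hx,
      W.join_bd]
  have h2 := hout x
  rw [h1, hy] at h2
  simp at h2

/-- Existence and uniqueness of the starting point: a component with boundary is a single arc. -/
theorem OneCob.arcs_eq_one (W : OneCob ε₀ ε₁) {P : Type} {f : W.Dart → P}
    (hf : Setoid.ker f = W.conn) (y : Y₀ ⊕ Y₁) : W.arcs f (f (W.bd y)) = 1 := by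
  have hf' (a b) : f a = f b ↔ W.conn a b := by rw [← hf]; rfl
  obtain ⟨z, hz, hc⟩ := W.exists_start y
  rw [OneCob.arcs, Nat.cast_eq_one, Nat.card_eq_one_iff_unique]
  refine ⟨⟨fun a b => Subtype.ext ?_⟩, ⟨⟨z, hz, ((hf' _ _).2 hc).symm⟩⟩⟩
  exact W.start_unique a.2.1 b.2.1 ((hf' _ _).1 (a.2.2.trans b.2.2.symm))

theorem OneCob.arcs_eq_zero (W : OneCob ε₀ ε₁) {P : Type} {f : W.Dart → P} {p : P}
    (h : ∀ y, f (W.bd y) ≠ p) : W.arcs f p = 0 := by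
  rw [OneCob.arcs, Nat.cast_eq_zero, Nat.card_eq_zero]
  exact Or.inl ⟨fun a => h _ a.2.2⟩

/-- The disjoint union of `W × [0,1]` and discs bounded by circles in the target is a surface. -/
theorem Bordism.isSurface_of_discs {W X : OneCob ε₀ ε₁} (S : Bordism W X)
    (hsrc : Setoid.ker S.src = W.conn) (htgt : Setoid.ker S.tgt = X.conn)
    (hsurj : Function.Surjective S.tgt)
    (h0 : ∀ d, S.euler (S.src d) = W.arcs S.src (S.src d))
    (h1 : ∀ p, p ∉ Set.range S.src → S.euler p = W.arcs S.src p + 1) : S.IsSurface := by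
  have hW : W.conn ≤ Setoid.ker fun a => Quot.mk (BdryStep W X) (Sum.inl a) :=
    OneCob.conn_le.2 ⟨fun d => Quot.sound (.src_edge d), fun d => Quot.sound (.src_join d)⟩
  have hX : X.conn ≤ Setoid.ker fun a => Quot.mk (BdryStep W X) (Sum.inr a) :=
    OneCob.conn_le.2 ⟨fun d => Quot.sound (.tgt_edge d), fun d => Quot.sound (.tgt_join d)⟩
  have hW' (a b) (h : S.src a = S.src b) : Quot.mk (BdryStep W X) (Sum.inl a) =
      Quot.mk _ (Sum.inl b) := hW (hsrc ▸ (h : Setoid.ker S.src a b))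
  have hX' (a b) (h : S.tgt a = S.tgt b) : Quot.mk (BdryStep W X) (Sum.inr a) =
      Quot.mk _ (Sum.inr b) := hX (htgt ▸ (h : Setoid.ker S.tgt a b))
  intro p
  refine ⟨0, ?_⟩
  obtain ⟨b, rfl⟩ := hsurj p
  -- All components have genus `0`, of three kinds: a strip over an arc (one boundary circle, Euler
  -- characteristic `1`), an annulus over a circle (two circles, `0`), and a disc bounded by a new
  -- circle (one circle, `1`).
  by_cases hp : S.tgt b ∈ Set.range S.src
  · obtain ⟨a, ha⟩ := hp
    rw [← ha, h0]
    by_cases hbd : ∃ y, S.src (W.bd y) = S.src a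
    · obtain ⟨y, hy⟩ := hbd
      have hc : S.circles (S.src a) = 1 := by
        rw [Bordism.circles, Nat.card_eq_one_iff_unique]
        refine ⟨⟨?_⟩, ⟨⟨_, Sum.inl a, rfl, rfl⟩⟩⟩
        have key : ∀ z, Sum.elim S.src S.tgt z = S.src a →
            Quot.mk (BdryStep W X) z = Quot.mk _ (Sum.inl a) := by
          rintro (c | c) hc
          · exact hW' _ _ hc
          · refine (hX' c (X.bd y) ?_).trans ((Quot.sound (.side y)).symm.trans (hW' _ _ hy))
            rw [← S.src_bd, hy]
            exact hc
        rintro ⟨_, z, rfl, hz⟩ ⟨_, z', rfl, hz'⟩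
        exact Subtype.ext ((key z hz).trans (key z' hz').symm)
      rw [hc, ← hy, W.arcs_eq_one hsrc]
      norm_num
    · push Not at hbd
      have hc : S.circles (S.src a) = 2 := by
        rw [Bordism.circles, Nat.card_eq_two_iff]
        refine ⟨⟨_, Sum.inl a, rfl, rfl⟩, ⟨_, Sum.inr b, rfl, ha.symm⟩, ?_, ?_⟩
        · intro h
          -- Without boundary points there are no sides, so the indicator of the source end of the
          -- annulus is invariant and separates its two boundary circles.
          have hstep : ∀ z z', BdryStep W X z z' →
              Sum.elim (fun c => S.src c = S.src a) (fun _ => False) z =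
                Sum.elim (fun c => S.src c = S.src a) (fun _ => False) z' := by
            rintro _ _ (d | d | d | d | y)
            · simp only [Sum.elim_inl, S.src_edge]
            · simp only [Sum.elim_inl, S.src_join]
            · rfl
            · rfl
            · simp only [Sum.elim_inl, Sum.elim_inr, hbd y]
          have h2 := congrArg (Quot.lift _ hstep) (congrArg Subtype.val h)
          simp at h2
        · rw [Set.eq_univ_iff_forall]
          rintro ⟨_, c | c, rfl, hc⟩
          · exact Or.inl (Subtype.ext (hW' _ _ hc))
          · exact Or.inr (Subtype.ext (hX' _ _ (Eq.trans hc ha)))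
      rw [hc, W.arcs_eq_zero hbd]
      norm_num
  · have hc : S.circles (S.tgt b) = 1 := by
      rw [Bordism.circles, Nat.card_eq_one_iff_unique]
      refine ⟨⟨?_⟩, ⟨⟨_, Sum.inr b, rfl, rfl⟩⟩⟩
      have key : ∀ z, Sum.elim S.src S.tgt z = S.tgt b →
          Quot.mk (BdryStep W X) z = Quot.mk _ (Sum.inr b) := by
        rintro (c | c) hc
        · exact absurd ⟨c, hc⟩ hp
        · exact hX' _ _ hc
      rintro ⟨_, z, rfl, hz⟩ ⟨_, z', rfl, hz'⟩
      exact Subtype.ext ((key z hz).trans (key z' hz').symm)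
    rw [h1 _ hp, hc, W.arcs_eq_zero fun y h => hp ⟨_, h⟩]
    norm_num

end Arcs

/-! ### The small circle of the kink as a separate component -/

variable {V J : Type} {m n : ℕ}

/-- A function on the ends of the old diagram and on the four ends of the new crossing. -/
def Dart.elimOld {α : Type*} (f : Dart V J m n → α) (g : Fin 4 → α) :
    Dart (Option V) J m n → α
  | .cross none i => g i
  | .cross (some v) i => f (.cross v i)
  | .mark j b => f (.mark j b)
  | .bot i => f (.bot i)
  | .top i => f (.top i)

theorem Dart.elimOld_old {α : Type*} (f : Dart V J m n → α) (g : Fin 4 → α) (d : Dart V J m n) :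
    Dart.elimOld f g d.old = f d := by
  cases d <;> rfl

/-- The component of the old diagram that contains an end, if it is not on the small circle. -/
def Shadow.retract (Γ : Shadow V J m n) (e : Dart V J m n) (σ : V → Bool) :
    Dart (Option V) J m n → Option (Quotient (Γ.conn σ)) :=
  Dart.elimOld (fun d => some ⟦d⟧) ![some ⟦e⟧, none, none, some ⟦e⟧]

theorem Shadow.retract_old (Γ : Shadow V J m n) (e : Dart V J m n) (σ : V → Bool)
    (d : Dart V J m n) : Γ.retract e σ d.old = some ⟦d⟧ := Dart.elimOld_old _ _ _

/-- The vertical smoothing joins `0` with `3` and `1` with `2`. Invariance therefore shows that the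
small circle, with value `none`, stays apart from the strand, and that the kink merges no old
components. -/
theorem Shadow.retract_kinkStep (Γ : Shadow V J m n) (e : Dart V J m n) {σ : V → Bool}
    {τ : Option V → Bool} (h : KinkState σ τ) {a b : Dart (Option V) J m n}
    (hab : Γ.KinkStep e σ τ a b) : Γ.retract e σ a = Γ.retract e σ b := by
  have hedge (d : Dart V J m n) : (⟦d⟧ : Quotient (Γ.conn σ)) = ⟦Γ.edge d⟧ :=
    Quotient.sound (Γ.conn_edge σ d)
  have hjoin (d : Dart V J m n) : (⟦d⟧ : Quotient (Γ.conn σ)) = ⟦smoothJoin σ d⟧ :=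
    Quotient.sound (Γ.conn_join σ d)
  rcases hab with d | d | d | d
  · revert a
    apply Dart.cases_old
    · intro d
      by_cases h1 : d = e
      · subst h1
        rw [Γ.kinkEdge_old_self, Shadow.retract_old]
        rfl
      by_cases h2 : d = Γ.edge e
      · subst h2
        rw [Γ.kinkEdge_old_edge, Shadow.retract_old, ← hedge]
        rfl
      rw [Γ.kinkEdge_old e d h1 h2, Shadow.retract_old, Shadow.retract_old, ← hedge]
    · intro i
      fin_cases i
      · exact (Γ.retract_old e σ e).symm
      · rfl
      · rfl
      · exact (congrArg some (hedge e)).trans (Γ.retract_old e σ (Γ.edge e)).symm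
  · revert a
    apply Dart.cases_old
    · intro d
      rw [smoothJoin_old h.1, Shadow.retract_old, Shadow.retract_old, ← hjoin]
    · intro i
      have := h.2
      fin_cases i <;> simp [smoothJoin, this, Shadow.retract, Dart.elimOld]
  · rw [Shadow.retract_old, Shadow.retract_old, ← hedge]
  · rw [Shadow.retract_old, Shadow.retract_old, ← hjoin]

theorem Shadow.retract_eq (Γ : Shadow V J m n) (e : Dart V J m n) {σ : V → Bool}
    {τ : Option V → Bool} (h : KinkState σ τ) {a b : Dart (Option V) J m n}
    (hab : Quot.mk (Γ.KinkStep e σ τ) a = Quot.mk _ b) : Γ.retract e σ a = Γ.retract e σ b :=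
  congrArg (Quot.lift (Γ.retract e σ) fun _ _ => Γ.retract_kinkStep e h) hab

variable [Finite V] [Finite J] {Γ : Shadow V J m n} {χ : Γ.Coloring} {e : Dart V J m n}
  {he : Γ.tail e = true}

theorem Shadow.newCircle_isSurface {σ : V → Bool} {τ : Option V → Bool} (h : KinkState σ τ) :
    (Γ.newCircle χ e he 0 σ τ).IsSurface := by
  classical
  have heuler (p) : (Γ.newCircle χ e he 0 σ τ).euler p =
      (Γ.smooth χ σ).arcs (Γ.newCircle χ e he 0 σ τ).src p +
        (if p = Quot.mk _ (.cross none 1) then 1 - 2 * ((0 : ℕ) : ℤ) else 0) := rfl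
  apply Bordism.isSurface_of_discs
  · refine le_antisymm (fun a b hab => ?_) (OneCob.conn_le.2
      ⟨fun d => Quot.sound (.src_edge d), fun d => Quot.sound (.src_join d)⟩)
    have h1 := Γ.retract_eq e h hab
    exact Quotient.exact (Option.some.inj
      ((Γ.retract_old e σ a).symm.trans (h1.trans (Γ.retract_old e σ b))))
  · refine (ker_quot_mk _).trans ((Γ.kinkStep_setoid e he σ τ).trans ?_)
    exact sup_eq_left.2 (Γ.map_conn_le e he h)
  · exact Quot.mk_surjective
  · intro d
    rw [heuler, if_neg, add_zero]
    intro h1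
    have h2 := Γ.retract_eq e h h1
    exact Option.some_ne_none _ ((Γ.retract_old e σ d).symm.trans h2)
  -- The ends `0` and `3` are attached to `e` and `Γ.edge e`, so only the circle through `1` and `2`
  -- can miss the source.
  · intro p hp
    rw [heuler, if_pos]
    · rfl
    obtain ⟨a, rfl⟩ := Quot.mk_surjective p
    revert a
    apply Dart.cases_old
    · intro d hd
      exact absurd ⟨d, rfl⟩ hd
    · intro i
      have hstep (i : Fin 4) : Quot.mk (Γ.KinkStep e σ τ) (.cross none i) =
          Quot.mk _ (Γ.kinkEdge e (.cross none i)) := Quot.sound (.tgt_edge _)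
      fin_cases i
      · exact fun hp => absurd ⟨e, (hstep 0).symm⟩ hp
      · exact fun _ => rfl
      · exact fun _ => hstep 2
      · exact fun hp => absurd ⟨Γ.edge e, (hstep 3).symm⟩ hp

/-! ### Neck cutting by the four-tube relation -/

section NeckCutting

variable (k : Type*) [CommRing k]

theorem Chain.eqv_of_iso {Y₀ Y₁ : Type} {ε₀ : Y₀ → Bool} {ε₁ : Y₁ → Bool} {W X : OneCob ε₀ ε₁}
    {S T : Bordism W X} (h : S.Iso T) : Chain.Eqv k (Chain.of k S) (Chain.of k T) :=
  Submodule.subset_span (.iso S T h)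

/-- Composing the disc bounded by the new circle with the genus-one morphism at the kink. -/
theorem Shadow.newCircle_phi {σ : V → Bool} {τ : Option V → Bool} (h : KinkState σ τ) :
    Chain.Eqv k
      (Chain.of k ((Γ.newCircle χ e he 0 σ τ).comp
          ((Γ.kink e he).phiFst (χ.kink e he) τ τ none)) -
        Chain.of k ((Γ.newCircle χ e he 0 σ τ).comp
          ((Γ.kink e he).phiSnd (χ.kink e he) τ τ none)))
      (Chain.of k (Γ.newCircle χ e he 1 σ τ) - Chain.of k (Γ.split χ e he σ τ)) := by
  set N := Γ.newCircle χ e he 0 σ τ with hN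
  have pN : Γ.IsKinkElem N ⊥ (Finsupp.single (.cross none 1) 1) :=
    Shadow.isKinkElem_newCircle 0 σ τ
  -- `p` is the sheet over the strand and `q` the disc. The abbreviations `p12`, `p34`, `p13` refer
  -- to the tubes in `4Tu` with discs `1`, `2` on `p` and `3`, `4` on `q`.
  let p : N.Comp := N.tgt (.cross none 0 : Dart (Option V) J m n)
  let q : N.Comp := N.tgt (.cross none 1 : Dart (Option V) J m n)
  have hτ : (Γ.kink e he).conn τ ≤ (Γ.kink e he).conn τ ⊔ (Γ.conn σ).map Dart.old := le_sup_left
  have p12 : Γ.IsKinkElem (N.addTube p p) ⊥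
      (Finsupp.single (.cross none 1) 1 + Finsupp.single (.cross none 0) (-2)) :=
    (pN.addTube (.cross none 0) (.cross none 0)).congr rfl
      ((congrArg (_ ⊔ ·) (pairSetoid_self _)).trans (sup_bot_eq _)) rfl
  have p34 : Γ.IsKinkElem (N.addTube q q) ⊥ (Finsupp.single (.cross none 1) (1 - 2 * (1 : ℕ))) :=
    (pN.addTube (.cross none 1) (.cross none 1)).congr rfl
      ((congrArg (_ ⊔ ·) (pairSetoid_self _)).trans (sup_bot_eq _))
      ((Finsupp.single_add (.cross none 1 : Dart (Option V) J m n) (1 : ℤ) (-2)).symm.trans rfl)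
  have p13 : Γ.IsKinkElem (N.addTube p q) (pairSetoid (.cross none 0) (.cross none 1))
      (Finsupp.single (.cross none 1) 1 + Finsupp.single (.cross none 0) (-2)) :=
    (pN.addTube (.cross none 0) (.cross none 1)).congr rfl
      (congrArg (· ⊔ _) (sup_bot_eq _)) rfl
  have pF : Γ.IsKinkElem (N.comp ((Γ.kink e he).phiFst (χ.kink e he) τ τ none))
      (pairSetoid (.cross none 0) (.cross none 1))
      (Finsupp.single (.cross none 1) 1 + Finsupp.single (.cross none 0) (-2)) := by
    have := (pN.comp_elem (Shadow.isElem_phiFst τ τ none)).absorb hτ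
    rwa [bot_sup_eq] at this
  have pS : Γ.IsKinkElem (N.comp ((Γ.kink e he).phiSnd (χ.kink e he) τ τ none)) ⊥
      (Finsupp.single (.cross none 1) 1 + Finsupp.single (.cross none 0) (-2)) := by
    have := (pN.comp_elem (Shadow.isElem_phiSnd τ τ none)).absorb hτ
    rwa [bot_sup_eq, pairSetoid_self] at this
  -- A disc joined to the sheet by a tube is the splitting saddle: after the connection both weights
  -- lie on one component, with total `1 - 2 = -1`.
  have pSplit : Γ.IsKinkElem (N.addTube p q) (pairSetoid (.cross none 0) (.cross none 1))
      (Finsupp.single (.cross none 1) (-1)) := by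
    refine Bordism.Presented.weight_congr p13 fun {B} (g : Dart (Option V) J m n → B) hg => ?_
    have h01 : g (.cross none 0) = g (.cross none 1) := hg _ _ (pairSetoid_le.1 le_sup_right)
    change Finsupp.mapDomain g (Finsupp.single (.cross none 1) 1 + Finsupp.single _ (-2)) =
      Finsupp.mapDomain g (Finsupp.single (.cross none 1) (-1))
    rw [Finsupp.mapDomain_add, Finsupp.mapDomain_single, Finsupp.mapDomain_single,
      Finsupp.mapDomain_single, h01, ← Finsupp.single_add]
    rfl
  have e1 := Chain.eqv_of_iso k (pF.iso p13)
  have e2 := Chain.eqv_of_iso k (pS.iso p12)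
  have e3 := Chain.eqv_of_iso k ((Shadow.isKinkElem_newCircle 1 σ τ).iso p34)
  have e4 := Chain.eqv_of_iso k ((Shadow.isKinkElem_split σ τ).iso pSplit)
  have e5 : Chain.of k (N.addTube p p) + Chain.of k (N.addTube q q) - Chain.of k (N.addTube p q) -
      Chain.of k (N.addTube p q) ∈ relations k _ _ :=
    Submodule.subset_span (.fourTu N (Shadow.newCircle_isSurface h) p p q q)
  simp only [Chain.Eqv] at e1 e2 e3 e4 ⊢
  -- Both mixed tubes of `4Tu` are the same `N.addTube p q`; one goes to each side of the identity.
  have := add_mem (sub_mem (sub_mem e1 e2) (sub_mem e3 e4)) (neg_mem e5)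
  convert this using 1
  abel

end NeckCutting

end

/-! ## Combinations of bordisms -/

section

section ChainAlgebra

variable {Y₀ Y₁ : Type} {ε₀ : Y₀ → Bool} {ε₁ : Y₁ → Bool} (k : Type*) [CommRing k]
  {W X Z : OneCob ε₀ ε₁}

theorem Chain.comp_add_left (f f' : Chain k W X) (g : Chain k X Z) :
    Chain.comp k (f + f') g = Chain.comp k f g + Chain.comp k f' g := by
  classical
  refine Finsupp.sum_add_index' (fun S => ?_) (fun S a b => ?_)
  · simp
  · simp only [add_mul, Finsupp.single_add, Finsupp.sum_add]

theorem Chain.comp_add_right (f : Chain k W X) (g g' : Chain k X Z) :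
    Chain.comp k f (g + g') = Chain.comp k f g + Chain.comp k f g' := by
  classical
  simp only [Chain.comp]
  rw [← Finsupp.sum_add]
  refine Finsupp.sum_congr fun S _ => Finsupp.sum_add_index' (fun T => ?_) (fun T a b => ?_)
  · simp
  · simp only [mul_add, Finsupp.single_add]

/-- The composition as a biadditive map. -/
def Chain.compHom : Chain k W X →+ Chain k X Z →+ Chain k W Z :=
  AddMonoidHom.mk' (fun f => AddMonoidHom.mk' (Chain.comp k f) (Chain.comp_add_right k f))
    fun f f' => AddMonoidHom.ext fun g => Chain.comp_add_left k f f' g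

theorem Chain.compHom_apply (f : Chain k W X) (g : Chain k X Z) :
    Chain.compHom k f g = Chain.comp k f g := rfl

theorem Chain.comp_of (S : Bordism W X) (T : Bordism X Z) :
    Chain.comp k (Chain.of k S) (Chain.of k T) = Chain.of k (S.comp T) := by
  rw [Chain.comp, Chain.of, Chain.of, Finsupp.sum_single_index, Finsupp.sum_single_index, mul_one]
  · rfl
  · rw [mul_zero, Finsupp.single_zero]
  · simp

theorem Chain.comp_zero_left (g : Chain k X Z) : Chain.comp k (0 : Chain k W X) g = 0 := by
  rw [← Chain.compHom_apply, map_zero]; rfl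

theorem Chain.comp_zero_right (f : Chain k W X) : Chain.comp k f (0 : Chain k X Z) = 0 := by
  rw [← Chain.compHom_apply, map_zero]

theorem Chain.comp_sub_left (f f' : Chain k W X) (g : Chain k X Z) :
    Chain.comp k (f - f') g = Chain.comp k f g - Chain.comp k f' g := by
  simp only [← Chain.compHom_apply, map_sub, AddMonoidHom.sub_apply]

theorem Chain.comp_sub_right (f : Chain k W X) (g g' : Chain k X Z) :
    Chain.comp k f (g - g') = Chain.comp k f g - Chain.comp k f g' := by
  simp only [← Chain.compHom_apply, map_sub]

theorem Chain.comp_neg_left (f : Chain k W X) (g : Chain k X Z) :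
    Chain.comp k (-f) g = -Chain.comp k f g := by
  simp only [← Chain.compHom_apply, map_neg, AddMonoidHom.neg_apply]

theorem Chain.comp_neg_right (f : Chain k W X) (g : Chain k X Z) :
    Chain.comp k f (-g) = -Chain.comp k f g := by
  simp only [← Chain.compHom_apply, map_neg]

theorem Chain.comp_zsmul_left (a : ℤ) (f : Chain k W X) (g : Chain k X Z) :
    Chain.comp k (a • f) g = a • Chain.comp k f g := by
  rw [← Chain.compHom_apply, map_zsmul]; rfl

theorem Chain.comp_zsmul_right (a : ℤ) (f : Chain k W X) (g : Chain k X Z) :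
    Chain.comp k f (a • g) = a • Chain.comp k f g := by
  rw [← Chain.compHom_apply, map_zsmul]; rfl

theorem Chain.comp_sum_left {ι : Type*} (s : Finset ι) (f : ι → Chain k W X) (g : Chain k X Z) :
    Chain.comp k (∑ i ∈ s, f i) g = ∑ i ∈ s, Chain.comp k (f i) g := by
  simp only [← Chain.compHom_apply, map_sum, AddMonoidHom.finsetSum_apply]

theorem Chain.comp_sum_right {ι : Type*} (s : Finset ι) (f : Chain k W X) (g : ι → Chain k X Z) :
    Chain.comp k f (∑ i ∈ s, g i) = ∑ i ∈ s, Chain.comp k f (g i) := by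
  simp only [← Chain.compHom_apply, map_sum]

/-- The morphism of the quotient category that is represented by a combination of bordisms. -/
def Chain.cls : Chain k W X →+ Chain k W X ⧸ relations k W X :=
  (relations k W X).mkQ.toAddMonoidHom

theorem Chain.eqv_iff {f g : Chain k W X} :
    Chain.Eqv k f g ↔ Chain.cls k f = Chain.cls k g :=
  (Submodule.Quotient.eq _).symm

theorem Chain.cls_of_iso {S T : Bordism W X} (h : S.Iso T) :
    Chain.cls k (Chain.of k S) = Chain.cls k (Chain.of k T) :=
  (Chain.eqv_iff k).1 (Chain.eqv_of_iso k h)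

theorem Chain.cls_comp_of_iso {X' : OneCob ε₀ ε₁} {S : Bordism W X} {T : Bordism X Z}
    {S' : Bordism W X'} {T' : Bordism X' Z} (h : (S.comp T).Iso (S'.comp T')) :
    Chain.cls k (Chain.comp k (Chain.of k S) (Chain.of k T)) =
      Chain.cls k (Chain.comp k (Chain.of k S') (Chain.of k T')) := by
  rw [Chain.comp_of, Chain.comp_of, Chain.cls_of_iso k h]

theorem Chain.cls_comp_sub_of_iso {X' : OneCob ε₀ ε₁} {S₁ S₂ : Bordism W X} {T : Bordism X Z}
    {S' : Bordism W X'} {T₁ T₂ : Bordism X' Z} (h₁ : (S₁.comp T).Iso (S'.comp T₁))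
    (h₂ : (S₂.comp T).Iso (S'.comp T₂)) :
    Chain.cls k (Chain.comp k (Chain.of k S₁ - Chain.of k S₂) (Chain.of k T)) =
      Chain.cls k (Chain.comp k (Chain.of k S') (Chain.of k T₁ - Chain.of k T₂)) := by
  rw [Chain.comp_sub_left, Chain.comp_sub_right, map_sub, map_sub, Chain.cls_comp_of_iso k h₁,
    Chain.cls_comp_of_iso k h₂]

/-! ## Rows times columns -/

variable {I I' : Type} {o : I → OneCob ε₀ ε₁} {o' : I' → OneCob ε₀ ε₁}

/-- The class of the product of a row and a column. -/
def rowCol (α : ∀ z, Chain k W (o z)) (β : ∀ z, Chain k (o z) Z) :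
    Chain k W Z ⧸ relations k W Z :=
  Chain.cls k (∑ᶠ z, Chain.comp k (α z) (β z))

theorem rowCol_sum_left [Finite I] {ι : Type*} (s : Finset ι) (α : ι → ∀ z, Chain k W (o z))
    (β : ∀ z, Chain k (o z) Z) :
    rowCol k (fun z => ∑ i ∈ s, α i z) β = ∑ i ∈ s, rowCol k (α i) β := by
  have := Fintype.ofFinite I
  simp only [rowCol, finsum_eq_sum_of_fintype, Chain.comp_sum_left]
  rw [Finset.sum_comm, map_sum]

theorem rowCol_sum_right [Finite I] {ι : Type*} (s : Finset ι) (α : ∀ z, Chain k W (o z))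
    (β : ι → ∀ z, Chain k (o z) Z) :
    rowCol k α (fun z => ∑ i ∈ s, β i z) = ∑ i ∈ s, rowCol k α (β i) := by
  have := Fintype.ofFinite I
  simp only [rowCol, finsum_eq_sum_of_fintype, Chain.comp_sum_right]
  rw [Finset.sum_comm, map_sum]

theorem rowCol_neg_left [Finite I] (α : ∀ z, Chain k W (o z)) (β : ∀ z, Chain k (o z) Z) :
    rowCol k (fun z => -α z) β = -rowCol k α β := by
  have := Fintype.ofFinite I
  simp only [rowCol, finsum_eq_sum_of_fintype, Chain.comp_neg_left, Finset.sum_neg_distrib, map_neg]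

theorem rowCol_neg_right [Finite I] (α : ∀ z, Chain k W (o z)) (β : ∀ z, Chain k (o z) Z) :
    rowCol k α (fun z => -β z) = -rowCol k α β := by
  have := Fintype.ofFinite I
  simp only [rowCol, finsum_eq_sum_of_fintype, Chain.comp_neg_right, Finset.sum_neg_distrib,
    map_neg]

/-- A product vanishes if all paths represent zero. -/
theorem rowCol_eq_zero [Finite I] (P Q : I → Prop) [DecidablePred P] [DecidablePred Q]
    (f : ∀ z, Chain k W (o z)) (g : ∀ z, Chain k (o z) Z)
    (h : ∀ z, P z → Q z → Chain.cls k (Chain.comp k (f z) (g z)) = 0) :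
    rowCol k (fun z => if P z then f z else 0) (fun z => if Q z then g z else 0) = 0 := by
  have := Fintype.ofFinite I
  rw [rowCol, finsum_eq_sum_of_fintype, map_sum]
  refine Finset.sum_eq_zero fun z _ => ?_
  split_ifs with hP hQ
  · exact h z hP hQ
  · rw [Chain.comp_zero_right, map_zero]
  · rw [Chain.comp_zero_left, map_zero]
  · rw [Chain.comp_zero_left, map_zero]

/-- A product with only one path. -/
theorem rowCol_eq_single (P Q : I → Prop) [DecidablePred P] [DecidablePred Q]
    (f : ∀ z, Chain k W (o z)) (g : ∀ z, Chain k (o z) Z)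
    (hP : ∀ z z', P z → P z' → z = z') (z : I) (hz : P z) (hz' : Q z) :
    rowCol k (fun z => if P z then f z else 0) (fun z => if Q z then g z else 0) =
      Chain.cls k (Chain.comp k (f z) (g z)) := by
  rw [rowCol, finsum_eq_single _ z, if_pos hz, if_pos hz']
  intro z' hne
  rw [if_neg fun h => hne (hP _ _ h hz), Chain.comp_zero_left]

/-- Two products agree up to a factor if the paths correspond to each other. -/
theorem rowCol_square [Finite I] [Finite I'] (P Q : I → Prop) (P' Q' : I' → Prop)
    [DecidablePred P] [DecidablePred Q] [DecidablePred P'] [DecidablePred Q']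
    (f : ∀ z, Chain k W (o z)) (g : ∀ z, Chain k (o z) Z)
    (f' : ∀ z, Chain k W (o' z)) (g' : ∀ z, Chain k (o' z) Z)
    (hP : ∀ z z', P z → P z' → z = z') (hP' : ∀ z z', P' z → P' z' → z = z')
    (hiff : (∃ z, P z ∧ Q z) ↔ ∃ z, P' z ∧ Q' z) (u : ℤ)
    (hfg : ∀ z z', P z → Q z → P' z' → Q' z' → Chain.cls k (Chain.comp k (f z) (g z)) =
      u • Chain.cls k (Chain.comp k (f' z') (g' z'))) :
    rowCol k (fun z => if P z then f z else 0) (fun z => if Q z then g z else 0) =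
      u • rowCol k (fun z => if P' z then f' z else 0) (fun z => if Q' z then g' z else 0) := by
  by_cases h : ∃ z, P z ∧ Q z
  · obtain ⟨z, hz, hz'⟩ := h
    obtain ⟨y, hy, hy'⟩ := hiff.1 ⟨z, hz, hz'⟩
    rw [rowCol_eq_single k P Q f g hP z hz hz', rowCol_eq_single k P' Q' f' g' hP' y hy hy']
    exact hfg z y hz hz' hy hy'
  · rw [rowCol_eq_zero k P Q f g fun z h1 h2 => absurd ⟨z, h1, h2⟩ h,
      rowCol_eq_zero k P' Q' f' g' fun z h1 h2 => absurd ⟨z, h1, h2⟩ (hiff.not.1 h), smul_zero]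

end ChainAlgebra

/-! ## Signs -/

theorem muSign_insert {V : Type} [DecidableEq V] (ν : V ↪ ℕ) {s : Finset V} {v : V} (hv : v ∉ s)
    (w : V) : muSign ν (insert v s) w = (if ν v < ν w then -1 else 1) * muSign ν s w := by
  rw [muSign, muSign, Finset.filter_insert]
  split_ifs
  · rw [Finset.card_insert_of_notMem (by simp [hv]), pow_succ']
  · rw [one_mul]

theorem muSign_erase {V : Type} [DecidableEq V] (ν : V ↪ ℕ) {s : Finset V} {v : V} (hv : v ∈ s)
    (w : V) : muSign ν (s.erase v) w = (if ν v < ν w then -1 else 1) * muSign ν s w := by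
  conv_rhs => rw [← Finset.insert_erase hv]
  rw [muSign_insert ν (Finset.notMem_erase v s), ← mul_assoc]
  split_ifs <;> simp

theorem muSign_mul_self {V : Type} (ν : V ↪ ℕ) (s : Finset V) (v : V) :
    muSign ν s v * muSign ν s v = 1 := by
  rw [muSign, ← mul_pow]
  simp

/-- Adding or removing an element. -/
def toggle {V : Type} [DecidableEq V] (s : Finset V) (v : V) : Finset V :=
  if v ∈ s then s.erase v else insert v s

/-- Adding and removing `v` change the parity of the elements before `w` in the same way. So saddles
(exterior multiplication) and genus-one morphisms (contraction) obey one sign rule. -/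
theorem muSign_toggle {V : Type} [DecidableEq V] (ν : V ↪ ℕ) (s : Finset V) (v w : V) :
    muSign ν (toggle s v) w = (if ν v < ν w then -1 else 1) * muSign ν s w := by
  rw [toggle]
  split_ifs with h h' h'
  · rw [muSign_erase ν h, if_pos h']
  · rw [muSign_erase ν h, if_neg h']
  · rw [muSign_insert ν h, if_pos h']
  · rw [muSign_insert ν h, if_neg h']

/-- The signs of the two ways around a square are different. -/
theorem muSign_toggle_comm {V : Type} [DecidableEq V] (ν : V ↪ ℕ) (s : Finset V) {v w : V}
    (h : v ≠ w) : muSign ν s v * muSign ν (toggle s v) w =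
      -(muSign ν s w * muSign ν (toggle s w) v) := by
  rw [muSign_toggle, muSign_toggle]
  have : ν v ≠ ν w := fun h' => h (ν.injective h')
  -- Exactly one of `v`, `w` precedes the other, so exactly one of the two products changes its
  -- sign.
  rcases lt_or_gt_of_ne this with h1 | h1
  · rw [if_pos h1, if_neg (by omega)]; ring
  · rw [if_neg (by omega), if_pos h1]; ring

/-! ## Moves between states -/

section Moves

variable {V J : Type} {m n : ℕ}

/-- The place of a move: `inl v` is the saddle at `v` and `inr b` the genus-one morphism at `b`. -/
def place : V ⊕ V → V := Sum.elim id id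

/-- The morphism that belongs to a move. -/
def Shadow.mor [Finite V] [Finite J] (k : Type*) [CommRing k] (Γ : Shadow V J m n) (χ : Γ.Coloring)
    (σ τ : V → Bool) : V ⊕ V → Chain k (Γ.smooth χ σ) (Γ.smooth χ τ)
  | .inl v => Chain.of k (Γ.saddle χ σ τ v)
  | .inr v => Chain.of k (Γ.phiFst χ σ τ v) - Chain.of k (Γ.phiSnd χ σ τ v)

section Morphisms

variable [Finite V] [Finite J] (k : Type*) [CommRing k] {Γ : Shadow V J m n} {χ : Γ.Coloring}

/-- Connections and weights of each elementary bordism depend only on its place, not on the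
smoothings around it; so every pair of terms can be interchanged by `Shadow.IsElem.comm`. -/
theorem Shadow.mor_comm (t t' : V ⊕ V) {σ ρ ρ' τ : V → Bool}
    (h : ∀ v, ρ v = σ v ∨ ρ v = τ v) (h' : ∀ v, ρ' v = σ v ∨ ρ' v = τ v) :
    Chain.cls k (Chain.comp k (Γ.mor k χ σ ρ t) (Γ.mor k χ ρ τ t')) =
      Chain.cls k (Chain.comp k (Γ.mor k χ σ ρ' t') (Γ.mor k χ ρ' τ t)) := by
  have hs (σ τ) (v) := Shadow.isElem_saddle (χ := χ) σ τ v
  have hf (σ τ) (v) := Shadow.isElem_phiFst (χ := χ) σ τ v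
  have hg (σ τ) (v) := Shadow.isElem_phiSnd (χ := χ) σ τ v
  rcases t with v | v <;> rcases t' with w | w <;>
    simp only [Shadow.mor, Chain.comp_sub_left, Chain.comp_sub_right, Chain.comp_of, map_sub]
  · exact Chain.cls_of_iso k ((hs _ _ v).comm (hs _ _ w) (hs _ _ w) (hs _ _ v) h h')
  · rw [Chain.cls_of_iso k ((hs _ _ v).comm (hf _ _ w) (hf _ _ w) (hs _ _ v) h h'),
      Chain.cls_of_iso k ((hs _ _ v).comm (hg _ _ w) (hg _ _ w) (hs _ _ v) h h')]
  · rw [Chain.cls_of_iso k ((hf _ _ v).comm (hs _ _ w) (hs _ _ w) (hf _ _ v) h h'),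
      Chain.cls_of_iso k ((hg _ _ v).comm (hs _ _ w) (hs _ _ w) (hg _ _ v) h h')]
  · rw [Chain.cls_of_iso k ((hf _ _ v).comm (hf _ _ w) (hf _ _ w) (hf _ _ v) h h'),
      Chain.cls_of_iso k ((hf _ _ v).comm (hg _ _ w) (hg _ _ w) (hf _ _ v) h h'),
      Chain.cls_of_iso k ((hg _ _ v).comm (hf _ _ w) (hf _ _ w) (hg _ _ v) h h'),
      Chain.cls_of_iso k ((hg _ _ v).comm (hg _ _ w) (hg _ _ w) (hg _ _ v) h h')]
    abel

/-- Once the sheets are connected, the tube term and the handle term of `Φ` coincide and cancel. -/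
theorem Shadow.saddle_phi_zero {σ ρ τ : V → Bool} {v : V} (hv : σ v ≠ τ v)
    (h : ∀ v, ρ v = σ v ∨ ρ v = τ v) :
    Chain.cls k (Chain.comp k (Γ.mor k χ σ ρ (.inl v)) (Γ.mor k χ ρ τ (.inr v))) = 0 := by
  simp only [Shadow.mor, Chain.comp_sub_right, Chain.comp_of, map_sub]
  rw [Chain.cls_of_iso k (Shadow.saddle_phi_iso hv h), sub_self]

theorem Shadow.phi_saddle_zero {σ ρ τ : V → Bool} {v : V} (hv : σ v ≠ τ v)
    (h : ∀ v, ρ v = σ v ∨ ρ v = τ v) :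
    Chain.cls k (Chain.comp k (Γ.mor k χ σ ρ (.inr v)) (Γ.mor k χ ρ τ (.inl v))) = 0 := by
  simp only [Shadow.mor, Chain.comp_sub_left, Chain.comp_of, map_sub]
  rw [Chain.cls_of_iso k (Shadow.phi_saddle_iso hv h), sub_self]

variable {e : Dart V J m n} {he : Γ.tail e = true}

/-- Moves commute with bordisms onto the kink. -/
theorem Shadow.mor_comm_kink (t : V ⊕ V) {σ σ' : V → Bool} {τ τ' : Option V → Bool}
    {T : Bordism (Γ.smooth χ σ') ((Γ.kink e he).smooth (χ.kink e he) τ')}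
    {T' : Bordism (Γ.smooth χ σ) ((Γ.kink e he).smooth (χ.kink e he) τ)}
    {Y : Setoid (Dart (Option V) J m n)} {u : Dart (Option V) J m n →₀ ℤ}
    (hT : Γ.IsKinkElem T Y u) (hT' : Γ.IsKinkElem T' Y u) (h : KinkState σ τ)
    (h' : KinkState σ' τ') :
    Chain.cls k (Chain.comp k (Γ.mor k χ σ σ' t) (Chain.of k T)) =
      Chain.cls k (Chain.comp k (Chain.of k T')
        ((Γ.kink e he).mor k (χ.kink e he) τ τ' (t.map some some))) := by
  have hp (v : V) (i j : Fin 4) : (pairSetoid (.cross v i) (.cross v j)).map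
      (Dart.old : Dart V J m n → _) = pairSetoid (.cross (some v) i) (.cross (some v) j) :=
    setoid_map_pair _ _ _
  have hw (v : V) (z : ℤ) : (Finsupp.single (.cross v 0) z).mapDomain
      (Dart.old : Dart V J m n → _) = Finsupp.single (.cross (some v) 0) z :=
    Finsupp.mapDomain_single
  have hb : (⊥ : Setoid (Dart V J m n)).map Dart.old = ⊥ :=
    le_bot_iff.1 (setoid_map_le_comap.2 bot_le)
  rcases t with v | v
  · exact Chain.cls_comp_of_iso k ((Shadow.isElem_saddle σ σ' v).comm_kink hT hT'
      (Shadow.isElem_saddle τ τ' (some v)) hb (hw v _) h h')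
  · exact Chain.cls_comp_sub_of_iso k
      ((Shadow.isElem_phiFst σ σ' v).comm_kink hT hT'
        (Shadow.isElem_phiFst τ τ' (some v)) (hp v 0 1) (hw v _) h h')
      ((Shadow.isElem_phiSnd σ σ' v).comm_kink hT hT'
        (Shadow.isElem_phiSnd τ τ' (some v)) (hp v 0 0) (hw v _) h h')

/-- The saddle at the kink glues the torus and the splitting saddle in the same way. -/
theorem Shadow.kink_saddle_eq (σ : V → Bool) {τ τ' : Option V → Bool} (h' : τ' none = false) :
    Chain.cls k (Chain.comp k (Chain.of k (Γ.newCircle χ e he 1 σ τ))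
        ((Γ.kink e he).mor k (χ.kink e he) τ τ' (.inl none))) =
      Chain.cls k (Chain.comp k (Chain.of k (Γ.split χ e he σ τ))
        ((Γ.kink e he).mor k (χ.kink e he) τ τ' (.inl none))) := by
  have h1 := (Shadow.isKinkElem_newCircle (χ := χ) (e := e) (he := he) 1 σ τ).comp_elem
    (Shadow.isElem_saddle τ τ' none)
  have h2 := (Shadow.isKinkElem_split (χ := χ) (e := e) (he := he) σ τ).comp_elem
    (Shadow.isElem_saddle τ τ' none)
  rw [bot_sup_eq, sup_comm] at h1
  rw [sup_bot_eq, sup_comm] at h2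
  -- The horizontal smoothing of the kink already connects `0` and `1`; the weights agree because `1
  -- - 2 * 1 = -1`.
  have h3 := h2.absorb (((Γ.kink e he).pair_le_conn h').trans le_sup_left)
  rw [sup_comm] at h1
  rw [sup_bot_eq] at h1
  exact Chain.cls_comp_of_iso k (h1.iso h3)

end Morphisms

end Moves

end

/-! ## The bracket is a complex -/

section

variable {V J : Type} {m n : ℕ}

theorem Diagram.State.ext' {D : Diagram V J m n} {x y : D.State} (hr : x.r = y.r)
    (hs : x.s = y.s) : x = y := by
  cases x; cases y; cases hr; cases hs; rfl

theorem Diagram.State.vertical_congr {D : Diagram V J m n} {x y : D.State} {v : V}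
    (hr : v ∈ x.r ↔ v ∈ y.r) (hs : v ∈ x.s ↔ v ∈ y.s) : x.vertical v = y.vertical v := by
  unfold Diagram.State.vertical
  cases D.kind v <;> by_cases h1 : v ∈ y.r <;> by_cases h2 : v ∈ y.s <;> simp [h1, h2, hr, hs]

theorem toggle_of_mem [DecidableEq V] {s : Finset V} {v : V} (h : v ∈ s) :
    toggle s v = s.erase v := if_pos h

theorem toggle_of_notMem [DecidableEq V] {s : Finset V} {v : V} (h : v ∉ s) :
    toggle s v = insert v s := if_neg h

theorem toggle_comm [DecidableEq V] (s : Finset V) (v w : V) :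
    toggle (toggle s v) w = toggle (toggle s w) v := by
  simp only [toggle]
  grind

theorem mem_toggle_of_ne [DecidableEq V] {s : Finset V} {u v : V} (h : u ≠ v) :
    u ∈ toggle s v ↔ u ∈ s := by
  simp only [toggle]
  grind

/-- A move can be made at a state. -/
def Diagram.Admits (D : Diagram V J m n) (r s : Finset V) : V ⊕ V → Prop
  | .inl v => v ∉ s
  | .inr b => D.kind b = Kind.sing ∧ b ∉ r ∧ b ∈ s

/-- Whether a move can be made depends only on the state at its place. -/
theorem Diagram.admits_congr {t : V ⊕ V} {D D' : Diagram V J m n} {r s r' s' : Finset V}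
    (hD : D.kind (place t) = D'.kind (place t)) (hr : place t ∈ r ↔ place t ∈ r')
    (hs : place t ∈ s ↔ place t ∈ s') : D.Admits r s t ↔ D'.Admits r' s' t := by
  rcases t with v | v
  · exact not_congr hs
  · exact and_congr (by rw [show D.kind v = D'.kind v from hD]) (and_congr (not_congr hr) hs)

section Moves

variable [DecidableEq V]

/-- The double points that a move resolves into positive crossings. -/
def moveRes : V ⊕ V → Finset V → Finset V
  | .inl _, r => r
  | .inr b, r => insert b r

theorem moveRes_comm (t t' : V ⊕ V) (r : Finset V) :
    moveRes t' (moveRes t r) = moveRes t (moveRes t' r) := by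
  rcases t with v | v <;> rcases t' with w | w <;> simp [moveRes, Finset.insert_comm]

theorem mem_moveRes_of_ne {t : V ⊕ V} {u : V} (h : u ≠ place t) (r : Finset V) :
    u ∈ moveRes t r ↔ u ∈ r := by
  rcases t with v | v
  · rfl
  · exact Finset.mem_insert.trans (or_iff_right h)

/-- The move `t` leads from `x` to `y`. -/
def Diagram.Move (D : Diagram V J m n) (x y : D.State) (t : V ⊕ V) : Prop :=
  D.Admits x.r x.s t ∧ y.r = moveRes t x.r ∧ y.s = toggle x.s (place t)

variable {D : Diagram V J m n} {x y z : D.State} {t t' : V ⊕ V}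

theorem Diagram.move_inl {v : V} :
    D.Move x y (.inl v) ↔ v ∉ x.s ∧ y.r = x.r ∧ y.s = insert v x.s := by
  refine and_congr_right fun h => and_congr_right fun _ => ?_
  rw [show place (.inl v) = v from rfl, toggle_of_notMem h]

theorem Diagram.move_inr {b : V} : D.Move x y (.inr b) ↔
    D.kind b = Kind.sing ∧ b ∉ x.r ∧ b ∈ x.s ∧ y.r = insert b x.r ∧ y.s = x.s.erase b := by
  simp only [Diagram.Move, Diagram.Admits, and_assoc]
  refine and_congr_right fun _ => and_congr_right fun _ => and_congr_right fun h =>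
    and_congr_right fun _ => ?_
  rw [show place (.inr b) = b from rfl, toggle_of_mem h]

theorem Diagram.Move.unique (h : D.Move x y t) (h' : D.Move x z t) : y = z :=
  Diagram.State.ext' (h.2.1.trans h'.2.1.symm) (h.2.2.trans h'.2.2.symm)

theorem Diagram.Move.sing (h : D.Admits x.r x.s t) : ∀ v ∈ moveRes t x.r, D.kind v = Kind.sing := by
  rcases t with v | v
  · exact x.sing_of_mem
  · intro u hu
    rcases Finset.mem_insert.1 hu with rfl | hu
    · exact h.1
    · exact x.sing_of_mem u hu

/-- A saddle adds one element to `s`; a genus-one move removes one from `s` and adds one, which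
counts twice, to `r`. -/
theorem Diagram.Move.deg (h : D.Move x y t) :
    (y.s.card : ℤ) + 2 * (y.r.card : ℤ) = x.s.card + 2 * (x.r.card : ℤ) + 1 := by
  rcases t with v | v
  · obtain ⟨h1, h2, h3⟩ := Diagram.move_inl.1 h
    rw [h2, h3, Finset.card_insert_of_notMem h1]
    push_cast
    ring
  · obtain ⟨-, h1, h2, h3, h4⟩ := Diagram.move_inr.1 h
    have := Finset.card_pos.2 ⟨_, h2⟩
    rw [h3, h4, Finset.card_insert_of_notMem h1, Finset.card_erase_of_mem h2, Nat.cast_sub this]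
    push_cast
    ring

theorem Diagram.Move.vertical_of_ne (h : D.Move x y t) {u : V} (hu : u ≠ place t) :
    y.vertical u = x.vertical u := by
  apply Diagram.State.vertical_congr
  · rw [h.2.1, mem_moveRes_of_ne hu]
  · rw [h.2.2, mem_toggle_of_ne hu]

/-- Passing from the negative to the positive resolution exchanges the two smoothings, and removing
`b` from `s` exchanges them back: `b` is vertical before and after. -/
theorem Diagram.Move.vertical_inr {b : V} (h : D.Move x y (.inr b)) (u : V) :
    y.vertical u = x.vertical u := by
  by_cases hu : u = b
  · subst hu
    obtain ⟨h0, h1, h2, h3, h4⟩ := Diagram.move_inr.1 h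
    simp [Diagram.State.vertical, h0, h1, h2, h3, h4]
  · exact h.vertical_of_ne hu

theorem Diagram.Move.vertical_inl {v : V} (h : D.Move x y (.inl v)) :
    x.vertical v ≠ y.vertical v := by
  obtain ⟨h1, h2, h3⟩ := Diagram.move_inl.1 h
  simp only [Diagram.State.vertical, h2, h3, h1, Finset.mem_insert_self]
  cases D.kind v <;> simp

/-- Supplies the hypothesis of `Shadow.IsElem.comp`: at the place of `t` the intermediate state
already looks like `y`, elsewhere still like `x`. -/
theorem Diagram.Move.between (h : D.Move x z t) (h' : D.Move z y t') (ht : place t ≠ place t')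
    (u : V) : z.vertical u = x.vertical u ∨ z.vertical u = y.vertical u := by
  by_cases hu : u = place t
  · exact Or.inr (h'.vertical_of_ne (hu ▸ ht)).symm
  · exact Or.inl (h.vertical_of_ne hu)

/-- Admissibility is a local condition, so moves at different places can be made in either order. -/
theorem Diagram.Move.square (ht : place t ≠ place t')
    (hxy : ∃ z, D.Move x z t ∧ D.Move z y t') : ∃ z, D.Move x z t' ∧ D.Move z y t := by
  obtain ⟨z, h, h'⟩ := hxy
  have h1 : D.Admits x.r x.s t' := by
    refine (Diagram.admits_congr rfl ?_ ?_).1 h'.1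
    · rw [h.2.1, mem_moveRes_of_ne ht.symm]
    · rw [h.2.2, mem_toggle_of_ne ht.symm]
  refine ⟨⟨moveRes t' x.r, toggle x.s (place t'), Diagram.Move.sing h1⟩, ⟨h1, rfl, rfl⟩, ?_, ?_, ?_⟩
  · refine (Diagram.admits_congr rfl ?_ ?_).1 h.1
    · exact (mem_moveRes_of_ne ht _).symm
    · exact (mem_toggle_of_ne ht).symm
  · rw [h'.2.1, h.2.1, moveRes_comm]
  · rw [h'.2.2, h.2.2, toggle_comm]

end Moves

section

variable (k : Type*) [CommRing k]

theorem Chain.cls_comp_zsmul {Y₀ Y₁ : Type} {ε₀ : Y₀ → Bool} {ε₁ : Y₁ → Bool}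
    {W X Z : OneCob ε₀ ε₁} (a b : ℤ) (f : Chain k W X) (g : Chain k X Z) :
    Chain.cls k (Chain.comp k (a • f) (b • g)) = (a * b) • Chain.cls k (Chain.comp k f g) := by
  rw [Chain.comp_zsmul_left, Chain.comp_zsmul_right, map_zsmul, map_zsmul, mul_smul]

theorem Chain.cls_comp_zsmul_eq_zero {Y₀ Y₁ : Type} {ε₀ : Y₀ → Bool} {ε₁ : Y₁ → Bool}
    {W X Z : OneCob ε₀ ε₁} (a b : ℤ) {f : Chain k W X} {g : Chain k X Z}
    (h : Chain.cls k (Chain.comp k f g) = 0) :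
    Chain.cls k (Chain.comp k (a • f) (b • g)) = 0 := by
  rw [Chain.cls_comp_zsmul, h, smul_zero]

theorem Shadow.mor_comm_zsmul [Finite V] [Finite J] {Γ : Shadow V J m n}
    {χ : Γ.Coloring} (t t' : V ⊕ V) {σ ρ ρ' τ : V → Bool} (h : ∀ v, ρ v = σ v ∨ ρ v = τ v) (h' : ∀ v, ρ' v = σ v ∨ ρ' v = τ v)
    {a b a' b' u : ℤ} (hu : a * b = u * (a' * b')) :
    Chain.cls k (Chain.comp k (a • Γ.mor k χ σ ρ t) (b • Γ.mor k χ ρ τ t')) =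
      u • Chain.cls k (Chain.comp k (a' • Γ.mor k χ σ ρ' t') (b' • Γ.mor k χ ρ' τ t)) := by
  rw [Chain.cls_comp_zsmul, Chain.cls_comp_zsmul, ← mul_smul, hu, Shadow.mor_comm k t t' h h']

end

section Bracket

variable [Fintype V] [DecidableEq V] [Finite J] (k : Type*) [CommRing k]

open Classical in
/-- The component of the differential that belongs to a move. -/
def Diagram.moveTerm (D : Diagram V J m n) (χ : D.Coloring) (ν : V ↪ ℕ) (t : V ⊕ V)
    (x y : D.State) : Chain k (D.smoothing χ x) (D.smoothing χ y) :=
  if D.Move x y t then muSign ν x.s (place t) • D.mor k χ x.vertical y.vertical t else 0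

theorem Diagram.bracket_d (D : Diagram V J m n) (χ : D.Coloring) (ν : V ↪ ℕ) (x y : D.State) :
    (D.bracket k χ ν).d x y = ∑ t, D.moveTerm k χ ν t x y := by
  classical
  rw [Fintype.sum_sum_type]
  exact congrArg₂ (· + ·)
    (Finset.sum_congr rfl fun v _ => if_congr Diagram.move_inl.symm rfl rfl)
    (Finset.sum_congr rfl fun b _ => if_congr Diagram.move_inr.symm rfl rfl)

variable {D : Diagram V J m n} {χ : D.Coloring} {ν : V ↪ ℕ}

/-- Two saddles at one place are impossible because the first puts it into `s`, two genus-one moves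
because the first puts it into `r`. The mixed products vanish since the saddle connects the sheets.
-/
theorem Diagram.moveTerm_comp_of_place_eq (x y : D.State) {t t' : V ⊕ V} (h : place t = place t') :
    rowCol k (fun z => D.moveTerm k χ ν t x z) (fun z => D.moveTerm k χ ν t' z y) = 0 := by
  classical
  have := Diagram.State.finite D
  refine rowCol_eq_zero k (fun z => D.Move x z t) (fun z => D.Move z y t') _ _ fun z h1 h2 => ?_
  refine Chain.cls_comp_zsmul_eq_zero k _ _ ?_
  rcases t with v | v <;> rcases t' with w | w <;> obtain rfl : v = w := h
  · have h3 := Diagram.move_inl.1 h1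
    have h4 := Diagram.move_inl.1 h2
    exact absurd (h3.2.2 ▸ Finset.mem_insert_self v x.s) h4.1
  · have hv : x.vertical v ≠ y.vertical v := by
      rw [h2.vertical_inr]
      exact h1.vertical_inl
    exact Shadow.saddle_phi_zero k hv fun u => Or.inr (h2.vertical_inr u).symm
  · have hv : x.vertical v ≠ y.vertical v := by
      rw [← h1.vertical_inr]
      exact h2.vertical_inl
    exact Shadow.phi_saddle_zero k hv fun u => Or.inl (h1.vertical_inr u)
  · have h3 := Diagram.move_inr.1 h1
    have h4 := Diagram.move_inr.1 h2
    exact absurd (h3.2.2.2.1 ▸ Finset.mem_insert_self v x.r) h4.2.1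

theorem Diagram.moveTerm_anticomm (x y : D.State) {t t' : V ⊕ V} (h : place t ≠ place t') :
    rowCol k (fun z => D.moveTerm k χ ν t x z) (fun z => D.moveTerm k χ ν t' z y) =
      (-1 : ℤ) • rowCol k (fun z => D.moveTerm k χ ν t' x z)
        (fun z => D.moveTerm k χ ν t z y) := by
  classical
  have := Diagram.State.finite D
  refine rowCol_square k (fun z => D.Move x z t) (fun z => D.Move z y t')
    (fun z => D.Move x z t') (fun z => D.Move z y t) _ _ _ _ (fun _ _ => Diagram.Move.unique)
    (fun _ _ => Diagram.Move.unique) ⟨Diagram.Move.square h, Diagram.Move.square h.symm⟩ _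
    fun z z' h1 h2 h3 h4 => ?_
  refine Shadow.mor_comm_zsmul k t t' (h1.between h2 h) (h3.between h4 h.symm) ?_
  rw [h1.2.2, h3.2.2, muSign_toggle_comm ν x.s h, neg_one_mul]

theorem Diagram.bracket_d_comp_d (x y : D.State) :
    rowCol k (fun z => ∑ t, D.moveTerm k χ ν t x z) (fun z => ∑ t, D.moveTerm k χ ν t z y) =
      0 := by
  have := Diagram.State.finite D
  refine (rowCol_sum_left k _ _ _).trans ?_
  refine (Finset.sum_congr rfl fun t _ => rowCol_sum_right k _ _ _).trans ?_
  rw [← Finset.sum_product']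
  -- Exchanging the two moves cancels the terms with different places; a pair fixed by the exchange
  -- has equal places, so its term is zero.
  refine Finset.sum_involution (fun p _ => p.swap) (fun p _ => ?_) (fun p _ hp h => ?_)
    (fun p _ => by simp) fun p _ => p.swap_swap
  · obtain ⟨t, t'⟩ := p
    by_cases h : place t = place t'
    · rw [Prod.swap_prod_mk, Diagram.moveTerm_comp_of_place_eq k x y h,
        Diagram.moveTerm_comp_of_place_eq k x y h.symm, add_zero]
    · rw [Prod.swap_prod_mk, Diagram.moveTerm_anticomm k x y h]
      simp
  · have h1 := congrArg Prod.fst h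
    rw [Prod.fst_swap] at h1
    exact hp (Diagram.moveTerm_comp_of_place_eq k x y (congrArg place h1.symm))

theorem Diagram.exists_move {x y : D.State} (h : (D.bracket k χ ν).d x y ≠ 0) :
    ∃ t, D.Move x y t := by
  rw [Diagram.bracket_d] at h
  obtain ⟨t, -, ht⟩ := Finset.exists_ne_zero_of_sum_ne_zero h
  refine ⟨t, ?_⟩
  by_contra h'
  exact ht (if_neg h')

theorem Diagram.bracket_isComplex (D : Diagram V J m n) (χ : D.Coloring) (ν : V ↪ ℕ) :
    (D.bracket k χ ν).IsComplex := by
  constructor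
  · intro x y h
    obtain ⟨t, ht⟩ := Diagram.exists_move k h
    exact ht.deg
  · intro x y
    exact (Chain.eqv_iff k).2 ((congrArg _ (finsum_congr fun z => congrArg₂ (Chain.comp k)
      (Diagram.bracket_d k D χ ν x z) (Diagram.bracket_d k D χ ν z y))).trans
        ((Diagram.bracket_d_comp_d k x y).trans (map_zero _).symm))

end Bracket

end

/-! ## The genus-one morphism is a chain map -/

section

variable {V J : Type} {m n : ℕ}

section GenusOne

variable [DecidableEq V] {D : Diagram V J m n} {c : V}

/-- The component of the genus-one morphism from `x` to `y` is not zero. -/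
def Diagram.Contract (x : (D.resolve c .neg).State) (y : (D.resolve c .pos).State) : Prop :=
  c ∈ x.s ∧ y.r = x.r ∧ y.s = toggle x.s c

theorem Diagram.contract_iff {x : (D.resolve c .neg).State} {y : (D.resolve c .pos).State} :
    Diagram.Contract x y ↔ c ∈ x.s ∧ y.r = x.r ∧ y.s = x.s.erase c := by
  refine and_congr_right fun h => ?_
  rw [toggle_of_mem h]

theorem Diagram.resolve_kind_self (D : Diagram V J m n) (c : V) (t : Kind) :
    (D.resolve c t).kind c = t := if_pos rfl

theorem Diagram.resolve_kind_of_ne (D : Diagram V J m n) {c v : V} (t : Kind) (h : v ≠ c) :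
    (D.resolve c t).kind v = D.kind v := if_neg h

theorem Diagram.vertical_resolve {t t' : Kind} {x : (D.resolve c t).State}
    {y : (D.resolve c t').State} {v : V} (hv : v ≠ c) (hr : v ∈ x.r ↔ v ∈ y.r)
    (hs : v ∈ x.s ↔ v ∈ y.s) : x.vertical v = y.vertical v := by
  unfold Diagram.State.vertical
  rw [D.resolve_kind_of_ne t hv, D.resolve_kind_of_ne t' hv]
  cases D.kind v <;> by_cases h1 : v ∈ y.r <;> by_cases h2 : v ∈ y.s <;> simp [h1, h2, hr, hs]

theorem Diagram.vertical_neg {x : (D.resolve c .neg).State} :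
    x.vertical c = true ↔ c ∈ x.s := by
  unfold Diagram.State.vertical
  rw [D.resolve_kind_self]
  simp

theorem Diagram.vertical_pos {x : (D.resolve c .pos).State} :
    x.vertical c = true ↔ c ∉ x.s := by
  unfold Diagram.State.vertical
  rw [D.resolve_kind_self]
  simp

theorem Diagram.Contract.vertical {x : (D.resolve c .neg).State} {y : (D.resolve c .pos).State}
    (h : Diagram.Contract x y) (v : V) : x.vertical v = y.vertical v := by
  by_cases hv : v = c
  · subst hv
    rw [Diagram.vertical_neg.2 h.1, Diagram.vertical_pos.2]
    rw [h.2.2, toggle_of_mem h.1]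
    exact Finset.notMem_erase _ _
  · refine Diagram.vertical_resolve hv ?_ ?_
    · rw [h.2.1]
    · rw [h.2.2, mem_toggle_of_ne hv]

/-- Where `c` is an ordinary crossing, it cannot belong to `r`; the other kinds do not depend on the
resolution of `c`. -/
theorem Diagram.State.kind_resolve {t t' : Kind} (ht : t ≠ Kind.sing)
    {r : Finset V} (h : ∀ v ∈ r, (D.resolve c t).kind v = Kind.sing) :
    ∀ v ∈ r, (D.resolve c t').kind v = Kind.sing := by
  intro v hv
  have h1 := h v hv
  by_cases hvc : v = c
  · subst hvc
    rw [D.resolve_kind_self] at h1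
    exact absurd h1 ht
  · rwa [D.resolve_kind_of_ne _ hvc] at h1 ⊢

variable {x : (D.resolve c .neg).State} {y : (D.resolve c .pos).State} {t : V ⊕ V}

theorem Diagram.contract_square (ht : place t ≠ c) :
    (∃ z, (D.resolve c .neg).Move x z t ∧ Diagram.Contract z y) ↔
      ∃ z, Diagram.Contract x z ∧ (D.resolve c .pos).Move z y t := by
  have hk : (D.resolve c .neg).kind (place t) = (D.resolve c .pos).kind (place t) := by
    rw [D.resolve_kind_of_ne _ ht, D.resolve_kind_of_ne _ ht]
  constructor
  · rintro ⟨z, h, h'⟩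
    refine ⟨⟨x.r, toggle x.s c, Diagram.State.kind_resolve (by simp) x.sing_of_mem⟩,
      ⟨?_, rfl, rfl⟩, ?_, ?_, ?_⟩
    · have := h'.1
      rwa [h.2.2, mem_toggle_of_ne ht.symm] at this
    · exact (Diagram.admits_congr hk Iff.rfl (mem_toggle_of_ne ht).symm).1 h.1
    · rw [h'.2.1, h.2.1]
    · rw [h'.2.2, h.2.2, toggle_comm]
  · rintro ⟨z, h, h'⟩
    have h1 : (D.resolve c .neg).Admits x.r x.s t := by
      refine (Diagram.admits_congr hk.symm ?_ ?_).1 h'.1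
      · rw [h.2.1]
      · rw [h.2.2, mem_toggle_of_ne ht]
    refine ⟨⟨moveRes t x.r, toggle x.s (place t), Diagram.Move.sing h1⟩, ⟨h1, rfl, rfl⟩, ?_, ?_, ?_⟩
    · exact (mem_toggle_of_ne ht.symm).2 h.1
    · rw [h'.2.1, h.2.1]
    · rw [h'.2.2, h.2.2, toggle_comm]

end GenusOne

section GenusOneChain

variable [Fintype V] [DecidableEq V] [Finite J] (k : Type*) [CommRing k]
  {D : Diagram V J m n} {c : V} {χ : D.Coloring} {ν : V ↪ ℕ}

open Classical in
theorem Diagram.genusOne_apply (D : Diagram V J m n) (χ : D.Coloring) (ν : V ↪ ℕ) (c : V)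
    (x : (D.resolve c .neg).State) (y : (D.resolve c .pos).State) :
    D.genusOne k χ ν c x y = if Diagram.Contract x y then
      muSign ν x.s c • D.mor k χ x.vertical y.vertical (.inr c) else 0 :=
  if_congr Diagram.contract_iff.symm rfl rfl

/-- The two contributions of a move away from `c` cancel each other, those at `c` vanish. -/
theorem Diagram.moveTerm_genusOne (x : (D.resolve c .neg).State) (y : (D.resolve c .pos).State)
    (t : V ⊕ V) :
    rowCol k (fun z => (D.resolve c .neg).moveTerm k χ ν t x z)
        (fun z => D.genusOne k χ ν c z y) =
      (-1 : ℤ) • rowCol k (fun z : (D.resolve c .pos).State => D.genusOne k χ ν c x z)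
        (fun z => (D.resolve c .pos).moveTerm k χ ν t z y) := by
  classical
  have := Diagram.State.finite (D.resolve c .neg)
  have := Diagram.State.finite (D.resolve c .pos)
  have e1 : (fun z => D.genusOne k χ ν c z y) = fun z : (D.resolve c .neg).State =>
      if Diagram.Contract z y then
        muSign ν z.s c • D.mor k χ z.vertical y.vertical (.inr c) else 0 :=
    funext fun z => Diagram.genusOne_apply k D χ ν c z y
  have e2 : (fun z : (D.resolve c .pos).State => D.genusOne k χ ν c x z) =
      fun z => if Diagram.Contract x z then
        muSign ν x.s c • D.mor k χ x.vertical z.vertical (.inr c) else 0 :=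
    funext fun z => Diagram.genusOne_apply k D χ ν c x z
  refine (congrArg (rowCol k _) e1).trans (Eq.trans ?_
    (congrArg (fun f => (-1 : ℤ) • rowCol k f _) e2.symm))
  by_cases ht : place t = c
  · have h1 : rowCol k (fun z => (D.resolve c .neg).moveTerm k χ ν t x z)
        (fun z : (D.resolve c .neg).State => if Diagram.Contract z y then
          muSign ν z.s c • D.mor k χ z.vertical y.vertical (.inr c) else 0) = 0 := by
      refine rowCol_eq_zero k (fun z => (D.resolve c .neg).Move x z t)
        (fun z => Diagram.Contract z y) _ _ fun z h h' => ?_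
      refine Chain.cls_comp_zsmul_eq_zero k _ _ ?_
      rcases t with v | v <;> obtain rfl : v = c := ht
      · exact Shadow.saddle_phi_zero k (by rw [← h'.vertical]; exact h.vertical_inl)
          fun u => Or.inr (h'.vertical u)
      -- A genus-one move at `c` would need a double point.
      · exact absurd ((D.resolve_kind_self v .neg).symm.trans h.1.1) (by simp)
    have h2 : rowCol k (fun z : (D.resolve c .pos).State => if Diagram.Contract x z then
          muSign ν x.s c • D.mor k χ x.vertical z.vertical (.inr c) else 0)
        (fun z => (D.resolve c .pos).moveTerm k χ ν t z y) = 0 := by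
      refine rowCol_eq_zero k (fun z => Diagram.Contract x z)
        (fun z => (D.resolve c .pos).Move z y t) _ _ fun z h h' => ?_
      refine Chain.cls_comp_zsmul_eq_zero k _ _ ?_
      rcases t with v | v <;> obtain rfl : v = c := ht
      · exact Shadow.phi_saddle_zero k (by rw [h.vertical]; exact h'.vertical_inl)
          fun u => Or.inl (h.vertical u).symm
      · exact absurd ((D.resolve_kind_self v .pos).symm.trans h'.1.1) (by simp)
    exact h1.trans ((congrArg ((-1 : ℤ) • ·) h2).trans (smul_zero _)).symm
  · refine rowCol_square k (fun z => (D.resolve c .neg).Move x z t) (fun z => Diagram.Contract z y)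
      (fun z => Diagram.Contract x z) (fun z => (D.resolve c .pos).Move z y t) _ _ _ _
      (fun _ _ => Diagram.Move.unique) (fun z z' h h' => Diagram.State.ext'
        (h.2.1.trans h'.2.1.symm) (h.2.2.trans h'.2.2.symm)) (Diagram.contract_square ht) _
      fun z z' h1 h2 h3 h4 => ?_
    refine Shadow.mor_comm_zsmul k t (.inr c) (fun u => Or.inr (h2.vertical u))
      (fun u => Or.inl (h3.vertical u).symm) ?_
    rw [h1.2.2, h3.2.2, muSign_toggle_comm ν x.s ht, neg_one_mul]

theorem Diagram.shift_d (A : Diagram V J m n) (χ : A.Coloring) (x y : A.State) :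
    ((A.bracket k χ ν).shift (-1)).d x y = -∑ t, A.moveTerm k χ ν t x y := by
  refine (congrArg (((-1 : ℤ).negOnePow : ℤ) • ·) (Diagram.bracket_d k A χ ν x y)).trans ?_
  simp only [Int.negOnePow_neg, Int.negOnePow_one, Units.val_neg, Units.val_one]
  exact neg_one_zsmul _

/-- The genus-one morphism anticommutes with the unshifted differentials, and the sign of the shift
by `-1` makes it commute. -/
theorem Diagram.genusOne_isChainMap (D : Diagram V J m n) (χ : D.Coloring) (ν : V ↪ ℕ) (c : V) :
    GradedCx.IsChainMap (A := (Diagram.bracket k (D.resolve c .neg) χ ν).shift (-1))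
      (B := Diagram.bracket k (D.resolve c .pos) χ ν) (D.genusOne k χ ν c) := by
  classical
  constructor
  · intro (x : (D.resolve c .neg).State) (y : (D.resolve c .pos).State) h
    have h' : Diagram.Contract x y := by
      by_contra h'
      exact h ((Diagram.genusOne_apply k D χ ν c x y).trans (if_neg h'))
    obtain ⟨h1, h2, h3⟩ := Diagram.contract_iff.1 h'
    have hp := Finset.card_pos.2 ⟨_, h1⟩
    change (y.s.card : ℤ) + 2 * (y.r.card : ℤ) = (x.s.card : ℤ) + 2 * (x.r.card : ℤ) + -1
    rw [h2, h3, Finset.card_erase_of_mem h1, Nat.cast_sub hp]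
    push_cast
    ring
  · intro (x : (D.resolve c .neg).State) (y : (D.resolve c .pos).State)
    have := Diagram.State.finite (D.resolve c .neg)
    have := Diagram.State.finite (D.resolve c .pos)
    have e1 : rowCol k (fun z => -∑ t, (D.resolve c .neg).moveTerm k χ ν t x z)
        (fun z => D.genusOne k χ ν c z y) =
          rowCol k (fun z : (D.resolve c .pos).State => D.genusOne k χ ν c x z)
            (fun z => ∑ t, (D.resolve c .pos).moveTerm k χ ν t z y) := by
      refine (rowCol_neg_left k _ _).trans ?_
      refine (congrArg _ (rowCol_sum_left k _ _ _)).trans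
        (Eq.trans ?_ (rowCol_sum_right k _ _ _).symm)
      refine (Finset.sum_neg_distrib _).symm.trans (Finset.sum_congr rfl fun t _ => ?_)
      refine (congrArg _ (Diagram.moveTerm_genusOne k x y t)).trans ?_
      refine (congrArg _ (neg_one_zsmul _)).trans (neg_neg _)
    refine (Chain.eqv_iff k).2 ((congrArg (Chain.cls k) (finsum_congr fun z => ?_)).trans
      (e1.trans (congrArg (Chain.cls k) (finsum_congr fun z => ?_))))
    · exact congrArg (fun f => Chain.comp k f _)
        (Diagram.shift_d k (D.resolve c .neg) χ x z)
    · exact congrArg (Chain.comp k _) (Diagram.bracket_d k (D.resolve c .pos) χ ν z y).symm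

end GenusOneChain

end

/-! ## States of the diagram with a kink -/

section

variable {V J : Type} {m n : ℕ}

section Lift

variable [DecidableEq V]

/-- A state of the diagram as a state of the diagram with a kink. -/
def liftSet : Bool → Finset V → Finset (Option V)
  | true, s => insert none (s.map .some)
  | false, s => s.map .some

theorem some_mem_liftSet {b : Bool} {s : Finset V} {v : V} : some v ∈ liftSet b s ↔ v ∈ s := by
  cases b <;> simp [liftSet]

theorem none_mem_liftSet {b : Bool} {s : Finset V} : none ∈ liftSet b s ↔ b = true := by
  cases b <;> simp [liftSet]

theorem some_mem_map {s : Finset V} {v : V} :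
    some v ∈ s.map (Function.Embedding.some : V ↪ Option V) ↔ v ∈ s := by
  simp

theorem mem_toggle_self {s : Finset V} {v : V} : v ∈ toggle s v ↔ v ∉ s := by
  simp only [toggle]
  grind

theorem liftSet_toggle (b : Bool) (s : Finset V) (v : V) :
    liftSet b (toggle s v) = toggle (liftSet b s) (some v) := by
  ext u
  cases u with
  | none => rw [mem_toggle_of_ne (by simp), none_mem_liftSet, none_mem_liftSet]
  | some u =>
    rw [some_mem_liftSet]
    by_cases h : u = v
    · subst h
      rw [mem_toggle_self, mem_toggle_self, some_mem_liftSet]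
    · rw [mem_toggle_of_ne h, mem_toggle_of_ne (by simpa using h), some_mem_liftSet]

theorem map_moveRes (t : V ⊕ V) (r : Finset V) : (moveRes t r).map Function.Embedding.some =
    moveRes (t.map some some) (r.map Function.Embedding.some) := by
  rcases t with v | v
  · rfl
  · exact Finset.map_insert _ _ _

theorem place_map (t : V ⊕ V) : place (t.map some some) = some (place t) := by
  cases t <;> rfl

theorem muSign_map (ν : Option V ↪ ℕ) (s : Finset V) (v : V) :
    muSign (Function.Embedding.some.trans ν) s v =
      muSign ν (s.map Function.Embedding.some) (some v) := by
  rw [muSign, muSign, Finset.filter_map, Finset.card_map]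
  rfl

variable {D : Diagram V J m n} {e : Dart V J m n} {he : D.tail e = true} {κ : Kind}

theorem Diagram.kink_kind_some (D : Diagram V J m n) (e : Dart V J m n) (he : D.tail e = true)
    (κ : Kind) (v : V) : ((D.kink e he).resolve none κ).kind (some v) = D.kind v :=
  if_neg (Option.some_ne_none v)

theorem Diagram.kink_kind_none (D : Diagram V J m n) (e : Dart V J m n) (he : D.tail e = true)
    (κ : Kind) : ((D.kink e he).resolve none κ).kind none = κ :=
  if_pos rfl

/-- The state `y` of the diagram with a kink extends `x`, with the smoothing `b` of the kink. -/
def Diagram.Lift (b : Bool) (x : D.State) (y : ((D.kink e he).resolve none κ).State) : Prop :=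
  y.r = x.r.map .some ∧ y.s = liftSet b x.s

theorem Diagram.sing_map (x : D.State) : ∀ v ∈ x.r.map .some,
    ((D.kink e he).resolve none κ).kind v = Kind.sing := by
  intro v hv
  obtain ⟨u, hu, rfl⟩ := Finset.mem_map.1 hv
  exact (D.kink_kind_some e he κ u).trans (x.sing_of_mem u hu)

theorem Diagram.admits_map {r s : Finset V} {b : Bool} {t : V ⊕ V} :
    ((D.kink e he).resolve none κ).Admits (r.map .some) (liftSet b s) (t.map some some) ↔
      D.Admits r s t := by
  rcases t with v | v
  · exact not_congr some_mem_liftSet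
  · refine and_congr ?_ (and_congr (not_congr some_mem_map) some_mem_liftSet)
    rw [D.kink_kind_some e he κ v]

/-- Moves at old crossings neither see nor change the state of the kink. -/
theorem Diagram.lift_square {b : Bool} {x : D.State}
    {y : ((D.kink e he).resolve none κ).State} {t : V ⊕ V} :
    (∃ z, D.Move x z t ∧ Diagram.Lift b z y) ↔
      ∃ z : ((D.kink e he).resolve none κ).State, Diagram.Lift b x z ∧
        ((D.kink e he).resolve none κ).Move z y (t.map some some) := by
  constructor
  · rintro ⟨z, h, h'⟩
    refine ⟨⟨x.r.map .some, liftSet b x.s, Diagram.sing_map x⟩, ⟨rfl, rfl⟩,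
      Diagram.admits_map.2 h.1, ?_, ?_⟩
    · rw [h'.1, h.2.1, map_moveRes]
    · rw [h'.2, h.2.2, liftSet_toggle, place_map]
  · rintro ⟨z, h, h'⟩
    have h1 := h'.1
    rw [h.1, h.2] at h1
    have h2 := Diagram.admits_map.1 h1
    refine ⟨⟨moveRes t x.r, toggle x.s (place t), Diagram.Move.sing h2⟩, ⟨h2, rfl, rfl⟩, ?_, ?_⟩
    · rw [h'.2.1, h.1, map_moveRes]
    · rw [h'.2.2, h.2, liftSet_toggle, place_map]

theorem Diagram.Lift.vertical {b : Bool} {x : D.State}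
    {y : ((D.kink e he).resolve none κ).State} (h : Diagram.Lift b x y) (v : V) :
    y.vertical (some v) = x.vertical v := by
  have hr : some v ∈ y.r ↔ v ∈ x.r := by rw [h.1, some_mem_map]
  have hs : some v ∈ y.s ↔ v ∈ x.s := by rw [h.2, some_mem_liftSet]
  unfold Diagram.State.vertical
  rw [D.kink_kind_some]
  cases D.kind v <;> by_cases h1 : v ∈ x.r <;> by_cases h2 : v ∈ x.s <;> simp [h1, h2, hr, hs]

/-- The vertical smoothing is the 1-smoothing of a negative kink, hence the value `true`; for the
positive kink it is the 0-smoothing. -/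
theorem Diagram.Lift.kinkState_neg {x : D.State}
    {y : ((D.kink e he).resolve none .neg).State} (h : Diagram.Lift true x y) :
    KinkState x.vertical y.vertical := by
  refine ⟨h.vertical, Diagram.vertical_neg.2 ?_⟩
  rw [h.2, none_mem_liftSet]

theorem Diagram.Lift.kinkState_pos {x : D.State}
    {y : ((D.kink e he).resolve none .pos).State} (h : Diagram.Lift false x y) :
    KinkState x.vertical y.vertical := by
  refine ⟨h.vertical, Diagram.vertical_pos.2 ?_⟩
  rw [h.2, none_mem_liftSet]
  simp

/-- Separates the two moves at the kink from those that come from the old diagram. -/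
theorem sum_option_sum [Fintype V] {M : Type*} [AddCommMonoid M] (F : Option V ⊕ Option V → M) :
    ∑ t, F t = F (.inl none) + F (.inr none) + ∑ t : V ⊕ V, F (t.map some some) := by
  simp only [Fintype.sum_sum_type, Fintype.sum_option, Sum.map_inl, Sum.map_inr]
  abel

end Lift

section KinkChain

variable [Fintype V] [DecidableEq V] [Finite J] (k : Type*) [CommRing k]
  {D : Diagram V J m n} {χ : D.Coloring} {ν : Option V ↪ ℕ} {e : Dart V J m n}
  {he : D.tail e = true} {κ : Kind}

/-- A combination of bordisms onto the kink that commutes with the moves. -/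
def Shadow.CommutesWithMoves (Γ : Shadow V J m n) (χ : Γ.Coloring) (e : Dart V J m n)
    (he : Γ.tail e = true)
    (T : ∀ σ τ, Chain k (Γ.smooth χ σ) ((Γ.kink e he).smooth (χ.kink e he) τ)) : Prop :=
  ∀ (t : V ⊕ V) (σ σ' : V → Bool) (τ τ' : Option V → Bool), KinkState σ τ → KinkState σ' τ' →
    Chain.cls k (Chain.comp k (Γ.mor k χ σ σ' t) (T σ' τ')) =
      Chain.cls k (Chain.comp k (T σ τ)
        ((Γ.kink e he).mor k (χ.kink e he) τ τ' (t.map some some)))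

theorem Shadow.commutesWithMoves_newCircle (g : ℕ) :
    D.toShadow.CommutesWithMoves k χ e he
      fun σ τ => Chain.of k (D.toShadow.newCircle χ e he g σ τ) :=
  fun t _ _ _ _ h h' => Shadow.mor_comm_kink k t (Shadow.isKinkElem_newCircle g _ _)
    (Shadow.isKinkElem_newCircle g _ _) h h'

theorem Shadow.commutesWithMoves_split :
    D.toShadow.CommutesWithMoves k χ e he
      fun σ τ => Chain.of k (D.toShadow.split χ e he σ τ) :=
  fun t _ _ _ _ h h' => Shadow.mor_comm_kink k t (Shadow.isKinkElem_split _ _)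
    (Shadow.isKinkElem_split _ _) h h'

theorem Chain.cls_comp_sub {Y₀ Y₁ : Type} {ε₀ : Y₀ → Bool} {ε₁ : Y₁ → Bool}
    {W X X' Z : OneCob ε₀ ε₁} {f : Chain k W X} {g₁ g₂ : Chain k X Z} {f₁ f₂ : Chain k W X'}
    {g : Chain k X' Z}
    (h₁ : Chain.cls k (Chain.comp k f g₁) = Chain.cls k (Chain.comp k f₁ g))
    (h₂ : Chain.cls k (Chain.comp k f g₂) = Chain.cls k (Chain.comp k f₂ g)) :
    Chain.cls k (Chain.comp k f (g₁ - g₂)) = Chain.cls k (Chain.comp k (f₁ - f₂) g) := by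
  rw [Chain.comp_sub_left, Chain.comp_sub_right, map_sub, map_sub, h₁, h₂]

theorem Shadow.CommutesWithMoves.sub {Γ : Shadow V J m n} {χ : Γ.Coloring} {he : Γ.tail e = true}
    {T T' : ∀ σ τ, Chain k (Γ.smooth χ σ) ((Γ.kink e he).smooth (χ.kink e he) τ)}
    (h : Γ.CommutesWithMoves k χ e he T) (h' : Γ.CommutesWithMoves k χ e he T') :
    Γ.CommutesWithMoves k χ e he fun σ τ => T σ τ - T' σ τ :=
  fun t _ _ _ _ hτ hτ' => Chain.cls_comp_sub k (h t _ _ _ _ hτ hτ') (h' t _ _ _ _ hτ hτ')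

theorem Chain.cls_comp_zsmul_congr {Y₀ Y₁ : Type} {ε₀ : Y₀ → Bool} {ε₁ : Y₁ → Bool}
    {W X X' Z : OneCob ε₀ ε₁} {f : Chain k W X} {g : Chain k X Z} {f' : Chain k W X'}
    {g' : Chain k X' Z} {a b a' b' u : ℤ} (hu : a * b = u * (a' * b'))
    (h : Chain.cls k (Chain.comp k f g) = Chain.cls k (Chain.comp k f' g')) :
    Chain.cls k (Chain.comp k (a • f) (b • g)) =
      u • Chain.cls k (Chain.comp k (a' • f') (b' • g')) := by
  rw [Chain.cls_comp_zsmul, Chain.cls_comp_zsmul, ← mul_smul, hu, h]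

open Classical in
/-- The matrix of bordisms onto the kink with coefficients `a`. -/
def Diagram.liftTerm (b : Bool) (a : Finset V → ℤ)
    (T : ∀ σ τ, Chain k (D.toShadow.smooth χ σ)
      ((D.toShadow.kink e he).smooth (χ.kink e he) τ))
    (x : D.State) (y : ((D.kink e he).resolve none κ).State) :
    Chain k (D.toShadow.smooth χ x.vertical)
      ((D.toShadow.kink e he).smooth (χ.kink e he) y.vertical) :=
  if Diagram.Lift b x y then a x.s • T x.vertical y.vertical else 0

variable {T : ∀ σ τ, Chain k (D.toShadow.smooth χ σ)
  ((D.toShadow.kink e he).smooth (χ.kink e he) τ)} {b : Bool} {a : Finset V → ℤ}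

/-- The bordisms commute by `hT`; `ha` is exactly the comparison of signs along the two sides of the
square. -/
theorem Diagram.moveTerm_lift (hT : D.toShadow.CommutesWithMoves k χ e he T)
    (hb : ∀ (x : D.State) (y : ((D.kink e he).resolve none κ).State), Diagram.Lift b x y →
      KinkState x.vertical y.vertical) (u : ℤ)
    (ha : ∀ (s : Finset V) v, muSign ν (s.map .some) (some v) * a (toggle s v) =
      u * (a s * muSign ν (liftSet b s) (some v)))
    (x : D.State) (y : ((D.kink e he).resolve none κ).State) (t : V ⊕ V) :
    rowCol k (fun z => D.moveTerm k χ (Function.Embedding.some.trans ν) t x z)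
        (fun z => Diagram.liftTerm k b a T z y) =
      u • rowCol k (fun z => Diagram.liftTerm k b a T x z)
        (fun z => ((D.kink e he).resolve none κ).moveTerm k (χ.kink e he) ν
          (t.map some some) z y) := by
  classical
  have := Diagram.State.finite D
  have := Diagram.State.finite ((D.kink e he).resolve none κ)
  refine rowCol_square k (fun z => D.Move x z t) (fun z => Diagram.Lift b z y)
    (fun z => Diagram.Lift b x z)
    (fun z => ((D.kink e he).resolve none κ).Move z y (t.map some some)) _ _ _ _
    (fun _ _ => Diagram.Move.unique) (fun z z' h h' => Diagram.State.ext'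
      (h.1.trans h'.1.symm) (h.2.trans h'.2.symm)) Diagram.lift_square _
    fun z z' h1 h2 h3 h4 => ?_
  refine Chain.cls_comp_zsmul_congr k ?_ (hT t _ _ _ _ (hb _ _ h3) (hb _ _ h2))
  rw [h1.2.2, h3.2, place_map, ← ha, muSign_map]

/-- The bordisms onto the kink form a chain map up to the sign `u` if they are compatible with the
moves at the kink. -/
theorem Diagram.lift_comm (hT : D.toShadow.CommutesWithMoves k χ e he T)
    (hb : ∀ (x : D.State) (y : ((D.kink e he).resolve none κ).State), Diagram.Lift b x y →
      KinkState x.vertical y.vertical) (u : ℤ)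
    (ha : ∀ (s : Finset V) v, muSign ν (s.map .some) (some v) * a (toggle s v) =
      u * (a s * muSign ν (liftSet b s) (some v))) (hκ : κ ≠ Kind.sing)
    (x : D.State) (y : ((D.kink e he).resolve none κ).State)
    (h0 : rowCol k (fun z => Diagram.liftTerm k b a T x z)
      (fun z => ((D.kink e he).resolve none κ).moveTerm k (χ.kink e he) ν (.inl none) z y) = 0) :
    rowCol k (fun z => ∑ t, D.moveTerm k χ (Function.Embedding.some.trans ν) t x z)
        (fun z => Diagram.liftTerm k b a T z y) =
      u • rowCol k (fun z => Diagram.liftTerm k b a T x z)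
        (fun z => ∑ t, ((D.kink e he).resolve none κ).moveTerm k (χ.kink e he) ν t z y) := by
  classical
  have := Diagram.State.finite D
  have := Diagram.State.finite ((D.kink e he).resolve none κ)
  -- The kink is an ordinary crossing, so it admits no genus-one move; its saddle is covered by
  -- `h0`.
  have h1 : rowCol k (fun z => Diagram.liftTerm k b a T x z)
      (fun z => ((D.kink e he).resolve none κ).moveTerm k (χ.kink e he) ν (.inr none) z y) = 0 := by
    refine rowCol_eq_zero k (fun z => Diagram.Lift b x z)
      (fun z => ((D.kink e he).resolve none κ).Move z y (.inr none)) _ _ fun z _ h => ?_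
    exact absurd ((D.kink_kind_none e he κ).symm.trans h.1.1) hκ
  refine (rowCol_sum_left k _ _ _).trans (Eq.trans ?_
    (congrArg (u • ·) (rowCol_sum_right k _ _ _).symm))
  refine Eq.trans ?_ (congrArg (u • ·) (sum_option_sum _).symm)
  refine (Finset.sum_congr rfl fun t _ => Diagram.moveTerm_lift k hT hb u ha x y t).trans ?_
  refine Finset.smul_sum.symm.trans (congrArg (u • ·) ?_)
  exact ((congrArg₂ (fun p q => p + q + _) h0 h1).trans
    ((congrArg (· + _) (add_zero _)).trans (zero_add _))).symm

end KinkChain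

end

/-! ## The Reidemeister I morphisms -/

section

section ReidemeisterMoves

variable {V J : Type} {m n : ℕ} [Fintype V] [DecidableEq V] [Finite J] (k : Type*) [CommRing k]
  {D : Diagram V J m n} {χ : D.Coloring} {ν : Option V ↪ ℕ} {e : Dart V J m n}
  {he : D.tail e = true}

/-- The coefficients of the Reidemeister morphism of the negative kink. -/
def kinkSign (ν : Option V ↪ ℕ) (s : Finset V) : ℤ := muSign ν (s.map .some) none

/-- Passing to the 1-smoothing of the kink is also a toggle, at `none`, and it anticommutes with the
toggle at `some v`. The shift of the target compensates this sign. -/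
theorem kinkSign_toggle (ν : Option V ↪ ℕ) (s : Finset V) (v : V) :
    muSign ν (s.map .some) (some v) * kinkSign ν (toggle s v) =
      -1 * (kinkSign ν s * muSign ν (liftSet true s) (some v)) := by
  have h1 : (toggle s v).map .some = toggle (s.map .some) (some v) := liftSet_toggle false s v
  have h2 : liftSet true s = toggle (s.map .some) none := (toggle_of_notMem (by simp)).symm
  rw [kinkSign, kinkSign, h1, h2, muSign_toggle_comm ν _ (Option.some_ne_none v), neg_one_mul]

theorem Diagram.reidNeg_apply (x : D.State) (y : (D.kinkNeg e he).State) :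
    D.reidNeg k χ ν e he x y = Diagram.liftTerm (κ := .neg) k true (kinkSign ν)
      (fun σ τ => Chain.of k (D.toShadow.newCircle χ e he 0 σ τ)) x y := by
  classical
  exact if_congr Iff.rfl rfl rfl

theorem Diagram.reidPos_apply (x : D.State) (y : (D.kinkPos e he).State) :
    D.reidPos k χ ν e he x y = Diagram.liftTerm (κ := .pos) k false (fun _ => 1)
      (fun σ τ => Chain.of k (D.toShadow.newCircle χ e he 1 σ τ) -
        Chain.of k (D.toShadow.split χ e he σ τ)) x y := by
  classical
  exact if_congr Iff.rfl (one_zsmul _).symm rfl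

theorem Diagram.reidNeg_isChainMap (D : Diagram V J m n) (χ : D.Coloring) (ν : Option V ↪ ℕ)
    (e : Dart V J m n) (he : D.tail e = true) :
    GradedCx.IsChainMap (A := D.bracketNil k χ ν) (B := (D.bracketNeg k χ ν e he).shift (-1))
      (D.reidNeg k χ ν e he) := by
  classical
  constructor
  · intro (x : D.State) (y : (D.kinkNeg e he).State) h
    have h' : Diagram.Lift true x y := by
      by_contra h'
      exact h (if_neg h')
    change (y.s.card : ℤ) + 2 * (y.r.card : ℤ) + -1 = (x.s.card : ℤ) + 2 * (x.r.card : ℤ)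
    rw [h'.1, h'.2, liftSet, Finset.card_insert_of_notMem (by simp), Finset.card_map,
      Finset.card_map]
    push_cast
    ring
  · intro (x : D.State) (y : ((D.kink e he).resolve none .neg).State)
    have := Diagram.State.finite ((D.kink e he).resolve none .neg)
    have h0 : rowCol k (fun z => Diagram.liftTerm (κ := .neg) k true (kinkSign ν)
          (fun σ τ => Chain.of k (D.toShadow.newCircle χ e he 0 σ τ)) x z)
        (fun z => ((D.kink e he).resolve none .neg).moveTerm k (χ.kink e he) ν (.inl none) z y) =
          0 := by
      refine rowCol_eq_zero k (fun z => Diagram.Lift true x z)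
        (fun z => ((D.kink e he).resolve none .neg).Move z y (.inl none)) _ _ fun z h h' => ?_
      -- The kink is already 1-smoothed, so no saddle starts there.
      exact absurd (h.2.symm ▸ none_mem_liftSet.2 rfl) h'.1
    have key := (Diagram.lift_comm k (Shadow.commutesWithMoves_newCircle k 0)
      (fun _ _ h => h.kinkState_neg) (-1) (kinkSign_toggle ν) (by simp) x y h0).trans
        ((neg_one_zsmul _).trans (rowCol_neg_right k _ _).symm)
    refine (Chain.eqv_iff k).2 ((congrArg (Chain.cls k) (finsum_congr fun z => ?_)).trans
      (key.trans (congrArg (Chain.cls k) (finsum_congr fun z => ?_))))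
    · exact congrArg₂ (Chain.comp k) (Diagram.bracket_d k D χ _ x z) (Diagram.reidNeg_apply k z y)
    · exact (congrArg₂ (Chain.comp k) (Diagram.reidNeg_apply k x z)
        (Diagram.shift_d k ((D.kink e he).resolve none .neg) (χ.kink e he) z y)).symm

theorem Diagram.reidPos_isChainMap (D : Diagram V J m n) (χ : D.Coloring) (ν : Option V ↪ ℕ)
    (e : Dart V J m n) (he : D.tail e = true) :
    GradedCx.IsChainMap (A := D.bracketNil k χ ν) (B := D.bracketPos k χ ν e he)
      (D.reidPos k χ ν e he) := by
  classical
  constructor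
  · intro (x : D.State) (y : (D.kinkPos e he).State) h
    have h' : Diagram.Lift false x y := by
      by_contra h'
      exact h (if_neg h')
    change (y.s.card : ℤ) + 2 * (y.r.card : ℤ) = (x.s.card : ℤ) + 2 * (x.r.card : ℤ)
    rw [h'.1, h'.2, liftSet, Finset.card_map, Finset.card_map]
  · intro (x : D.State) (y : ((D.kink e he).resolve none .pos).State)
    have := Diagram.State.finite ((D.kink e he).resolve none .pos)
    have h0 : rowCol k (fun z => Diagram.liftTerm (κ := .pos) k false (fun _ => 1)
          (fun σ τ => Chain.of k (D.toShadow.newCircle χ e he 1 σ τ) -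
            Chain.of k (D.toShadow.split χ e he σ τ)) x z)
        (fun z => ((D.kink e he).resolve none .pos).moveTerm k (χ.kink e he) ν (.inl none) z y) =
          0 := by
      refine rowCol_eq_zero k (fun z => Diagram.Lift false x z)
        (fun z => ((D.kink e he).resolve none .pos).Move z y (.inl none)) _ _ fun z h h' => ?_
      refine Chain.cls_comp_zsmul_eq_zero k _ _ ?_
      -- The saddle leads to the horizontal smoothing, where the torus and the splitting saddle
      -- become the same.
      have hy : y.vertical none = false := by
        have h1 := h'.vertical_inl
        rw [h.kinkState_pos.2] at h1
        simpa using h1.symm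
      have h2 := Shadow.kink_saddle_eq k (Γ := D.toShadow) (χ := χ) (e := e) (he := he)
        x.vertical (τ := z.vertical) hy
      refine (congrArg (Chain.cls k) (Chain.comp_sub_left k _ _ _)).trans ?_
      exact (map_sub _ _ _).trans (sub_eq_zero.2 h2)
    have key := (Diagram.lift_comm (ν := ν) k ((Shadow.commutesWithMoves_newCircle k 1).sub k
      (Shadow.commutesWithMoves_split k)) (fun _ _ h => h.kinkState_pos) 1
      (fun s v => by simp [liftSet]) (by simp) x y h0).trans (one_zsmul _)
    refine (Chain.eqv_iff k).2 ((congrArg (Chain.cls k) (finsum_congr fun z => ?_)).trans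
      (key.trans (congrArg (Chain.cls k) (finsum_congr fun z => ?_))))
    · exact congrArg₂ (Chain.comp k) (Diagram.bracket_d k D χ _ x z) (Diagram.reidPos_apply k z y)
    · exact (congrArg₂ (Chain.comp k) (Diagram.reidPos_apply k x z)
        (Diagram.bracket_d k ((D.kink e he).resolve none .pos) (χ.kink e he) ν z y)).symm

/-- The intermediate and the final state have equal smoothings, but belong to different resolutions
of the kink; `hτ` transports neck cutting along this equality. -/
theorem Shadow.cls_newCircle_phi {Γ : Shadow V J m n} {χ : Γ.Coloring} {he : Γ.tail e = true}
    {σ : V → Bool} {τ τ' : Option V → Bool} (h : KinkState σ τ) (hτ : τ = τ') :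
    Chain.cls k (Chain.comp k (Chain.of k (Γ.newCircle χ e he 0 σ τ))
      ((Γ.kink e he).mor k (χ.kink e he) τ τ' (.inr none))) =
    Chain.cls k (Chain.of k (Γ.newCircle χ e he 1 σ τ') - Chain.of k (Γ.split χ e he σ τ')) := by
  subst hτ
  refine Eq.trans (congrArg (Chain.cls k) ?_) ((Chain.eqv_iff k).1 (Shadow.newCircle_phi k h))
  exact (Chain.comp_sub_right k _ _ _).trans
    (congrArg₂ (· - ·) (Chain.comp_of k _ _) (Chain.comp_of k _ _))

theorem Diagram.reidNeg_comp_genusOne (D : Diagram V J m n) (χ : D.Coloring) (ν : Option V ↪ ℕ)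
    (e : Dart V J m n) (he : D.tail e = true) :
    GradedCx.Mat.Eqv
      (GradedCx.Mat.comp (A := D.bracketNil k χ ν) (B := D.bracketNeg k χ ν e he)
        (C := D.bracketPos k χ ν e he) (D.reidNeg k χ ν e he) (D.kinkGenusOne k χ ν e he))
      (D.reidPos k χ ν e he) := by
  classical
  intro (x : D.State) (y : ((D.kink e he).resolve none .pos).State)
  have := Diagram.State.finite ((D.kink e he).resolve none .neg)
  let f (z : ((D.kink e he).resolve none .neg).State) :
      Chain k (D.toShadow.smooth χ x.vertical)
        ((D.toShadow.kink e he).smooth (χ.kink e he) z.vertical) :=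
    kinkSign ν x.s • Chain.of k (D.toShadow.newCircle χ e he 0 x.vertical z.vertical)
  let g (z : ((D.kink e he).resolve none .neg).State) :
      Chain k ((D.toShadow.kink e he).smooth (χ.kink e he) z.vertical)
        ((D.toShadow.kink e he).smooth (χ.kink e he) y.vertical) :=
    muSign ν z.s none •
      (D.toShadow.kink e he).mor k (χ.kink e he) z.vertical y.vertical (.inr none)
  have key : rowCol k (fun z => if Diagram.Lift true x z then f z else 0)
      (fun z => if Diagram.Contract z y then g z else 0) = Chain.cls k
        (Diagram.liftTerm (κ := .pos) k false (fun _ => 1)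
          (fun σ τ => Chain.of k (D.toShadow.newCircle χ e he 1 σ τ) -
            Chain.of k (D.toShadow.split χ e he σ τ)) x y) := by
    by_cases hxy : Diagram.Lift false x y
    -- The only path from `x` to `y`: add the kink to `s`, then contract it away.
    · let z : ((D.kink e he).resolve none .neg).State :=
        ⟨x.r.map .some, liftSet true x.s, Diagram.sing_map x⟩
      have hz : Diagram.Lift true x z := ⟨rfl, rfl⟩
      have hzy : Diagram.Contract z y := by
        refine Diagram.contract_iff.2 ⟨none_mem_liftSet.2 rfl, hxy.1, hxy.2.trans ?_⟩
        exact (Finset.erase_insert (s := x.s.map .some) (by simp)).symm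
      refine (rowCol_eq_single k (fun z => Diagram.Lift true x z)
        (fun z => Diagram.Contract z y) f g (fun z z' h h' => Diagram.State.ext'
          (h.1.trans h'.1.symm) (h.2.trans h'.2.symm)) z hz hzy).trans ?_
      refine (Chain.cls_comp_zsmul k _ _ _ _).trans ?_
      have hs : kinkSign ν x.s * muSign ν z.s none = 1 := by
        change kinkSign ν x.s * muSign ν (insert none (x.s.map .some)) none = 1
        -- Only strictly smaller elements are counted, so the kink does not affect its own sign, and
        -- the product is a square.
        rw [muSign_insert ν (by simp), if_neg (lt_irrefl _), one_mul]
        exact muSign_mul_self ν _ _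
      rw [hs]
      refine (one_zsmul _).trans ((Shadow.cls_newCircle_phi k hz.kinkState_neg
        (funext hzy.vertical)).trans (congrArg (Chain.cls k) ?_))
      exact ((if_pos hxy).trans (one_zsmul _)).symm
    -- A path through any `z` would force `y` to extend `x` with the kink 0-smoothed.
    · refine (rowCol_eq_zero k (fun z => Diagram.Lift true x z)
        (fun z => Diagram.Contract z y) f g fun z h h' => absurd ⟨?_, ?_⟩ hxy).trans
          ((congrArg (Chain.cls k) (if_neg hxy)).trans (map_zero _)).symm
      · rw [h'.2.1, h.1]
      · rw [(Diagram.contract_iff.1 h').2.2, h.2]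
        exact Finset.erase_insert (s := x.s.map .some) (by simp)
  refine (Chain.eqv_iff k).2 ((congrArg (Chain.cls k) (finsum_congr fun z => ?_)).trans
    (key.trans (congrArg (Chain.cls k) (Diagram.reidPos_apply k x y).symm)))
  exact congrArg₂ (Chain.comp k) (Diagram.reidNeg_apply k x z)
    (Diagram.genusOne_apply k (D.kink e he) (χ.kink e he) ν none z y)

end ReidemeisterMoves

end

end TangleCob

theorem theorem5p7 (k : Type*) [CommRing k] {V J : Type} [Fintype V] [DecidableEq V] [Finite J]
    {m n : ℕ} (D : TangleCob.Diagram V J m n) (hD : D.IsPlanar) (χ : D.Coloring)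
    (e : TangleCob.Dart V J m n) (he : D.tail e = true) (ν : Option V ↪ ℕ) :
    (D.bracketNil k χ ν).IsComplex ∧
    (D.bracketNeg k χ ν e he).IsComplex ∧
    (D.bracketPos k χ ν e he).IsComplex ∧
    TangleCob.GradedCx.IsChainMap (A := D.bracketNil k χ ν)
      (B := (D.bracketNeg k χ ν e he).shift (-1)) (D.reidNeg k χ ν e he) ∧
    TangleCob.GradedCx.IsChainMap (A := D.bracketNil k χ ν)
      (B := D.bracketPos k χ ν e he) (D.reidPos k χ ν e he) ∧
    TangleCob.GradedCx.IsChainMap (A := (D.bracketNeg k χ ν e he).shift (-1))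
      (B := D.bracketPos k χ ν e he) (D.kinkGenusOne k χ ν e he) ∧
    TangleCob.GradedCx.Mat.Eqv
      (TangleCob.GradedCx.Mat.comp (A := D.bracketNil k χ ν) (B := D.bracketNeg k χ ν e he)
        (C := D.bracketPos k χ ν e he) (D.reidNeg k χ ν e he) (D.kinkGenusOne k χ ν e he))
      (D.reidPos k χ ν e he) :=
  ⟨D.bracket_isComplex k χ _, (D.kinkNeg e he).bracket_isComplex k (χ.kink e he) ν,
    (D.kinkPos e he).bracket_isComplex k (χ.kink e he) ν, D.reidNeg_isChainMap k χ ν e he,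
    D.reidPos_isChainMap k χ ν e he,
    (D.kink e he).genusOne_isChainMap k (χ.kink e he) ν none,
    D.reidNeg_comp_genusOne k χ ν e he⟩
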